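/- Let $d_1,d_2,d'\ge 1$ be integers, $A=\mathbb R^{d'}$, $T>0$, $\epsilon>0$, and let the following hold. (i) $b:\mathbb R^{d_1}\times A\to\mathbb R^{d_1}$ is of class $C^4$, $b(x,0)=0$ for all $x$, and for some $C\ge 0$ one has $|\nabla_x^k\nabla_a^l b(x,a)|\le C(1+|a|^{k+1})(1+|x|^l)$ for all $(x,a)$ and all integers $k,l\ge 0$ with $k+l\le 4$. (ii) $\ell:A\to\mathbb R$ is convex, of class $C^2$, and for some $c>0$ one has $\nabla^2\ell(a)\ge c(1+|a|^2)I_{d'}$ for all $a\in A$. Put $\nu^\infty(da)=e^{-\ell(a)}da\,/\int_A e^{-\ell(a')}da'$. (iii) $L:\mathbb R^{d_1}\times\mathbb R^{d_2}\to\mathbb R$ is bounded from below and three times differentiable, and for some $K$ one has $|L(x,y)|\le K(1+|x|^2+|y|^2)$ and $|\nabla^kL(x,y)|\le K(1+|x|+|y|)$ for $k=1,2,3$ and all $(x,y)$. For $t_0\in[0,T]$ let $\mathcal A(t_0)$ be the set of measurable maps $\boldsymbol\nu:t\in[t_0,T]\mapsto\nu_t\in\mathcal P(A)$ such that $\int_{t_0}^T\mathcal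 E(\nu_t|\nu^\infty)\,dt<\infty$, where $\mathcal E(\nu|\nu^\infty)=\int_A\log\frac{d\nu}{d\nu^\infty}\,d\nu$ if $\nu\ll\nu^\infty$ and $+\infty$ otherwise. Identify $\boldsymbol\nu$ with the measure $d\nu_t(a)\,dt$ on $[t_0,T]\times A$, of total mass $T-t_0$; the weak topology on $\mathcal A(t_0)$ is that of weak convergence of these measures against bounded continuous functions. Let $\mathcal P_2$ be the set of Borel probability measures on $\mathbb R^{d_1}\times\mathbb R^{d_2}$ with a finite second moment, with the Monge–Kantorovich distance $d_2$, and let $(t_0,\gamma_0)\in[0,T]\times\mathcal P_2$. Then: 1. For every $\boldsymbol\nu\in\mathcal A(t_0)$ there is exactly one $\boldsymbol\gamma\in C([t_0,T],\mathcal P_2)$ that solves the continuity equation $\partial_t\gamma_t+\operatorname{div}_x\bigl(\int_A b(\cdot,a)\,d\nu_t(a)\,\gamma_t\bigr)=0$ with initial condition $\gamma_0$ at time $t_0$, i.e. such that for every $C^1$ function $\varphi$ of $(t,x,y)$ that is bounded together with its first derivatives and every $t_1\in[t_0,T]$, $$\int\varphi_{t_1}\,d\gamma_{t_1}=\int\varphi_{t_0}\,d\gamma_0+\int_{t_0}^{t_1}\!\int\Bigl\{\partial_t\varphi_t(x,y)+\int_A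 b(x,a)\,d\nu_t(a)\cdot\nabla_x\varphi_t(x,y)\Bigr\}d\gamma_t(x,y)\,dt.$$ Hence the cost $$J((t_0,\gamma_0),\boldsymbol\nu)=\int L\,d\gamma_T+\epsilon\int_{t_0}^T\mathcal E(\nu_t|\nu^\infty)\,dt$$ is well defined. 2. For every $M\in\mathbb R$ the sub-level set $\{\boldsymbol\nu\in\mathcal A(t_0):J((t_0,\gamma_0),\boldsymbol\nu)\le M\}$ is compact (in particular relatively compact), for the weak topology, in the set of positive measures of mass $T-t_0$ on $[t_0,T]\times A$. 3. The functional $\boldsymbol\nu\in\mathcal A(t_0)\mapsto J((t_0,\gamma_0),\boldsymbol\nu)$ is lower semicontinuous for the weak topology. 4. There is at least one minimizer: some $\boldsymbol\nu^*\in\mathcal A(t_0)$ satisfies $J((t_0,\gamma_0),\boldsymbol\nu^*)\le J((t_0,\gamma_0),\boldsymbol\nu)$ for all $\boldsymbol\nu\in\mathcal A(t_0)$. -/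

import Mathlib

open MeasureTheory ProbabilityTheory Set Filter Topology
open scoped ENNReal

/-- `RSp d` is `ℝ^d` with its Euclidean norm. -/
abbrev RSp (d : ℕ) : Type := EuclideanSpace ℝ (Fin d)

/-! ### Assumptions on the data -/

/-- The mixed derivative `∇_x^k ∇_a^l b (x, a)`. -/
noncomputable def mixedDeriv {d₁ d' : ℕ} (b : RSp d₁ → RSp d' → RSp d₁) (k l : ℕ)
    (x : RSp d₁) (a : RSp d') :=
  iteratedFDeriv ℝ k (fun x' : RSp d₁ => iteratedFDeriv ℝ l (fun a' : RSp d' => b x' a') a) x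

/-- Regularity and growth of the velocity field `b : ℝ^{d₁} × A → ℝ^{d₁}`. -/
structure RegularField {d₁ d' : ℕ} (b : RSp d₁ → RSp d' → RSp d₁) : Prop where
  contDiff : ContDiff ℝ 4 (fun p : RSp d₁ × RSp d' => b p.1 p.2)
  growth : ∃ C : ℝ, 0 ≤ C ∧ ∀ k l : ℕ, k + l ≤ 4 → ∀ (x : RSp d₁) (a : RSp d'),
    ‖mixedDeriv b k l x a‖ ≤ C * (1 + ‖a‖ ^ (k + 1)) * (1 + ‖x‖ ^ l)
  zero_right : ∀ x : RSp d₁, b x 0 = 0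

/-- The potential `ℓ` is convex, of class `C²`, and `∇²ℓ(a) ≥ c (1 + |a|²) I`. -/
structure RegularPotential {d' : ℕ} (ℓ : RSp d' → ℝ) : Prop where
  contDiff : ContDiff ℝ 2 ℓ
  convexOn : ConvexOn ℝ univ ℓ
  hessian : ∃ c : ℝ, 0 < c ∧ ∀ a v : RSp d',
    c * (1 + ‖a‖ ^ 2) * ‖v‖ ^ 2 ≤ iteratedFDeriv ℝ 2 ℓ a (fun _ => v)

/-- The terminal cost `L` is bounded from below, three times differentiable, `L` has at most
quadratic growth and its derivatives of order `1, 2, 3` have at most linear growth. -/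
structure RegularCost {d₁ d₂ : ℕ} (L : RSp d₁ × RSp d₂ → ℝ) : Prop where
  bddBelow : ∃ m : ℝ, ∀ z, m ≤ L z
  differentiable : ∀ k < 3, Differentiable ℝ (iteratedFDeriv ℝ k L)
  growth : ∃ K : ℝ, ∀ z : RSp d₁ × RSp d₂,
    |L z| ≤ K * (1 + ‖z.1‖ ^ 2 + ‖z.2‖ ^ 2) ∧
    ∀ k : ℕ, 1 ≤ k → k ≤ 3 → ‖iteratedFDeriv ℝ k L z‖ ≤ K * (1 + ‖z.1‖ + ‖z.2‖)

/-- The prior `ν^∞(da) = exp(-ℓ(a)) da / ∫ exp(-ℓ)`. -/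
noncomputable def priorMeasure {d' : ℕ} (ℓ : RSp d' → ℝ) : Measure (RSp d') :=
  (volume : Measure (RSp d')).tilted (fun a => -ℓ a)

/-! ### The space `P₂(ℝ^{d₁} × ℝ^{d₂})` and the distance `d₂` -/

/-- Borel probability measures on `ℝ^{d₁} × ℝ^{d₂}` with a finite second moment. -/
@[ext]
structure PTwo (d₁ d₂ : ℕ) where
  meas : Measure (RSp d₁ × RSp d₂)
  isProbabilityMeasure : IsProbabilityMeasure meas
  secondMoment : ∫⁻ z, ENNReal.ofReal (‖z.1‖ ^ 2 + ‖z.2‖ ^ 2) ∂meas < ∞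

/-- The Monge-Kantorovich-Rubinstein distance of order two (for the Euclidean norm of
`ℝ^{d₁} × ℝ^{d₂}`). -/
noncomputable def distTwo {d₁ d₂ : ℕ} (μ ν : PTwo d₁ d₂) : ℝ≥0∞ :=
  (⨅ π ∈ {π : Measure ((RSp d₁ × RSp d₂) × (RSp d₁ × RSp d₂)) |
        π.map Prod.fst = μ.meas ∧ π.map Prod.snd = ν.meas},
      ∫⁻ p, ENNReal.ofReal (‖p.1.1 - p.2.1‖ ^ 2 + ‖p.1.2 - p.2.2‖ ^ 2) ∂π) ^ (1 / 2 : ℝ)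

/-! ### Admissible controls -/

/-- Lebesgue measure on `[t₀, T]`. -/
noncomputable def lebIcc (t₀ T : ℝ) : Measure (Icc t₀ T) :=
  (volume : Measure ℝ).comap Subtype.val

theorem lebIcc_isFiniteMeasure (t₀ T : ℝ) : IsFiniteMeasure (lebIcc t₀ T) := ⟨by
  rw [lebIcc, Measure.comap_apply _ Subtype.val_injective
    (fun s hs => measurableSet_Icc.subtype_image hs) _ MeasurableSet.univ,
    image_univ, Subtype.range_coe]
  exact measure_Icc_lt_top⟩

/-- The set `𝒜(t₀)`: measurable maps `t ∈ [t₀, T] ↦ ν_t ∈ 𝒫(A)` with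
`∫_{t₀}^T ℰ(ν_t | ν^∞) dt < ∞`. -/
@[ext]
structure AdmissibleControl {d' : ℕ} (ℓ : RSp d' → ℝ) (t₀ T : ℝ) where
  kernel : Kernel (Icc t₀ T) (RSp d')
  isMarkovKernel : IsMarkovKernel kernel
  entropy : ∫⁻ t, InformationTheory.klDiv (kernel t) (priorMeasure ℓ) ∂(lebIcc t₀ T) < ∞

/-- The measure `Leb_{[t₀,T]} ⊗ (ν_t)_t` on `[t₀, T] × A` attached to a control. Its values lie in
the closed set of the measures of total mass `T - t₀`, and `FiniteMeasure` carries the topology of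
weak convergence (against bounded continuous functions). -/
noncomputable def AdmissibleControl.toFiniteMeasure {d' : ℕ} {ℓ : RSp d' → ℝ} {t₀ T : ℝ}
    (ν : AdmissibleControl ℓ t₀ T) : FiniteMeasure (Icc t₀ T × RSp d') :=
  ⟨lebIcc t₀ T ⊗ₘ ν.kernel, by
    have h1 : IsMarkovKernel ν.kernel := ν.isMarkovKernel
    have h2 := lebIcc_isFiniteMeasure t₀ T
    infer_instance⟩

/-- The weak topology on `𝒜(t₀)`. -/
noncomputable instance {d' : ℕ} {ℓ : RSp d' → ℝ} {t₀ T : ℝ} :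
    TopologicalSpace (AdmissibleControl ℓ t₀ T) :=
  TopologicalSpace.induced AdmissibleControl.toFiniteMeasure inferInstance

/-! ### The continuity equation and the cost -/

/-- `γ ∈ C([t₀,T], P₂)` solves `∂_t γ_t + div_x (b(x, ν_t) γ_t) = 0`, `γ_{t₀} = γ₀`, where
`b(x, ν_t) = ∫_A b(x, a) dν_t(a)`, in the sense of distributions: it is tested against the
functions `φ` of `(t, (x, y))` of class `C¹` that are bounded together with their first
derivatives. -/
structure IsContinuitySolution {d₁ d₂ d' : ℕ} (b : RSp d₁ → RSp d' → RSp d₁)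
    {ℓ : RSp d' → ℝ} {t₀ T : ℝ} (ν : AdmissibleControl ℓ t₀ T) (γ₀ : PTwo d₁ d₂)
    (γ : Icc t₀ T → PTwo d₁ d₂) : Prop where
  continuous : ∀ s : Icc t₀ T, Tendsto (fun t => distTwo (γ t) (γ s)) (𝓝 s) (𝓝 0)
  weak_eq : ∀ φ : ℝ × (RSp d₁ × RSp d₂) → ℝ, ContDiff ℝ 1 φ →
    (∃ K : ℝ, ∀ p, |φ p| ≤ K ∧ ‖fderiv ℝ φ p‖ ≤ K) →
    ∀ t₁ : Icc t₀ T,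
      ∫ z, φ (t₁, z) ∂(γ t₁).meas =
        ∫ z, φ (t₀, z) ∂γ₀.meas +
        ∫ t in Iic t₁, (∫ z : RSp d₁ × RSp d₂,
          (fderiv ℝ φ (t, z) (1, (0, 0)) +
            fderiv ℝ φ (t, z) (0, (∫ a, b z.1 a ∂(ν.kernel t), 0))) ∂(γ t).meas) ∂(lebIcc t₀ T)

open Classical in
/-- The curve `γ` driven by the control `ν` from `γ₀`: the solution of the continuity equation
(with a default value if there were none). -/
noncomputable def stateCurve {d₁ d₂ d' : ℕ} (b : RSp d₁ → RSp d' → RSp d₁)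
    {ℓ : RSp d' → ℝ} {t₀ T : ℝ} (γ₀ : PTwo d₁ d₂) (ν : AdmissibleControl ℓ t₀ T) :
    Icc t₀ T → PTwo d₁ d₂ :=
  if h : ∃ γ, IsContinuitySolution b ν γ₀ γ then h.choose else fun _ => γ₀

/-- The total cost
`J((t₀, γ₀), ν) = ∫ L dγ_T + ε ∫_{t₀}^T ℰ(ν_t | ν^∞) dt`. -/
noncomputable def totalCost {d₁ d₂ d' : ℕ} (b : RSp d₁ → RSp d' → RSp d₁) {ℓ : RSp d' → ℝ}
    (L : RSp d₁ × RSp d₂ → ℝ) (ε : ℝ) {t₀ T : ℝ} (h : t₀ ≤ T) (γ₀ : PTwo d₁ d₂)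
    (ν : AdmissibleControl ℓ t₀ T) : ℝ :=
  ∫ z, L z ∂(stateCurve b γ₀ ν ⟨T, right_mem_Icc.2 h⟩).meas +
    ε * (∫⁻ t, InformationTheory.klDiv (ν.kernel t) (priorMeasure ℓ) ∂(lebIcc t₀ T)).toReal

set_option linter.unusedSectionVars false

/-! The Hessian bound makes `ℓ` grow at least like a quartic, so `exp (c‖a‖ ^ 4)` is integrable for
the prior for some `c > 0`. By Young's inequality between `klFun` and `exp - 1`, the entropy then
controls fourth moments: an admissible control satisfies `∫∫ ‖a‖ ^ 4 dν_t dt < ∞`, uniformly on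
entropy sublevels (`AdmissibleControl.exists_lintegral_fourth_le`). Since `b(·, a)` is bounded by
`C(1 + ‖a‖)` and is Lipschitz with constant `C(1 + ‖a‖ ^ 2)`, the averaged drift is bounded by, and
Lipschitz with constant, a modulus `κ` of time whose square is integrable
(`DriftBounds.caratheodoryField`). All the differential equations rest on this.

Existence in item 1: Picard iteration in an exponentially weighted norm gives a flow
(`CaratheodoryField.exists_flow`), and the push-forward of `γ₀` solves the continuity equation.
Uniqueness: over a short interval `[s, t]`, testing `γ_t` with `ψ` is the same as testing `γ_s` with
`ψ` composed with the frozen displacement `x + ∫_s^t B_r(x) dr`, up to an error of smaller order.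
The displaced test functions stay in the same class, and their constants multiply into an
exponential; continuous induction in time then shows that two solutions agree against every test
function (`IsTransported.integral_eq`), and sines and cosines of linear forms separate measures.

Compactness: the time integral of the entropy is the entropy of `dν_t dt` relative to Lebesgue times
the prior (`lintegral_klDiv_eq_klDiv_compProd`). A dual formula over bounded continuous functions
makes it weakly lower semicontinuous (`isClosed_klDiv_le`). Fourth moments give tightness, and
disintegration shows that no limit leaves the set of controls; hence entropy sublevels are compact.

Continuity: on an entropy sublevel the drift along a fixed curve, integrated in time, depends
continuously on the control. A stability form of Grönwall's inequality carries this over to the flow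
(`tendsto_flow`), and dominated convergence to the terminal cost. The cost is therefore, on each
entropy sublevel, a continuous function plus a lower semicontinuous one. As `L` is bounded below,
large entropy forces large cost, and items 2, 3 and 4 follow by the direct method. -/

/-! ### Carathéodory differential equations with a square-integrable Lipschitz modulus -/

/-- A nonnegative measurable function on `ℝ` which is locally square-integrable. -/
structure SquareModulus (κ : ℝ → ℝ) : Prop where
  measurable : Measurable κ
  nonneg : ∀ s, 0 ≤ κ s
  sq_integrable : ∀ a b, IntervalIntegrable (fun s => κ s ^ 2) volume a b

namespace SquareModulus

variable {κ : ℝ → ℝ}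

theorem intervalIntegrable_mul (hκ : SquareModulus κ) {f : ℝ → ℝ} (hf : Continuous f) (a b : ℝ) :
    IntervalIntegrable (fun s => κ s * f s) volume a b := by
  have h1 : IntervalIntegrable (fun s => κ s ^ 2 + f s ^ 2) volume a b :=
    (hκ.sq_integrable a b).add ((hf.pow 2).intervalIntegrable a b)
  refine h1.mono_fun (hκ.measurable.mul hf.measurable).aestronglyMeasurable
    (ae_of_all _ fun s => ?_)
  change |κ s * f s| ≤ |κ s ^ 2 + f s ^ 2|
  rw [abs_of_nonneg (add_nonneg (sq_nonneg (κ s)) (sq_nonneg (f s))), abs_le]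
  constructor <;> nlinarith [sq_nonneg (κ s + f s), sq_nonneg (κ s - f s), sq_nonneg (κ s),
    sq_nonneg (f s)]

theorem intervalIntegrable (hκ : SquareModulus κ) (a b : ℝ) : IntervalIntegrable κ volume a b := by
  simpa using hκ.intervalIntegrable_mul (continuous_const (y := (1 : ℝ))) a b

/-- The exponential weight `exp (2 (1 + N) s)` absorbs half of a modulus with square integral at
most `N`. -/
theorem integral_mul_exp_le (hκ : SquareModulus κ) {t₀ T N : ℝ}
    (hN : ∫ s in t₀..T, κ s ^ 2 ≤ N) {t : ℝ} (ht : t ∈ Icc t₀ T) :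
    ∫ s in t₀..t, κ s * Real.exp (2 * (1 + N) * s) ≤ 2⁻¹ * Real.exp (2 * (1 + N) * t) := by
  have hmono : ∫ s in t₀..t, κ s ^ 2 ≤ N :=
    (intervalIntegral.integral_mono_interval le_rfl ht.1 ht.2
      (ae_of_all _ fun s => sq_nonneg _) (hκ.sq_integrable _ _)).trans hN
  have hN0 : 0 ≤ N :=
    (intervalIntegral.integral_nonneg ht.1 fun s _ => sq_nonneg (κ s)).trans hmono
  set c : ℝ := 2 * (1 + N) with hc
  have hc0 : 0 < c := by positivity
  have hexp : ∫ s in t₀..t, Real.exp (2 * c * (s - t)) ≤ (2 * c)⁻¹ := by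
    have hd : ∀ s ∈ uIcc t₀ t, HasDerivAt (fun s => (2 * c)⁻¹ * Real.exp (2 * c * (s - t)))
        (Real.exp (2 * c * (s - t))) s := by
      intro s _
      have h1 : HasDerivAt (fun s => 2 * c * (s - t)) (2 * c * 1) s :=
        ((hasDerivAt_id s).sub_const t).const_mul _
      convert! (h1.exp.const_mul ((2 * c)⁻¹)) using 1
      field_simp
    rw [intervalIntegral.integral_eq_sub_of_hasDerivAt hd
      ((by fun_prop : Continuous fun s => Real.exp (2 * c * (s - t))).intervalIntegrable _ _)]
    have : 0 ≤ (2 * c)⁻¹ * Real.exp (2 * c * (t₀ - t)) := by positivity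
    simp only [sub_self, mul_zero, Real.exp_zero, mul_one]
    linarith
  -- Young's inequality with weight `c`. After integration the two terms contribute at most `N /
  -- (2c)` and `1/4`, and `c = 2(1 + N)` makes the first at most `1/4` as well.
  have hpt : ∀ s, κ s * Real.exp (c * s) ≤
      Real.exp (c * t) * (c⁻¹ / 2 * κ s ^ 2 + c / 2 * Real.exp (2 * c * (s - t))) := by
    intro s
    have e1 : Real.exp (c * s) = Real.exp (c * t) * Real.exp (c * (s - t)) := by
      rw [← Real.exp_add]; ring_nf
    have e2 : Real.exp (2 * c * (s - t)) = Real.exp (c * (s - t)) ^ 2 := by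
      rw [← Real.exp_nat_mul]; push_cast; ring_nf
    rw [e1, e2]
    set r := Real.exp (c * (s - t))
    have : κ s * r ≤ c⁻¹ / 2 * κ s ^ 2 + c / 2 * r ^ 2 := by
      have h := mul_nonneg (inv_nonneg.2 hc0.le) (sq_nonneg (κ s - c * r))
      have h' : c⁻¹ * (κ s - c * r) ^ 2 = c⁻¹ * κ s ^ 2 - 2 * (κ s * r) + c * r ^ 2 := by
        field_simp; ring
      linarith
    calc κ s * (Real.exp (c * t) * r) = Real.exp (c * t) * (κ s * r) := by ring
      _ ≤ _ := mul_le_mul_of_nonneg_left this (Real.exp_pos _).le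
  have hi1 : IntervalIntegrable (fun s => c⁻¹ / 2 * κ s ^ 2) volume t₀ t :=
    (hκ.sq_integrable _ _).const_mul _
  have hi2 : IntervalIntegrable (fun s => c / 2 * Real.exp (2 * c * (s - t))) volume t₀ t :=
    (by fun_prop : Continuous fun s => c / 2 * Real.exp (2 * c * (s - t))).intervalIntegrable _ _
  calc ∫ s in t₀..t, κ s * Real.exp (c * s)
      ≤ ∫ s in t₀..t,
          Real.exp (c * t) * (c⁻¹ / 2 * κ s ^ 2 + c / 2 * Real.exp (2 * c * (s - t))) :=
        intervalIntegral.integral_mono_on ht.1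
          (hκ.intervalIntegrable_mul (by fun_prop) _ _) ((hi1.add hi2).const_mul _)
          fun s _ => hpt s
    _ = Real.exp (c * t) * (c⁻¹ / 2 * (∫ s in t₀..t, κ s ^ 2) +
          c / 2 * ∫ s in t₀..t, Real.exp (2 * c * (s - t))) := by
        rw [intervalIntegral.integral_const_mul, intervalIntegral.integral_add hi1 hi2,
          intervalIntegral.integral_const_mul, intervalIntegral.integral_const_mul]
    _ ≤ Real.exp (c * t) * (c⁻¹ / 2 * N + c / 2 * (2 * c)⁻¹) := by gcongr
    _ ≤ 2⁻¹ * Real.exp (c * t) := by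
        have h1 : c⁻¹ / 2 * N + c / 2 * (2 * c)⁻¹ ≤ 2⁻¹ := by
          have : c⁻¹ / 2 * N + c / 2 * (2 * c)⁻¹ = N / (2 * c) + 1 / 4 := by field_simp; ring
          rw [this]
          have : N / (2 * c) ≤ 1 / 4 := by rw [div_le_iff₀ (by positivity), hc]; linarith
          linarith
        rw [mul_comm]; gcongr

/-- Grönwall's inequality with a square-integrable modulus. -/
theorem gronwall (hκ : SquareModulus κ) {t₀ T N g : ℝ}
    (hN : ∫ s in t₀..T, κ s ^ 2 ≤ N) (hg : 0 ≤ g) {u : ℝ → ℝ} (hu : Continuous u)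
    (hu0 : ∀ t, 0 ≤ u t)
    (h : ∀ t ∈ Icc t₀ T, u t ≤ g + ∫ s in t₀..t, κ s * u s) {t : ℝ} (ht : t ∈ Icc t₀ T) :
    u t ≤ 2 * Real.exp (2 * (1 + N) * (T - t₀)) * g := by
  have hN0 : 0 ≤ N :=
    (intervalIntegral.integral_nonneg (ht.1.trans ht.2) fun s _ => sq_nonneg (κ s)).trans hN
  set c : ℝ := 2 * (1 + N) with hc
  have hc0 : 0 < c := by positivity
  -- At a maximum point of the weighted function, the integral term is at most half of the maximum
  -- `S` and is absorbed on the left.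
  obtain ⟨r, hr, hmax⟩ := isCompact_Icc.exists_isMaxOn (⟨t, ht⟩ : (Icc t₀ T).Nonempty)
    (by fun_prop : Continuous fun s => Real.exp (-(c * s)) * u s).continuousOn
  set S := Real.exp (-(c * r)) * u r with hS
  have hS0 : 0 ≤ S := mul_nonneg (Real.exp_pos _).le (hu0 r)
  have hle : ∀ s ∈ Icc t₀ T, u s ≤ Real.exp (c * s) * S := by
    intro s hs
    have h1 : Real.exp (-(c * s)) * u s ≤ S := hmax hs
    calc u s = Real.exp (c * s) * (Real.exp (-(c * s)) * u s) := by
          rw [← mul_assoc, ← Real.exp_add]; simp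
      _ ≤ _ := by gcongr
  have h2 : u r ≤ g + S * (2⁻¹ * Real.exp (c * r)) := by
    refine (h r hr).trans (add_le_add_right ?_ g)
    calc ∫ s in t₀..r, κ s * u s ≤ ∫ s in t₀..r, S * (κ s * Real.exp (c * s)) := by
          refine intervalIntegral.integral_mono_on hr.1 (hκ.intervalIntegrable_mul hu _ _)
            ((hκ.intervalIntegrable_mul (by fun_prop) _ _).const_mul _) fun s hs => ?_
          calc κ s * u s ≤ κ s * (Real.exp (c * s) * S) :=
                mul_le_mul_of_nonneg_left (hle s ⟨hs.1, hs.2.trans hr.2⟩) (hκ.nonneg s)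
            _ = _ := by ring
      _ = S * ∫ s in t₀..r, κ s * Real.exp (c * s) := intervalIntegral.integral_const_mul _ _
      _ ≤ _ := mul_le_mul_of_nonneg_left (hκ.integral_mul_exp_le hN hr) hS0
  have h3 : S ≤ 2 * (Real.exp (-(c * r)) * g) := by
    have h4 : S ≤ Real.exp (-(c * r)) * (g + S * (2⁻¹ * Real.exp (c * r))) :=
      mul_le_mul_of_nonneg_left h2 (Real.exp_pos _).le
    have h5 : Real.exp (-(c * r)) * Real.exp (c * r) = 1 := by rw [← Real.exp_add]; simp
    nlinarith
  calc u t ≤ Real.exp (c * t) * S := hle t ht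
    _ ≤ Real.exp (c * t) * (2 * (Real.exp (-(c * r)) * g)) := by gcongr
    _ = 2 * Real.exp (c * (t - r)) * g := by
        rw [mul_sub, sub_eq_add_neg, Real.exp_add]; ring
    _ ≤ 2 * Real.exp (c * (T - t₀)) * g := by
        gcongr
        · exact ht.2
        · exact hr.1

end SquareModulus

/-- A time-dependent vector field on `ℝ × E` which is measurable, bounded by `κ` and
`κ`-Lipschitz in space. -/
structure CaratheodoryField {E : Type*} [NormedAddCommGroup E] [MeasurableSpace E]
    (B : ℝ → E → E) (κ : ℝ → ℝ) : Prop where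
  measurable : Measurable (Function.uncurry B)
  modulus : SquareModulus κ
  bound : ∀ s x, ‖B s x‖ ≤ κ s
  lipschitz : ∀ s x y, ‖B s x - B s y‖ ≤ κ s * ‖x - y‖

namespace CaratheodoryField

variable {E : Type*} [NormedAddCommGroup E] [MeasurableSpace E] [BorelSpace E]
  [SecondCountableTopology E] {B : ℝ → E → E} {κ : ℝ → ℝ}

theorem intervalIntegrable (hB : CaratheodoryField B κ) {u : ℝ → E} (hu : Continuous u)
    (a b : ℝ) : IntervalIntegrable (fun s => B s (u s)) volume a b :=
  (hB.modulus.intervalIntegrable a b).mono_fun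
    (hB.measurable.comp (measurable_id.prodMk hu.measurable)).aestronglyMeasurable
    (ae_of_all _ fun s => (hB.bound s _).trans (Real.le_norm_self _))

variable [NormedSpace ℝ E]

theorem norm_integral_sub_le (hB : CaratheodoryField B κ) {u v : ℝ → E} (hu : Continuous u)
    (hv : Continuous v) {a b : ℝ} (hab : a ≤ b) :
    ‖(∫ s in a..b, B s (u s)) - ∫ s in a..b, B s (v s)‖ ≤ ∫ s in a..b, κ s * ‖u s - v s‖ := by
  rw [← intervalIntegral.integral_sub (hB.intervalIntegrable hu a b) (hB.intervalIntegrable hv a b)]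
  exact intervalIntegral.norm_integral_le_of_norm_le hab
    (ae_of_all _ fun s _ => hB.lipschitz s _ _) (hB.modulus.intervalIntegrable_mul (by fun_prop) _ _)

variable [CompleteSpace E]

/-- Every initial condition is the starting point of a solution. -/
theorem exists_solution (hB : CaratheodoryField B κ) {t₀ T : ℝ} (h : t₀ ≤ T) (x : E) :
    ∃ u : ℝ → E, Continuous u ∧ (∀ t, u t = u (projIcc t₀ T h t)) ∧
      ∀ t ∈ Icc t₀ T, u t = x + ∫ s in t₀..t, B s (u s) := by
  set N := ∫ s in t₀..T, κ s ^ 2 with hN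
  set c : ℝ := 2 * (1 + N) with hc
  let lift : C(Icc t₀ T, E) → ℝ → E := fun w s => Real.exp (c * s) • w (projIcc t₀ T h s)
  have hlift : ∀ w, Continuous (lift w) := fun w =>
    (by fun_prop : Continuous fun s : ℝ => Real.exp (c * s)).smul
      (w.continuous.comp continuous_projIcc)
  have hprim : ∀ w, Continuous fun t : ℝ => ∫ s in t₀..t, B s (lift w s) := fun w =>
    intervalIntegral.continuous_primitive (fun a b => hB.intervalIntegrable (hlift w) a b) t₀
  let Φ : C(Icc t₀ T, E) → C(Icc t₀ T, E) := fun w =>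
    ⟨fun t => Real.exp (-(c * t)) • (x + ∫ s in t₀..t, B s (lift w s)), by
      have := hprim w
      exact (by fun_prop : Continuous fun t : Icc t₀ T => Real.exp (-(c * t))).smul
        (continuous_const.add (this.comp continuous_subtype_val))⟩
  have hΦ : ContractingWith 2⁻¹ Φ := by
    refine ⟨by rw [← NNReal.coe_lt_coe]; norm_num, LipschitzWith.of_dist_le_mul fun w w' => ?_⟩
    rw [ContinuousMap.dist_le (by positivity)]
    intro t
    have e1 : Φ w t - Φ w' t = Real.exp (-(c * t)) •
        ((∫ s in t₀..t, B s (lift w s)) - ∫ s in t₀..t, B s (lift w' s)) := by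
      change Real.exp (-(c * t)) • (x + ∫ s in t₀..t, B s (lift w s)) -
        Real.exp (-(c * t)) • (x + ∫ s in t₀..t, B s (lift w' s)) = _
      rw [← smul_sub, add_sub_add_left_eq_sub]
    rw [dist_eq_norm, e1, norm_smul, Real.norm_eq_abs, abs_of_pos (Real.exp_pos _)]
    have e2 : ∀ s, κ s * ‖lift w s - lift w' s‖ ≤ dist w w' * (κ s * Real.exp (c * s)) := by
      intro s
      have : ‖lift w s - lift w' s‖ ≤ Real.exp (c * s) * dist w w' := by
        rw [← smul_sub, norm_smul, Real.norm_eq_abs, abs_of_pos (Real.exp_pos _), ← dist_eq_norm]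
        gcongr
        exact ContinuousMap.dist_apply_le_dist _
      calc _ ≤ κ s * (Real.exp (c * s) * dist w w') :=
            mul_le_mul_of_nonneg_left this (hB.modulus.nonneg s)
        _ = _ := by ring
    calc Real.exp (-(c * t)) *
          ‖(∫ s in t₀..t, B s (lift w s)) - ∫ s in t₀..t, B s (lift w' s)‖
        ≤ Real.exp (-(c * t)) * ∫ s in t₀..t, dist w w' * (κ s * Real.exp (c * s)) := by
          gcongr
          refine (hB.norm_integral_sub_le (hlift w) (hlift w') t.2.1).trans ?_
          exact intervalIntegral.integral_mono_on t.2.1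
            (hB.modulus.intervalIntegrable_mul ((hlift w).sub (hlift w')).norm _ _)
            ((hB.modulus.intervalIntegrable_mul (by fun_prop) _ _).const_mul _) fun s _ => e2 s
      _ ≤ Real.exp (-(c * t)) * (dist w w' * (2⁻¹ * Real.exp (c * t))) := by
          rw [intervalIntegral.integral_const_mul]
          gcongr
          exact hB.modulus.integral_mul_exp_le hN.ge t.2
      _ = (2⁻¹ : NNReal) * dist w w' := by
          have : Real.exp (-(c * t)) * Real.exp (c * t) = 1 := by rw [← Real.exp_add]; simp
          push_cast
          linear_combination 2⁻¹ * dist w w' * this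
  have : Nonempty C(Icc t₀ T, E) := ⟨ContinuousMap.const _ 0⟩
  set w := hΦ.fixedPoint Φ with hw
  have hfix : Φ w = w := hΦ.fixedPoint_isFixedPt
  have hval : ∀ t ∈ Icc t₀ T, lift w t = x + ∫ s in t₀..t, B s (lift w s) := by
    intro t ht
    have h1 : w ⟨t, ht⟩ = Real.exp (-(c * t)) • (x + ∫ s in t₀..t, B s (lift w s)) := by
      conv_lhs => rw [← hfix]
      rfl
    change Real.exp (c * t) • w (projIcc t₀ T h t) = _
    rw [projIcc_of_mem h ht, h1, smul_smul, ← Real.exp_add]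
    simp
  refine ⟨fun t => lift w (projIcc t₀ T h t), (hlift w).comp
    (continuous_subtype_val.comp continuous_projIcc), fun t => by simp, fun t ht => ?_⟩
  have hcongr : ∫ s in t₀..t, B s (lift w (projIcc t₀ T h s)) = ∫ s in t₀..t, B s (lift w s) := by
    refine intervalIntegral.integral_congr fun s hs => ?_
    rw [uIcc_of_le ht.1] at hs
    simp only [projIcc_of_mem h (show s ∈ Icc t₀ T from ⟨hs.1, hs.2.trans ht.2⟩)]
  rw [hcongr]
  simp only [projIcc_of_mem h ht]
  exact hval t ht

/-- `X` is a flow of `B` on `[t₀, T]`, extended by constants in time. -/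
structure IsFlow (B : ℝ → E → E) (t₀ T : ℝ) (X : ℝ → E → E) : Prop where
  continuous : Continuous (Function.uncurry X)
  eq : ∀ t ∈ Icc t₀ T, ∀ x, X t x = x + ∫ s in t₀..t, B s (X s x)

/-- Solutions are chosen one starting point at a time. Grönwall's inequality makes them Lipschitz in
the starting point, uniformly in time, and with continuity in time this yields joint continuity. -/
theorem exists_flow (hB : CaratheodoryField B κ) {t₀ T : ℝ} (h : t₀ ≤ T) :
    ∃ X : ℝ → E → E, IsFlow B t₀ T X := by
  choose u hc hp he using fun x => hB.exists_solution h x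
  refine ⟨fun t x => u x t, ?_, fun t ht x => he x t ht⟩
  set C := 2 * Real.exp (2 * (1 + ∫ s in t₀..T, κ s ^ 2) * (T - t₀))
  have hC : 0 ≤ C := by positivity
  refine continuous_prod_of_continuous_lipschitzWith' _ ⟨C, hC⟩ (fun t => ?_) hc
  refine LipschitzWith.of_dist_le_mul fun x y => ?_
  change dist (u x t) (u y t) ≤ C * dist x y
  rw [hp x, hp y, dist_eq_norm, dist_eq_norm]
  refine hB.modulus.gronwall le_rfl (norm_nonneg _) (u := fun t => ‖u x t - u y t‖)
    ((hc x).sub (hc y)).norm (fun _ => norm_nonneg _) (fun r hr => ?_) (projIcc t₀ T h t).2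
  rw [he x r hr, he y r hr, add_sub_add_comm]
  exact (norm_add_le _ _).trans (add_le_add_right
    (hB.norm_integral_sub_le (hc x) (hc y) hr.1) _)

end CaratheodoryField

namespace CaratheodoryField

/-! ### Test functions along the flow -/

variable {E : Type*} [NormedAddCommGroup E] [NormedSpace ℝ E] [CompleteSpace E]
  [MeasurableSpace E] [BorelSpace E] [SecondCountableTopology E] {B : ℝ → E → E} {κ : ℝ → ℝ}
  {F : Type*} [NormedAddCommGroup F] [NormedSpace ℝ F] [MeasurableSpace F] [BorelSpace F]
  [SecondCountableTopology F]
  {t₀ T : ℝ} {X : ℝ → E → E}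

theorem IsFlow.apply_start (hX : IsFlow B t₀ T X) (h : t₀ ≤ T) (x : E) : X t₀ x = x := by
  simpa using hX.eq t₀ (left_mem_Icc.2 h) x

theorem IsFlow.continuous_time (hX : IsFlow B t₀ T X) (x : E) : Continuous fun t => X t x :=
  hX.continuous.comp (continuous_id.prodMk continuous_const)

theorem IsFlow.norm_sub_le (hB : CaratheodoryField B κ) (hX : IsFlow B t₀ T X) {s t : ℝ}
    (hs : t₀ ≤ s) (hst : s ≤ t) (ht : t ≤ T) (x : E) :
    ‖X t x - X s x‖ ≤ ∫ r in s..t, κ r := by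
  have hi := fun a b => hB.intervalIntegrable (hX.continuous_time x) a b
  rw [hX.eq t ⟨hs.trans hst, ht⟩, hX.eq s ⟨hs, hst.trans ht⟩, add_sub_add_left_eq_sub,
    intervalIntegral.integral_interval_sub_left (hi _ _) (hi _ _)]
  exact intervalIntegral.norm_integral_le_of_norm_le hst (ae_of_all _ fun r _ => hB.bound r _)
    (hB.modulus.intervalIntegrable _ _)

theorem IsFlow.ae_hasDerivAt (hB : CaratheodoryField B κ) (hX : IsFlow B t₀ T X) (x : E) :
    ∀ᵐ t, t ∈ Ioo t₀ T → HasDerivAt (fun t => X t x) (B t (X t x)) t := by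
  filter_upwards [(hB.intervalIntegrable (hX.continuous_time x) t₀ T).ae_hasDerivAt_integral]
    with t ht hmem
  have hle : t₀ ≤ T := (hmem.1.trans hmem.2).le
  have h1 := ht (by rw [uIcc_of_le hle]; exact Ioo_subset_Icc_self hmem) t₀ left_mem_uIcc
  refine (h1.const_add x).congr_of_eventuallyEq ?_
  filter_upwards [Ioo_mem_nhds hmem.1 hmem.2] with s hs
  exact hX.eq s (Ioo_subset_Icc_self hs) x

/-- The fundamental theorem of calculus for a `C¹` function along a flow line. -/
theorem IsFlow.comp_sub_eq (hB : CaratheodoryField B κ) (hX : IsFlow B t₀ T X)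
    {φ : ℝ × (E × F) → ℝ} (hφ : ContDiff ℝ 1 φ) {K : ℝ} (hK : ∀ p, ‖fderiv ℝ φ p‖ ≤ K)
    {t₁ : ℝ} (ht₁ : t₁ ∈ Icc t₀ T) (x : E) (y : F) :
    φ (t₁, (X t₁ x, y)) - φ (t₀, (x, y)) =
      ∫ t in t₀..t₁, fderiv ℝ φ (t, (X t x, y)) (1, (B t (X t x), 0)) := by
  set c : ℝ → ℝ × (E × F) := fun t => (t, (X t x, y)) with hc
  -- The flow line is differentiable only almost everywhere. Increments of `φ` along it are at most
  -- `K` times those of `G`, so absolute continuity passes from `G` to `φ ∘ c`, and the fundamental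
  -- theorem for absolutely continuous functions applies.
  set G : ℝ → ℝ := fun t => ∫ r in t₀..t, (1 + κ r) with hG
  have hGi : ∀ a b, IntervalIntegrable (fun r => 1 + κ r) volume a b := fun a b =>
    (intervalIntegrable_const).add (hB.modulus.intervalIntegrable a b)
  have hK0 : 0 ≤ K := (norm_nonneg _).trans (hK 0)
  have hlip : ∀ p q, ‖φ p - φ q‖ ≤ K * ‖p - q‖ := fun p q =>
    (convex_univ).norm_image_sub_le_of_norm_fderiv_le
      (fun z _ => (hφ.differentiable (by norm_num)).differentiableAt) (fun z _ => hK z)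
      (mem_univ q) (mem_univ p)
  have hstep : ∀ s ∈ Icc t₀ t₁, ∀ t ∈ Icc t₀ t₁, s ≤ t →
      dist (φ (c s)) (φ (c t)) ≤ K * dist (G s) (G t) := by
    intro s hs t ht hst
    rw [dist_comm, dist_eq_norm, dist_comm, Real.dist_eq]
    have e : G t - G s = (t - s) + ∫ r in s..t, κ r := by
      rw [hG]
      simp only
      rw [intervalIntegral.integral_interval_sub_left (hGi _ _) (hGi _ _),
        intervalIntegral.integral_add intervalIntegrable_const
          (hB.modulus.intervalIntegrable _ _)]
      simp
    have hk0 : 0 ≤ ∫ r in s..t, κ r :=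
      intervalIntegral.integral_nonneg hst fun r _ => hB.modulus.nonneg r
    rw [e, abs_of_nonneg (add_nonneg (sub_nonneg.2 hst) hk0)]
    refine (hlip _ _).trans (mul_le_mul_of_nonneg_left ?_ hK0)
    have h1 := IsFlow.norm_sub_le hB hX hs.1 hst (ht.2.trans ht₁.2) x
    rw [hc]
    simp only [Prod.mk_sub_mk, sub_self, Prod.norm_mk, norm_zero]
    rw [Real.norm_of_nonneg (sub_nonneg.2 hst)]
    refine max_le (by linarith) (max_le ?_ (by linarith))
    linarith
  have hac : AbsolutelyContinuousOnInterval (fun t => φ (c t)) t₀ t₁ := by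
    have hGac : AbsolutelyContinuousOnInterval G t₀ t₁ :=
      (hGi t₀ t₁).absolutelyContinuousOnInterval_intervalIntegral left_mem_uIcc
    rw [absolutelyContinuousOnInterval_iff] at hGac ⊢
    intro ε hε
    obtain ⟨δ, hδ, H⟩ := hGac (ε / (K + 1)) (by positivity)
    refine ⟨δ, hδ, fun E' hE' hsum => ?_⟩
    have h1 := H E' hE' hsum
    calc ∑ i ∈ Finset.range E'.1, dist (φ (c (E'.2 i).1)) (φ (c (E'.2 i).2))
        ≤ ∑ i ∈ Finset.range E'.1, K * dist (G (E'.2 i).1) (G (E'.2 i).2) := by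
          refine Finset.sum_le_sum fun i hi => ?_
          have hm := hE'.1 i hi
          rw [uIcc_of_le ht₁.1] at hm
          rcases le_total (E'.2 i).1 (E'.2 i).2 with hle | hle
          · exact hstep _ hm.1 _ hm.2 hle
          · rw [dist_comm, dist_comm (G _)]
            exact hstep _ hm.2 _ hm.1 hle
      _ = K * ∑ i ∈ Finset.range E'.1, dist (G (E'.2 i).1) (G (E'.2 i).2) := by
          rw [Finset.mul_sum]
      _ ≤ K * (ε / (K + 1)) := by gcongr
      _ < ε := by
          rw [mul_div_assoc', div_lt_iff₀ (by positivity)]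
          nlinarith
  have hfin := hac.integral_deriv_eq_sub
  rw [hc] at hfin
  simp only [IsFlow.apply_start hX (ht₁.1.trans ht₁.2)] at hfin
  rw [← hfin]
  refine intervalIntegral.integral_congr_ae ?_
  have hne : ∀ᵐ t : ℝ, t ≠ t₁ := by simp [ae_iff, measure_singleton]
  filter_upwards [IsFlow.ae_hasDerivAt hB hX x, hne] with t ht htne hmem
  rw [uIoc_of_le ht₁.1] at hmem
  have hd := ht ⟨hmem.1, (lt_of_le_of_ne hmem.2 htne).trans_le ht₁.2⟩
  have hdc : HasDerivAt c (1, (B t (X t x), 0)) t :=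
    (hasDerivAt_id t).prodMk (hd.prodMk (hasDerivAt_const t y))
  exact (((hφ.differentiable (by norm_num)).differentiableAt.hasFDerivAt
    (x := c t)).comp_hasDerivAt t hdc).deriv

/-- The push-forward of a probability measure by the flow solves the continuity equation. -/
theorem IsFlow.integral_comp_eq (hB : CaratheodoryField B κ) (hX : IsFlow B t₀ T X)
    {φ : ℝ × (E × F) → ℝ} (hφ : ContDiff ℝ 1 φ) {K : ℝ}
    (hK : ∀ p, |φ p| ≤ K ∧ ‖fderiv ℝ φ p‖ ≤ K)
    {t₁ : ℝ} (ht₁ : t₁ ∈ Icc t₀ T) (γ : Measure (E × F)) [IsProbabilityMeasure γ] :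
    ∫ z, φ (t₁, (X t₁ z.1, z.2)) ∂γ = ∫ z, φ (t₀, z) ∂γ +
      ∫ t in t₀..t₁, ∫ z, fderiv ℝ φ (t, (X t z.1, z.2)) (1, (B t (X t z.1), 0)) ∂γ := by
  have hK0 : 0 ≤ K := (norm_nonneg _).trans (hK 0).2
  have hXm : Measurable fun p : ℝ × (E × F) => X p.1 p.2.1 :=
    hX.continuous.measurable.comp (measurable_fst.prodMk measurable_snd.fst)
  have hbd : ∀ (t : ℝ) (f : E × F → E × F), Measurable f →
      Integrable (fun z => φ (t, f z)) γ := fun t f hf =>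
    Integrable.of_bound
      (hφ.continuous.measurable.comp (measurable_const.prodMk hf)).aestronglyMeasurable K
      (ae_of_all _ fun z => (hK _).1)
  have hXt : Measurable fun z : E × F => (X t₁ z.1, z.2) :=
    (hXm.comp (measurable_const.prodMk measurable_id)).prodMk measurable_snd
  have hint : Integrable (Function.uncurry fun (t : ℝ) (z : E × F) =>
      fderiv ℝ φ (t, (X t z.1, z.2)) (1, (B t (X t z.1), 0)))
      ((volume.restrict (uIoc t₀ t₁)).prod γ) := by
    have hmeas : Measurable (Function.uncurry fun (t : ℝ) (z : E × F) =>
        fderiv ℝ φ (t, (X t z.1, z.2)) (1, (B t (X t z.1), 0))) := by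
      have hc : Continuous fun p : (ℝ × (E × F)) × (ℝ × (E × F)) => fderiv ℝ φ p.1 p.2 :=
        ((hφ.continuous_fderiv (by norm_num)).comp continuous_fst).clm_apply continuous_snd
      refine hc.measurable.comp (Measurable.prodMk ?_ ?_)
      · exact measurable_fst.prodMk (hXm.prodMk measurable_snd.snd)
      · exact measurable_const.prodMk
          ((hB.measurable.comp (measurable_fst.prodMk hXm)).prodMk measurable_const)
    have hdom : Integrable (fun p : ℝ × (E × F) => K * (1 + κ p.1))
        ((volume.restrict (uIoc t₀ t₁)).prod γ) := by
      have h1 : Integrable (fun t => K * (1 + κ t)) (volume.restrict (uIoc t₀ t₁)) :=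
        (intervalIntegrable_iff.1
          ((intervalIntegrable_const.add (hB.modulus.intervalIntegrable t₀ t₁)).const_mul K))
      exact h1.comp_fst γ
    refine hdom.mono' hmeas.aestronglyMeasurable (ae_of_all _ fun p => ?_)
    refine ((fderiv ℝ φ _).le_opNorm _).trans (mul_le_mul (hK _).2 ?_ (norm_nonneg _) hK0)
    simp only [Prod.norm_mk, norm_one, norm_zero]
    have h0 := hB.modulus.nonneg p.1
    have h1 := hB.bound p.1 (X p.1 p.2.1)
    refine max_le (by linarith) (max_le (by linarith) (by linarith))
  rw [← sub_eq_iff_eq_add', ← integral_sub (hbd _ _ hXt) (hbd t₀ (fun z => z) measurable_id),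
    integral_congr_ae (ae_of_all _ fun z : E × F =>
      IsFlow.comp_sub_eq hB hX hφ (fun p => (hK p).2) ht₁ z.1 z.2)]
  rw [intervalIntegral.integral_of_le ht₁.1]
  simp_rw [intervalIntegral.integral_of_le ht₁.1]
  rw [uIoc_of_le ht₁.1] at hint
  exact (integral_integral_swap hint).symm

end CaratheodoryField

/-! ### Couplings and the distance `d₂` -/

section DistTwo

variable {d₁ d₂ : ℕ}

/-- The joint law of `f` and `g` is an admissible coupling. -/
theorem distTwo_le_of_map {Ω : Type*} [MeasurableSpace Ω] {P : Measure Ω} [IsProbabilityMeasure P]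
    {f g : Ω → RSp d₁ × RSp d₂} (hf : Measurable f) (hg : Measurable g) {μ ν : PTwo d₁ d₂}
    (hμ : P.map f = μ.meas) (hν : P.map g = ν.meas) {r : ℝ} (hr : 0 ≤ r)
    (h : ∀ ω, ‖(f ω).1 - (g ω).1‖ ^ 2 + ‖(f ω).2 - (g ω).2‖ ^ 2 ≤ r ^ 2) :
    distTwo μ ν ≤ ENNReal.ofReal r := by
  have h1 : (⨅ π ∈ {π : Measure ((RSp d₁ × RSp d₂) × (RSp d₁ × RSp d₂)) |
        π.map Prod.fst = μ.meas ∧ π.map Prod.snd = ν.meas},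
      ∫⁻ p, ENNReal.ofReal (‖p.1.1 - p.2.1‖ ^ 2 + ‖p.1.2 - p.2.2‖ ^ 2) ∂π)
      ≤ ENNReal.ofReal r ^ (2 : ℝ) := by
    refine (iInf₂_le (P.map fun ω => (f ω, g ω)) ⟨?_, ?_⟩).trans ?_
    · rw [lintegral_map (by fun_prop) (hf.prodMk hg)]
      calc _ ≤ ∫⁻ _, ENNReal.ofReal (r ^ 2) ∂P :=
            lintegral_mono fun ω => ENNReal.ofReal_le_ofReal (h ω)
        _ = _ := by
            rw [lintegral_const, measure_univ, mul_one, ENNReal.ofReal_pow hr]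
            norm_cast
    · rw [Measure.map_map measurable_fst (hf.prodMk hg)]; exact hμ
    · rw [Measure.map_map measurable_snd (hf.prodMk hg)]; exact hν
  calc distTwo μ ν ≤ (ENNReal.ofReal r ^ (2 : ℝ)) ^ (1 / 2 : ℝ) :=
        ENNReal.rpow_le_rpow h1 (by norm_num)
    _ = ENNReal.ofReal r := by rw [← ENNReal.rpow_mul]; norm_num

/-- Duality between `d₂` and bounded Lipschitz functions. -/
theorem abs_integral_sub_le_of_distTwo_lt {μ ν : PTwo d₁ d₂} {f : RSp d₁ × RSp d₂ → ℝ}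
    {C K r : ℝ} (hC : ∀ z, |f z| ≤ C) (hK : 0 ≤ K) (hf : ∀ z w, |f z - f w| ≤ K * ‖z - w‖)
    (hr : distTwo μ ν < ENNReal.ofReal r) :
    |∫ z, f z ∂μ.meas - ∫ z, f z ∂ν.meas| ≤ K * r := by
  have hr0 : 0 < r := by
    by_contra hcon
    rw [ENNReal.ofReal_of_nonpos (not_lt.1 hcon)] at hr
    exact not_lt_bot hr
  have hfc : Continuous f :=
    (LipschitzWith.of_dist_le_mul (K := ⟨K, hK⟩) fun z w => by
      rw [Real.dist_eq, dist_eq_norm]; exact hf z w).continuous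
  have h1 : (⨅ π ∈ {π : Measure ((RSp d₁ × RSp d₂) × (RSp d₁ × RSp d₂)) |
        π.map Prod.fst = μ.meas ∧ π.map Prod.snd = ν.meas},
      ∫⁻ p, ENNReal.ofReal (‖p.1.1 - p.2.1‖ ^ 2 + ‖p.1.2 - p.2.2‖ ^ 2) ∂π)
      < ENNReal.ofReal (r ^ 2) := by
    rw [← ENNReal.rpow_lt_rpow_iff (z := (1 / 2 : ℝ)) (by norm_num)]
    refine hr.trans_eq ?_
    rw [ENNReal.ofReal_rpow_of_nonneg (by positivity) (by norm_num), ← Real.sqrt_eq_rpow,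
      Real.sqrt_sq hr0.le]
  simp only [iInf_lt_iff] at h1
  obtain ⟨π, ⟨hπ1, hπ2⟩, hπ⟩ := h1
  have hμ := μ.isProbabilityMeasure
  have hprob : IsProbabilityMeasure π := ⟨by
    have : (π.map Prod.fst) univ = 1 := by rw [hπ1]; exact measure_univ
    rwa [Measure.map_apply measurable_fst MeasurableSet.univ, preimage_univ] at this⟩
  set g : (RSp d₁ × RSp d₂) × (RSp d₁ × RSp d₂) → ℝ :=
    fun p => ‖p.1.1 - p.2.1‖ ^ 2 + ‖p.1.2 - p.2.2‖ ^ 2 with hg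
  have hg0 : ∀ p, 0 ≤ g p := fun p => by positivity
  have hgm : AEStronglyMeasurable g π := (by fun_prop : Measurable g).aestronglyMeasurable
  have hgi : Integrable g π :=
    (lintegral_ofReal_ne_top_iff_integrable hgm (ae_of_all _ hg0)).1 (hπ.trans_le le_top).ne
  have hgint : ∫ p, g p ∂π ≤ r ^ 2 := by
    rw [integral_eq_lintegral_of_nonneg_ae (ae_of_all _ hg0) hgm]
    exact ENNReal.toReal_le_of_le_ofReal (by positivity) hπ.le
  have hfi : ∀ u : (RSp d₁ × RSp d₂) × (RSp d₁ × RSp d₂) → RSp d₁ × RSp d₂, Measurable u →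
      Integrable (fun p => f (u p)) π := fun u hu =>
    Integrable.of_bound (hfc.measurable.comp hu).aestronglyMeasurable C
      (ae_of_all _ fun p => hC _)
  rw [← hπ1, ← hπ2, integral_map measurable_fst.aemeasurable hfc.aestronglyMeasurable,
    integral_map measurable_snd.aemeasurable hfc.aestronglyMeasurable,
    ← integral_sub (hfi _ measurable_fst) (hfi _ measurable_snd)]
  -- The inequality `2 r ρ ≤ r ^ 2 + ρ ^ 2` stands in for Cauchy–Schwarz. The sup norm of the
  -- product is bounded by the Euclidean one, which is the one in the transport cost.
  have hpt : ∀ p : (RSp d₁ × RSp d₂) × (RSp d₁ × RSp d₂),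
      ‖f p.1 - f p.2‖ ≤ K * (r / 2 + (2 * r)⁻¹ * g p) := by
    intro p
    refine (hf _ _).trans (mul_le_mul_of_nonneg_left ?_ hK)
    have h2 : ‖p.1 - p.2‖ ^ 2 ≤ g p := by
      rw [Prod.norm_def]
      rcases max_choice ‖(p.1 - p.2).1‖ ‖(p.1 - p.2).2‖ with h | h <;> rw [h, hg] <;>
        simp only [Prod.fst_sub, Prod.snd_sub] <;>
        nlinarith [sq_nonneg ‖p.1.1 - p.2.1‖, sq_nonneg ‖p.1.2 - p.2.2‖]
    have h3 : ‖p.1 - p.2‖ ≤ r / 2 + (2 * r)⁻¹ * ‖p.1 - p.2‖ ^ 2 := by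
      have h4 : 0 ≤ (2 * r)⁻¹ * (‖p.1 - p.2‖ - r) ^ 2 := by positivity
      have h5 : (2 * r)⁻¹ * (‖p.1 - p.2‖ - r) ^ 2 =
          (2 * r)⁻¹ * ‖p.1 - p.2‖ ^ 2 - ‖p.1 - p.2‖ + r / 2 := by field_simp; ring
      linarith
    refine h3.trans ?_
    gcongr
  calc |∫ p, (f p.1 - f p.2) ∂π| ≤ ∫ p, K * (r / 2 + (2 * r)⁻¹ * g p) ∂π :=
        norm_integral_le_of_norm_le (((integrable_const _).add (hgi.const_mul _)).const_mul _)
          (ae_of_all _ hpt)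
    _ = K * (r / 2 + (2 * r)⁻¹ * ∫ p, g p ∂π) := by
        rw [integral_const_mul, integral_add (integrable_const _) (hgi.const_mul _),
          integral_const_mul]
        simp
    _ ≤ K * (r / 2 + (2 * r)⁻¹ * r ^ 2) := by gcongr
    _ = K * r := by field_simp; ring

end DistTwo

/-! ### The drift attached to a kernel with fourth moments -/

section Drift

variable {d₁ d' : ℕ}

/-- The part of the regularity of `b` used for the continuity equation. -/
structure DriftBounds (b : RSp d₁ → RSp d' → RSp d₁) (C : ℝ) : Prop where
  one_le : 1 ≤ C
  continuous : Continuous (Function.uncurry b)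
  bound : ∀ x a, ‖b x a‖ ≤ C * (1 + ‖a‖)
  differentiable : ∀ a, Differentiable ℝ fun x => b x a
  continuous_fderiv : Continuous fun p : RSp d₁ × RSp d' => fderiv ℝ (fun x => b x p.2) p.1
  fderiv_bound : ∀ x a, ‖fderiv ℝ (fun x => b x a) x‖ ≤ C * (1 + ‖a‖ ^ 2)
  fderiv_lipschitz : ∀ x y a, ‖fderiv ℝ (fun x => b x a) x - fderiv ℝ (fun x => b x a) y‖ ≤
    C * (1 + ‖a‖ ^ 3) * ‖x - y‖

theorem norm_mixedDeriv_zero_right (b : RSp d₁ → RSp d' → RSp d₁) (k : ℕ) (x : RSp d₁)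
    (a : RSp d') : ‖mixedDeriv b k 0 x a‖ = ‖iteratedFDeriv ℝ k (fun x => b x a) x‖ := by
  have h : (fun x' : RSp d₁ => iteratedFDeriv ℝ 0 (fun a' : RSp d' => b x' a') a) =
      (continuousMultilinearCurryFin0 ℝ (RSp d') (RSp d₁)).symm ∘ fun x => b x a := by
    ext x'; simp
  rw [mixedDeriv, h, LinearIsometryEquiv.norm_iteratedFDeriv_comp_left]

theorem RegularField.exists_driftBounds {b : RSp d₁ → RSp d' → RSp d₁} (hb : RegularField b) :
    ∃ C, DriftBounds b C := by
  obtain ⟨C, hC0, hC⟩ := hb.growth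
  -- Only `l = 0` is used: the factor `1 + ‖x‖ ^ 0` is then the constant `2`, so the bound is
  -- uniform in `x`. Adding `1` to `2 * C` secures a constant at least `1`.
  have hg : ∀ k ≤ 4, ∀ x a, ‖iteratedFDeriv ℝ k (fun x => b x a) x‖ ≤
      (2 * C + 1) * (1 + ‖a‖ ^ (k + 1)) := by
    intro k hk x a
    rw [← norm_mixedDeriv_zero_right]
    refine (hC k 0 (by omega) x a).trans ?_
    rw [pow_zero]
    have : 0 ≤ ‖a‖ ^ (k + 1) := by positivity
    nlinarith
  have hcd : ∀ a, ContDiff ℝ 4 fun x => b x a := fun a =>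
    hb.contDiff.comp (contDiff_id.prodMk contDiff_const)
  have hcd' : ∀ a, ContDiff ℝ 1 (fderiv ℝ fun x => b x a) := fun a =>
    (hcd a).fderiv_right (by norm_num)
  have hfd : ∀ p : RSp d₁ × RSp d', fderiv ℝ (fun x => b x p.2) p.1 =
      (fderiv ℝ (fun p : RSp d₁ × RSp d' => b p.1 p.2) p).comp
        (ContinuousLinearMap.inl ℝ (RSp d₁) (RSp d')) := by
    intro p
    have h1 : HasFDerivAt (fun p : RSp d₁ × RSp d' => b p.1 p.2)
        (fderiv ℝ (fun p : RSp d₁ × RSp d' => b p.1 p.2) p) (p.1, p.2) :=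
      (hb.contDiff.differentiable (by norm_num)).differentiableAt.hasFDerivAt
    exact (HasFDerivAt.comp (f := fun x => (x, p.2)) p.1 h1
      (hasFDerivAt_prodMk_left p.1 p.2)).fderiv
  refine ⟨2 * C + 1, by linarith, hb.contDiff.continuous, fun x a => ?_,
    fun a => (hcd a).differentiable (by norm_num), ?_, fun x a => ?_, fun x y a => ?_⟩
  · simpa using hg 0 (by norm_num) x a
  · simp_rw [hfd]
    exact (hb.contDiff.continuous_fderiv (by norm_num)).clm_comp continuous_const
  · simpa [norm_iteratedFDeriv_one] using hg 1 (by norm_num) x a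
  · refine (convex_univ).norm_image_sub_le_of_norm_fderiv_le
      (fun z _ => ((hcd' a).differentiable (by norm_num)).differentiableAt) (fun z _ => ?_)
      (mem_univ y) (mem_univ x)
    rw [← norm_iteratedFDeriv_one, norm_iteratedFDeriv_fderiv]
    exact hg 2 (by norm_num) z a

/-- A Markov kernel from `ℝ` to `ℝ^{d'}` with locally integrable fourth moments. -/
structure FourthMoment (η : Kernel ℝ (RSp d')) : Prop where
  isMarkovKernel : IsMarkovKernel η
  integrable : ∀ s, Integrable (fun a => ‖a‖ ^ 4) (η s)
  intervalIntegrable : ∀ u v, IntervalIntegrable (fun s => ∫ a, ‖a‖ ^ 4 ∂(η s)) volume u v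

/-- The averaged velocity field `b(x, η_s) = ∫ b(x, a) dη_s(a)`. -/
noncomputable def driftField (b : RSp d₁ → RSp d' → RSp d₁) (η : Kernel ℝ (RSp d')) :
    ℝ → RSp d₁ → RSp d₁ := fun s x => ∫ a, b x a ∂(η s)

/-- The modulus of the averaged velocity field. -/
noncomputable def driftModulus (C : ℝ) (η : Kernel ℝ (RSp d')) : ℝ → ℝ :=
  fun s => C * (2 * √(1 + ∫ a, ‖a‖ ^ 4 ∂(η s)))

variable {b : RSp d₁ → RSp d' → RSp d₁} {C : ℝ} {η : Kernel ℝ (RSp d')}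

theorem FourthMoment.fourth_nonneg (η : Kernel ℝ (RSp d')) (s : ℝ) :
    0 ≤ ∫ a, ‖a‖ ^ 4 ∂(η s) := integral_nonneg fun _ => by positivity

theorem driftModulus_sq (C : ℝ) (η : Kernel ℝ (RSp d')) (s : ℝ) :
    driftModulus C η s ^ 2 = 4 * C ^ 2 * (1 + ∫ a, ‖a‖ ^ 4 ∂(η s)) := by
  rw [driftModulus, mul_pow, mul_pow,
    Real.sq_sqrt (add_nonneg zero_le_one (FourthMoment.fourth_nonneg η s))]
  ring

/-- The square of the modulus is affine in the fourth moment, which is locally integrable in time.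
-/
theorem FourthMoment.squareModulus (hη : FourthMoment η) (hC : 0 ≤ C) :
    SquareModulus (driftModulus C η) where
  measurable := by
    have := hη.isMarkovKernel
    have h : StronglyMeasurable fun s => ∫ a, ‖a‖ ^ 4 ∂(η s) :=
      StronglyMeasurable.integral_kernel
        (by fun_prop : Measurable fun a : RSp d' => ‖a‖ ^ 4).stronglyMeasurable
    have h' := h.measurable
    unfold driftModulus
    fun_prop
  nonneg s := by unfold driftModulus; positivity
  sq_integrable u v := by
    simp_rw [driftModulus_sq]
    exact (intervalIntegrable_const.add (hη.intervalIntegrable u v)).const_mul _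

theorem FourthMoment.integrable_of_le (hη : FourthMoment η) (s : ℝ) {G : Type*}
    [NormedAddCommGroup G] {f : RSp d' → G} (hf : AEStronglyMeasurable f (η s)) {M : ℝ}
    (h : ∀ a, ‖f a‖ ≤ M * (1 + ‖a‖ ^ 4)) : Integrable f (η s) := by
  have := hη.isMarkovKernel
  exact (((integrable_const 1).add (hη.integrable s)).const_mul M).mono' hf (ae_of_all _ h)

/-- Cauchy–Schwarz in the form `f ≤ √Q + f ^ 2 / (4√Q)`, where `Q` is the integral of `1 + ‖a‖ ^ 4`.
-/
theorem FourthMoment.integral_le_sqrt (hη : FourthMoment η) (s : ℝ) {f : RSp d' → ℝ}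
    (hf0 : ∀ a, 0 ≤ f a) (h : ∀ a, f a ^ 2 ≤ 4 * (1 + ‖a‖ ^ 4)) :
    ∫ a, f a ∂(η s) ≤ 2 * √(1 + ∫ a, ‖a‖ ^ 4 ∂(η s)) := by
  have := hη.isMarkovKernel
  set Q := 1 + ∫ a, ‖a‖ ^ 4 ∂(η s) with hQ
  have hQ0 : 0 < Q := by have := FourthMoment.fourth_nonneg η s; positivity
  have hs : 0 < √Q := Real.sqrt_pos.2 hQ0
  have hi0 : Integrable (fun a : RSp d' => 1 + ‖a‖ ^ 4) (η s) :=
    (integrable_const _).add (hη.integrable s)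
  have hi : Integrable (fun a : RSp d' => √Q + (√Q)⁻¹ * (1 + ‖a‖ ^ 4)) (η s) :=
    (integrable_const _).add (hi0.const_mul _)
  have hpt : ∀ a, f a ≤ √Q + (√Q)⁻¹ * (1 + ‖a‖ ^ 4) := by
    intro a
    have h1 : (√Q)⁻¹ * (f a ^ 2 / 4) ≤ (√Q)⁻¹ * (1 + ‖a‖ ^ 4) := by
      gcongr; linarith [h a]
    have h2 : 0 ≤ (√Q)⁻¹ * (f a / 2 - √Q) ^ 2 := by positivity
    have h3 : (√Q)⁻¹ * (f a / 2 - √Q) ^ 2 = (√Q)⁻¹ * (f a ^ 2 / 4) - f a + √Q := by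
      field_simp; ring
    linarith
  calc ∫ a, f a ∂(η s) ≤ ∫ a, (√Q + (√Q)⁻¹ * (1 + ‖a‖ ^ 4)) ∂(η s) :=
        integral_mono_of_nonneg (ae_of_all _ hf0) hi (ae_of_all _ hpt)
    _ = √Q + (√Q)⁻¹ * Q := by
        rw [integral_add (integrable_const _) (hi0.const_mul _), integral_const_mul,
          integral_add (integrable_const _) (hη.integrable s)]
        simp [hQ]
    _ = 2 * √Q := by
        have : (√Q)⁻¹ * Q = √Q := by
          rw [inv_mul_eq_iff_eq_mul₀ hs.ne']; exact (Real.mul_self_sqrt hQ0.le).symm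
        rw [this]; ring

theorem FourthMoment.integral_const_mul_le (hη : FourthMoment η) (hC : 0 ≤ C) (s : ℝ)
    {f : RSp d' → ℝ} (hf0 : ∀ a, 0 ≤ f a) (h : ∀ a, f a ^ 2 ≤ 4 * (1 + ‖a‖ ^ 4)) :
    ∫ a, C * f a ∂(η s) ≤ driftModulus C η s := by
  rw [integral_const_mul]
  exact mul_le_mul_of_nonneg_left (hη.integral_le_sqrt s hf0 h) hC

theorem one_add_norm_le (a : RSp d') : 1 + ‖a‖ ≤ 2 * (1 + ‖a‖ ^ 4) := by
  have := norm_nonneg a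
  nlinarith [sq_nonneg (‖a‖ ^ 2 - ‖a‖), sq_nonneg (‖a‖ - 1), sq_nonneg (‖a‖ ^ 2 - 1),
    sq_nonneg (‖a‖ ^ 2)]

theorem one_add_norm_sq_le (a : RSp d') : 1 + ‖a‖ ^ 2 ≤ 2 * (1 + ‖a‖ ^ 4) := by
  nlinarith [sq_nonneg (‖a‖ ^ 2 - 1), sq_nonneg (‖a‖ ^ 2)]

theorem one_add_norm_cube_le (a : RSp d') : 1 + ‖a‖ ^ 3 ≤ 2 * (1 + ‖a‖ ^ 4) := by
  have := norm_nonneg a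
  nlinarith [sq_nonneg (‖a‖ ^ 2 - ‖a‖), sq_nonneg (‖a‖ - 1), sq_nonneg (‖a‖ ^ 2 - 1),
    sq_nonneg (‖a‖ ^ 2)]

theorem DriftBounds.measurable (hb : DriftBounds b C) (x : RSp d₁) : Measurable (b x) :=
  hb.continuous.measurable.comp measurable_prodMk_left

theorem DriftBounds.integrable (hb : DriftBounds b C) (hη : FourthMoment η) (s : ℝ)
    (x : RSp d₁) : Integrable (b x) (η s) := by
  refine hη.integrable_of_le s (hb.measurable x).aestronglyMeasurable (M := C * 2) fun a =>
    (hb.bound x a).trans ?_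
  have := hb.one_le
  rw [mul_assoc]
  exact mul_le_mul_of_nonneg_left (one_add_norm_le a) (by linarith)

/-- The size `1 + ‖a‖` and the Lipschitz constant `1 + ‖a‖ ^ 2` both have squares at most `4(1 + ‖a‖
^ 4)`, so one modulus serves for both. -/
theorem DriftBounds.caratheodoryField (hb : DriftBounds b C) (hη : FourthMoment η) :
    CaratheodoryField (driftField b η) (driftModulus C η) where
  measurable := by
    have := hη.isMarkovKernel
    have h : StronglyMeasurable fun p : ℝ × RSp d₁ =>
        ∫ a, b p.2 a ∂(η.comap Prod.fst measurable_fst p) :=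
      StronglyMeasurable.integral_kernel_prod_right'
        (f := fun q : (ℝ × RSp d₁) × RSp d' => b q.1.2 q.2)
        (hb.continuous.comp
          (by fun_prop : Continuous fun q : (ℝ × RSp d₁) × RSp d' => (q.1.2, q.2))).stronglyMeasurable
    exact h.measurable
  modulus := hη.squareModulus (zero_le_one.trans hb.one_le)
  bound s x := by
    have hC := zero_le_one.trans hb.one_le
    refine le_trans ?_ (hη.integral_const_mul_le hC s (f := fun a => 1 + ‖a‖)
      (fun a => by positivity) fun a => ?_)
    · refine norm_integral_le_of_norm_le (hη.integrable_of_le s (M := C * 2)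
        (by fun_prop : Measurable fun a : RSp d' => C * (1 + ‖a‖)).aestronglyMeasurable
        fun a => ?_) (ae_of_all _ fun a => hb.bound x a)
      rw [Real.norm_of_nonneg (by positivity), mul_assoc]
      exact mul_le_mul_of_nonneg_left (one_add_norm_le a) hC
    · nlinarith [sq_nonneg (‖a‖ ^ 2 - 1), sq_nonneg (‖a‖ - 1), sq_nonneg (‖a‖ ^ 2)]
  lipschitz s x y := by
    have hC := zero_le_one.trans hb.one_le
    have h1 : driftField b η s x - driftField b η s y = ∫ a, (b x a - b y a) ∂(η s) :=
      (integral_sub (hb.integrable hη s x) (hb.integrable hη s y)).symm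
    have h2 := hη.integral_const_mul_le hC s (f := fun a => 1 + ‖a‖ ^ 2)
      (fun a => by positivity) fun a => by
        nlinarith [sq_nonneg (‖a‖ ^ 2 - 1), sq_nonneg (‖a‖ ^ 2)]
    rw [h1]
    refine le_trans ?_ (mul_le_mul_of_nonneg_right h2 (norm_nonneg (x - y)))
    rw [← integral_mul_const]
    refine norm_integral_le_of_norm_le (Integrable.mul_const (hη.integrable_of_le s (M := C * 2)
        (by fun_prop : Measurable fun a : RSp d' => C * (1 + ‖a‖ ^ 2)).aestronglyMeasurable
        fun a => ?_) _) (ae_of_all _ fun a => ?_)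
    · rw [Real.norm_of_nonneg (by positivity), mul_assoc]
      exact mul_le_mul_of_nonneg_left (one_add_norm_sq_le a) hC
    · exact (convex_univ).norm_image_sub_le_of_norm_fderiv_le
        (fun z _ => (hb.differentiable a).differentiableAt) (fun z _ => hb.fderiv_bound z a)
        (mem_univ y) (mem_univ x)

end Drift

/-! ### Uniqueness for the continuity equation -/

/-- A Carathéodory field which is `C¹` in space, with a Lipschitz derivative. -/
structure DifferentiableField {E : Type*} [NormedAddCommGroup E] [NormedSpace ℝ E]
    [MeasurableSpace E] (B : ℝ → E → E) (κ : ℝ → ℝ) (DB : ℝ → E → E →L[ℝ] E) : Prop where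
  caratheodory : CaratheodoryField B κ
  hasFDerivAt : ∀ s x, HasFDerivAt (B s) (DB s x) x
  stronglyMeasurable_fderiv : ∀ x, StronglyMeasurable fun s => DB s x
  fderiv_lipschitz : ∀ s x y, ‖DB s x - DB s y‖ ≤ κ s ^ 2 * ‖x - y‖

/-- Bounded `C¹` functions whose derivative is bounded by `L` and `L`-Lipschitz. -/
structure TestClass {Z : Type*} [NormedAddCommGroup Z] [NormedSpace ℝ Z] (L : ℝ) (ψ : Z → ℝ) :
    Prop where
  contDiff : ContDiff ℝ 1 ψ
  bounded : ∃ C, ∀ z, |ψ z| ≤ C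
  fderiv_le : ∀ z, ‖fderiv ℝ ψ z‖ ≤ L
  fderiv_lipschitz : ∀ z w, ‖fderiv ℝ ψ z - fderiv ℝ ψ w‖ ≤ L * ‖z - w‖

namespace TestClass

variable {Z : Type*} [NormedAddCommGroup Z] [NormedSpace ℝ Z] {L : ℝ} {ψ : Z → ℝ}

theorem nonneg (h : TestClass L ψ) : 0 ≤ L := (norm_nonneg _).trans (h.fderiv_le 0)

theorem hasFDerivAt (h : TestClass L ψ) (z : Z) : HasFDerivAt ψ (fderiv ℝ ψ z) z :=
  (h.contDiff.differentiable (by norm_num)).differentiableAt.hasFDerivAt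

theorem continuous_fderiv (h : TestClass L ψ) : Continuous (fderiv ℝ ψ) :=
  h.contDiff.continuous_fderiv (by norm_num)

/-- Mean value inequality on the ball of radius `‖v‖`, where the derivative differs from its value
at the centre by at most `L‖v‖`. -/
theorem taylor (h : TestClass L ψ) (z v : Z) :
    |ψ (z + v) - ψ z - fderiv ℝ ψ z v| ≤ L * ‖v‖ ^ 2 := by
  have h1 := (convex_closedBall z ‖v‖).norm_image_sub_le_of_norm_hasFDerivWithin_le'
    (f := ψ) (f' := fderiv ℝ ψ) (φ := fderiv ℝ ψ z) (C := L * ‖v‖) (x := z) (y := z + v)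
    (fun w _ => (h.hasFDerivAt w).hasFDerivWithinAt)
    (fun w hw => (h.fderiv_lipschitz w z).trans
      (mul_le_mul_of_nonneg_left (mem_closedBall_iff_norm.1 hw) h.nonneg))
    (Metric.mem_closedBall_self (norm_nonneg v)) (by simp)
  rw [add_sub_cancel_left, Real.norm_eq_abs] at h1
  exact h1.trans_eq (by ring)

end TestClass

/-! ### Frozen displacements over a time interval and their action on test functions -/

section Displacement

variable {E : Type*} [NormedAddCommGroup E] [NormedSpace ℝ E] [CompleteSpace E]
  [MeasurableSpace E] [BorelSpace E] [SecondCountableTopology E] {B : ℝ → E → E} {κ : ℝ → ℝ}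
  {DB : ℝ → E → E →L[ℝ] E}
  {F : Type*} [NormedAddCommGroup F] [NormedSpace ℝ F] [MeasurableSpace F] [BorelSpace F]
  [SecondCountableTopology F]

theorem SquareModulus.intervalIntegrable_add_sq (hκ : SquareModulus κ) (s t : ℝ) :
    IntervalIntegrable (fun r => κ r + κ r ^ 2) volume s t :=
  (hκ.intervalIntegrable s t).add (hκ.sq_integrable s t)

theorem SquareModulus.integral_le_integral_add_sq (hκ : SquareModulus κ) {s t : ℝ} (h : s ≤ t) :
    ∫ r in s..t, κ r ≤ ∫ r in s..t, (κ r + κ r ^ 2) :=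
  intervalIntegral.integral_mono_on h (hκ.intervalIntegrable s t)
    (hκ.intervalIntegrable_add_sq s t) fun _ _ => le_add_of_nonneg_right (sq_nonneg _)

theorem SquareModulus.integral_sq_le_integral_add_sq (hκ : SquareModulus κ) {s t : ℝ}
    (h : s ≤ t) : ∫ r in s..t, κ r ^ 2 ≤ ∫ r in s..t, (κ r + κ r ^ 2) :=
  intervalIntegral.integral_mono_on h (hκ.sq_integrable s t)
    (hκ.intervalIntegrable_add_sq s t) fun r _ => le_add_of_nonneg_left (hκ.nonneg r)

/-- The displacement `∫_s^t B_r(x) dr` of a frozen particle. -/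
noncomputable def displacement (B : ℝ → E → E) (s t : ℝ) (x : E) : E := ∫ r in s..t, B r x

theorem CaratheodoryField.norm_displacement_le (hB : CaratheodoryField B κ) {s t : ℝ}
    (h : s ≤ t) (x : E) : ‖displacement B s t x‖ ≤ ∫ r in s..t, κ r :=
  intervalIntegral.norm_integral_le_of_norm_le h (ae_of_all _ fun r _ => hB.bound r x)
    (hB.modulus.intervalIntegrable s t)

namespace DifferentiableField

theorem norm_fderiv_le (hB : DifferentiableField B κ DB) (s : ℝ) (x : E) : ‖DB s x‖ ≤ κ s := by
  have h0 := hB.caratheodory.modulus.nonneg s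
  exact (hB.hasFDerivAt s x).le_of_lipschitz (C := ⟨κ s, h0⟩) (LipschitzWith.of_dist_le_mul
    fun y z => by rw [dist_eq_norm, dist_eq_norm]; exact hB.caratheodory.lipschitz s y z)

theorem intervalIntegrable_fderiv (hB : DifferentiableField B κ DB) (x : E) (s t : ℝ) :
    IntervalIntegrable (fun r => DB r x) volume s t :=
  (hB.caratheodory.modulus.intervalIntegrable s t).mono_fun
    (hB.stronglyMeasurable_fderiv x).aestronglyMeasurable
    (ae_of_all _ fun r => (hB.norm_fderiv_le r x).trans (Real.le_norm_self _))

theorem hasFDerivAt_displacement (hB : DifferentiableField B κ DB) {s t : ℝ} (x : E) :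
    HasFDerivAt (displacement B s t) (∫ r in s..t, DB r x) x :=
  (intervalIntegral.hasFDerivAt_integral_of_dominated_of_fderiv_le (F := fun x r => B r x)
    (F' := fun x r => DB r x) (bound := κ) (s := univ) univ_mem
    (Eventually.of_forall fun _ => (hB.caratheodory.measurable.comp
      (measurable_id.prodMk measurable_const)).aestronglyMeasurable)
    (hB.caratheodory.intervalIntegrable continuous_const s t)
    (hB.stronglyMeasurable_fderiv x).aestronglyMeasurable
    (ae_of_all _ fun r _ y _ => hB.norm_fderiv_le r y)
    (hB.caratheodory.modulus.intervalIntegrable s t)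
    (ae_of_all _ fun r _ y _ => hB.hasFDerivAt r y))

theorem norm_integral_fderiv_le (hB : DifferentiableField B κ DB) {s t : ℝ} (h : s ≤ t) (x : E) :
    ‖∫ r in s..t, DB r x‖ ≤ ∫ r in s..t, κ r :=
  intervalIntegral.norm_integral_le_of_norm_le h (ae_of_all _ fun r _ => hB.norm_fderiv_le r x)
    (hB.caratheodory.modulus.intervalIntegrable s t)

theorem norm_integral_fderiv_sub_le (hB : DifferentiableField B κ DB) {s t : ℝ} (h : s ≤ t)
    (x y : E) : ‖(∫ r in s..t, DB r x) - ∫ r in s..t, DB r y‖ ≤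
      (∫ r in s..t, κ r ^ 2) * ‖x - y‖ := by
  rw [← intervalIntegral.integral_sub (hB.intervalIntegrable_fderiv x s t)
    (hB.intervalIntegrable_fderiv y s t), ← intervalIntegral.integral_mul_const]
  exact intervalIntegral.norm_integral_le_of_norm_le h
    (ae_of_all _ fun r _ => hB.fderiv_lipschitz r x y)
    ((hB.caratheodory.modulus.sq_integrable s t).mul_const _)

/-- The class of test functions is stable under the frozen displacement. -/
theorem testClass_comp_displacement (hB : DifferentiableField B κ DB) {s t : ℝ} (h : s ≤ t)
    {L : ℝ} {ψ : E × F → ℝ} (hψ : TestClass L ψ) :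
    TestClass (L * Real.exp (3 * ∫ r in s..t, (κ r + κ r ^ 2)))
      (fun z : E × F => ψ (z + (displacement B s t z.1, 0))) := by
  set θ := ∫ r in s..t, (κ r + κ r ^ 2) with hθ
  have hκ := hB.caratheodory.modulus
  have hθ0 : 0 ≤ θ := intervalIntegral.integral_nonneg h fun r _ =>
    add_nonneg (hκ.nonneg r) (sq_nonneg _)
  have hL := hψ.nonneg
  set D : E → E →L[ℝ] E := fun x => ∫ r in s..t, DB r x with hD
  have hD1 : ∀ x, ‖D x‖ ≤ θ := fun x =>
    (hB.norm_integral_fderiv_le h x).trans (hκ.integral_le_integral_add_sq h)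
  have hD2 : ∀ x y, ‖D x - D y‖ ≤ θ * ‖x - y‖ := fun x y =>
    (hB.norm_integral_fderiv_sub_le h x y).trans
      (mul_le_mul_of_nonneg_right (hκ.integral_sq_le_integral_add_sq h) (norm_nonneg _))
  -- An endomorphism of `E` is made to act on the first coordinate of `E × F` and to kill the
  -- second.
  let lift : (E →L[ℝ] E) →L[ℝ] (E × F →L[ℝ] E × F) :=
    (ContinuousLinearMap.compL ℝ (E × F) E (E × F) (ContinuousLinearMap.inl ℝ E F)).comp
      ((ContinuousLinearMap.compL ℝ (E × F) E E).flip (ContinuousLinearMap.fst ℝ E F))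
  have hlift : ∀ A v, lift A v = (A v.1, 0) := fun A v => rfl
  have hliftn : ∀ A, ‖lift A‖ ≤ ‖A‖ := by
    intro A
    refine ContinuousLinearMap.opNorm_le_bound _ (norm_nonneg _) fun v => ?_
    rw [hlift, Prod.norm_mk, norm_zero, max_eq_left (norm_nonneg _)]
    exact (A.le_opNorm _).trans (mul_le_mul_of_nonneg_left (norm_fst_le v) (norm_nonneg _))
  set S : E × F → E × F := fun z => z + (displacement B s t z.1, 0) with hS
  set DS : E × F → (E × F →L[ℝ] E × F) := fun z =>
    ContinuousLinearMap.id ℝ (E × F) + lift (D z.1) with hDS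
  have hSd : ∀ z, HasFDerivAt S (DS z) z := by
    intro z
    refine (hasFDerivAt_id z).add ?_
    have h1 : HasFDerivAt (fun z : E × F => displacement B s t z.1)
        ((D z.1).comp (ContinuousLinearMap.fst ℝ E F)) z :=
      (hB.hasFDerivAt_displacement z.1).comp z hasFDerivAt_fst
    have h2 := h1.prodMk (hasFDerivAt_const (0 : F) z)
    convert! h2 using 1
  have hDS1 : ∀ z, ‖DS z‖ ≤ 1 + θ := fun z => (norm_add_le _ _).trans
    (add_le_add ContinuousLinearMap.norm_id_le ((hliftn _).trans (hD1 _)))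
  have hDS2 : ∀ z w, ‖DS z - DS w‖ ≤ θ * ‖z - w‖ := by
    intro z w
    have e : DS z - DS w = lift (D z.1 - D w.1) := by
      rw [map_sub, hDS]; simp only [add_sub_add_left_eq_sub]
    rw [e]
    refine (hliftn _).trans ((hD2 _ _).trans (mul_le_mul_of_nonneg_left ?_ hθ0))
    exact norm_fst_le (z - w)
  have hS2 : ∀ z w, ‖S z - S w‖ ≤ (1 + θ) * ‖z - w‖ := fun z w =>
    (convex_univ).norm_image_sub_le_of_norm_hasFDerivWithin_le
      (fun u _ => (hSd u).hasFDerivWithinAt) (fun u _ => hDS1 u) (mem_univ w) (mem_univ z)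
  have hcomp : ∀ z, HasFDerivAt (fun z => ψ (S z)) ((fderiv ℝ ψ (S z)).comp (DS z)) z := fun z =>
    (hψ.hasFDerivAt (S z)).comp z (hSd z)
  have hfd : ∀ z, fderiv ℝ (fun z => ψ (S z)) z = (fderiv ℝ ψ (S z)).comp (DS z) := fun z =>
    (hcomp z).fderiv
  have hexp1 : 1 + θ ≤ Real.exp (3 * θ) := by
    have := Real.add_one_le_exp (3 * θ); linarith
  -- The chain rule multiplies the constant by `1 + 3θ + θ ^ 2`. Bounding this by `exp (3θ)` makes
  -- the factors of successive intervals combine by adding their `θ`.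
  have hexp2 : (1 + θ) ^ 2 + θ ≤ Real.exp (3 * θ) := by
    have := Real.quadratic_le_exp_of_nonneg (x := 3 * θ) (by positivity)
    nlinarith
  have hlip : ∀ z w, ‖fderiv ℝ (fun z => ψ (S z)) z - fderiv ℝ (fun z => ψ (S z)) w‖ ≤
      L * Real.exp (3 * θ) * ‖z - w‖ := by
    intro z w
    have e : (fderiv ℝ ψ (S z)).comp (DS z) - (fderiv ℝ ψ (S w)).comp (DS w) =
        (fderiv ℝ ψ (S z) - fderiv ℝ ψ (S w)).comp (DS z) +
          (fderiv ℝ ψ (S w)).comp (DS z - DS w) := by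
      rw [ContinuousLinearMap.sub_comp, ContinuousLinearMap.comp_sub]; abel
    rw [hfd, hfd, e]
    calc _ ≤ ‖fderiv ℝ ψ (S z) - fderiv ℝ ψ (S w)‖ * ‖DS z‖ +
          ‖fderiv ℝ ψ (S w)‖ * ‖DS z - DS w‖ :=
          (norm_add_le _ _).trans (add_le_add (ContinuousLinearMap.opNorm_comp_le _ _)
            (ContinuousLinearMap.opNorm_comp_le _ _))
      _ ≤ L * ((1 + θ) * ‖z - w‖) * (1 + θ) + L * (θ * ‖z - w‖) := by
          gcongr
          · exact (hψ.fderiv_lipschitz _ _).trans (mul_le_mul_of_nonneg_left (hS2 z w) hL)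
          · exact hDS1 z
          · exact hψ.fderiv_le _
          · exact hDS2 z w
      _ = L * ((1 + θ) ^ 2 + θ) * ‖z - w‖ := by ring
      _ ≤ _ := by gcongr
  refine ⟨?_, ?_, fun z => ?_, hlip⟩
  · rw [contDiff_one_iff_fderiv]
    refine ⟨fun z => (hcomp z).differentiableAt, ?_⟩
    exact (LipschitzWith.of_dist_le_mul (K := ⟨L * Real.exp (3 * θ), by positivity⟩)
      fun z w => by rw [dist_eq_norm, dist_eq_norm]; exact hlip z w).continuous
  · obtain ⟨C, hC⟩ := hψ.bounded
    exact ⟨C, fun z => hC _⟩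
  · rw [hfd]
    calc _ ≤ ‖fderiv ℝ ψ (S z)‖ * ‖DS z‖ := ContinuousLinearMap.opNorm_comp_le _ _
      _ ≤ L * (1 + θ) := by
          gcongr
          · exact hψ.fderiv_le _
          · exact hDS1 z
      _ ≤ _ := by gcongr

end DifferentiableField

end Displacement

/-! ### The freezing scheme and uniqueness of transported curves -/

section Uniqueness

variable {E : Type*} [NormedAddCommGroup E] [NormedSpace ℝ E] [CompleteSpace E]
  [MeasurableSpace E] [BorelSpace E] [SecondCountableTopology E] {B : ℝ → E → E} {κ : ℝ → ℝ}
  {DB : ℝ → E → E →L[ℝ] E}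
  {F : Type*} [NormedAddCommGroup F] [NormedSpace ℝ F] [MeasurableSpace F] [BorelSpace F]
  [SecondCountableTopology F] {t₀ T : ℝ}

/-- `μ` and `ν` are `δ`-close when tested against bounded Lipschitz functions. -/
def LipClose {Z : Type*} [NormedAddCommGroup Z] [MeasurableSpace Z] (μ ν : Measure Z) (δ : ℝ) :
    Prop :=
  ∀ (f : Z → ℝ) (C K : ℝ), 0 ≤ K → (∀ z, |f z| ≤ C) → (∀ z w, |f z - f w| ≤ K * ‖z - w‖) →
    |∫ z, f z ∂μ - ∫ z, f z ∂ν| ≤ K * δ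

/-- The infinitesimal variation of `ψ` along the field `B`. -/
noncomputable def fieldDeriv (B : ℝ → E → E) (ψ : E × F → ℝ) (r : ℝ) (z : E × F) : ℝ :=
  fderiv ℝ ψ z (B r z.1, 0)

/-- Curves of probability measures that solve the continuity equation of the field `B` against
time-independent test functions, and are continuous for the bounded-Lipschitz topology. -/
structure IsTransported (B : ℝ → E → E) (t₀ T : ℝ) (γ₀ : Measure (E × F))
    (γ : Kernel ℝ (E × F)) : Prop where
  isMarkovKernel : IsMarkovKernel γ
  eq : ∀ (L : ℝ) (ψ : E × F → ℝ), TestClass L ψ → ∀ t ∈ Icc t₀ T,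
    ∫ z, ψ z ∂(γ t) = ∫ z, ψ z ∂γ₀ + ∫ r in t₀..t, ∫ z, fieldDeriv B ψ r z ∂(γ r)
  continuous : ∀ s ∈ Ico t₀ T, ∀ δ > 0, ∃ η > 0, ∀ r ∈ Icc s (s + η), r ≤ T →
    LipClose (γ r) (γ s) δ

variable {ψ : E × F → ℝ} {L : ℝ}

theorem TestClass.measurable_fieldDeriv (hψ : TestClass L ψ) (hB : CaratheodoryField B κ) :
    Measurable (Function.uncurry (fieldDeriv (F := F) B ψ)) := by
  have hc : Continuous fun p : (E × F) × (E × F) => fderiv ℝ ψ p.1 p.2 :=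
    (hψ.continuous_fderiv.comp continuous_fst).clm_apply continuous_snd
  exact hc.measurable.comp (measurable_snd.prodMk
    ((hB.measurable.comp (measurable_fst.prodMk measurable_snd.fst)).prodMk measurable_const))

theorem TestClass.abs_fieldDeriv_le (hψ : TestClass L ψ) (hB : CaratheodoryField B κ) (r : ℝ)
    (z : E × F) : |fieldDeriv B ψ r z| ≤ L * κ r := by
  refine ((fderiv ℝ ψ z).le_opNorm _).trans (mul_le_mul (hψ.fderiv_le z) ?_ (norm_nonneg _)
    hψ.nonneg)
  rw [Prod.norm_mk, norm_zero, max_eq_left (norm_nonneg _)]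
  exact hB.bound r _

theorem TestClass.abs_fieldDeriv_sub_le (hψ : TestClass L ψ) (hB : CaratheodoryField B κ) (r : ℝ)
    (z w : E × F) : |fieldDeriv B ψ r z - fieldDeriv B ψ r w| ≤ 2 * L * κ r * ‖z - w‖ := by
  have hL := hψ.nonneg
  have hκ := hB.modulus.nonneg r
  have e : fieldDeriv B ψ r z - fieldDeriv B ψ r w =
      (fderiv ℝ ψ z - fderiv ℝ ψ w) (B r z.1, 0) + fderiv ℝ ψ w (B r z.1 - B r w.1, 0) := by
    have : ((B r z.1 - B r w.1, 0) : E × F) = (B r z.1, 0) - (B r w.1, 0) := by simp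
    rw [this, map_sub, sub_apply, fieldDeriv, fieldDeriv]
    ring
  have h1 : |(fderiv ℝ ψ z - fderiv ℝ ψ w) (B r z.1, 0)| ≤ L * ‖z - w‖ * κ r := by
    refine ((fderiv ℝ ψ z - fderiv ℝ ψ w).le_opNorm _).trans
      (mul_le_mul (hψ.fderiv_lipschitz z w) ?_ (norm_nonneg _) (by positivity))
    rw [Prod.norm_mk, norm_zero, max_eq_left (norm_nonneg _)]
    exact hB.bound r _
  have h2 : |fderiv ℝ ψ w (B r z.1 - B r w.1, 0)| ≤ L * (κ r * ‖z - w‖) := by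
    refine ((fderiv ℝ ψ w).le_opNorm _).trans
      (mul_le_mul (hψ.fderiv_le w) ?_ (norm_nonneg _) hL)
    rw [Prod.norm_mk, norm_zero, max_eq_left (norm_nonneg _)]
    exact (hB.lipschitz r _ _).trans (mul_le_mul_of_nonneg_left (norm_fst_le (z - w)) hκ)
  rw [e]
  refine (abs_add_le _ _).trans ((add_le_add h1 h2).trans_eq (by ring))

theorem TestClass.integrable (hψ : TestClass L ψ) (μ : Measure (E × F)) [IsFiniteMeasure μ] :
    Integrable ψ μ := by
  obtain ⟨C, hC⟩ := hψ.bounded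
  exact Integrable.of_bound hψ.contDiff.continuous.measurable.aestronglyMeasurable C
    (ae_of_all _ hC)

theorem TestClass.intervalIntegrable_integral (hψ : TestClass L ψ) (hB : CaratheodoryField B κ)
    (γ : Kernel ℝ (E × F)) [IsMarkovKernel γ] (s t : ℝ) :
    IntervalIntegrable (fun r => ∫ z, fieldDeriv B ψ r z ∂(γ r)) volume s t := by
  have hm : StronglyMeasurable fun r => ∫ z, fieldDeriv B ψ r z ∂(γ r) :=
    StronglyMeasurable.integral_kernel_prod_right (f := fieldDeriv B ψ)
      (hψ.measurable_fieldDeriv hB).stronglyMeasurable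
  refine ((hB.modulus.intervalIntegrable s t).const_mul L).mono_fun hm.aestronglyMeasurable
    (ae_of_all _ fun r => ?_)
  refine le_trans ?_ (Real.le_norm_self _)
  refine (norm_integral_le_of_norm_le_const (ae_of_all _ fun z =>
    hψ.abs_fieldDeriv_le hB r z)).trans_eq ?_
  simp

/-- Fubini. This identifies the first-order Taylor term of the frozen displacement with the time
integral of the equation in which the measure is frozen. -/
theorem TestClass.integral_fieldDeriv_displacement (hψ : TestClass L ψ)
    (hB : CaratheodoryField B κ) (μ : Measure (E × F)) [IsProbabilityMeasure μ] {s t : ℝ}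
    (h : s ≤ t) : ∫ z, fderiv ℝ ψ z (displacement B s t z.1, 0) ∂μ =
      ∫ r in s..t, ∫ z, fieldDeriv B ψ r z ∂μ := by
  have hpt : ∀ z : E × F, fderiv ℝ ψ z (displacement B s t z.1, 0) =
      ∫ r in s..t, fieldDeriv B ψ r z := by
    intro z
    have := ((fderiv ℝ ψ z).comp (ContinuousLinearMap.inl ℝ E F)).intervalIntegral_comp_comm
      (hB.intervalIntegrable (continuous_const (y := z.1)) s t)
    exact this.symm
  simp_rw [hpt, intervalIntegral.integral_of_le h]
  refine integral_integral_swap ?_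
  have hint : Integrable (fun p : (E × F) × ℝ => L * κ p.2) (μ.prod (volume.restrict (Ioc s t))) :=
    Integrable.comp_snd (f := fun r => L * κ r)
      (((hB.modulus.intervalIntegrable s t).1).const_mul L) μ
  exact hint.mono' ((hψ.measurable_fieldDeriv hB).comp measurable_swap).aestronglyMeasurable
    (ae_of_all _ fun p => hψ.abs_fieldDeriv_le hB p.2 p.1)

/-- One step of the freezing scheme. -/
theorem IsTransported.abs_integral_sub_le {γ₀ : Measure (E × F)} {γ : Kernel ℝ (E × F)}
    (hγ : IsTransported B t₀ T γ₀ γ) (hB : CaratheodoryField B κ) (hψ : TestClass L ψ) {s t δ : ℝ}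
    (hs : t₀ ≤ s) (hst : s ≤ t) (ht : t ≤ T) (hδ : ∀ r ∈ Icc s t, LipClose (γ r) (γ s) δ) :
    |∫ z, ψ z ∂(γ t) - ∫ z, ψ (z + (displacement B s t z.1, 0)) ∂(γ s)| ≤
      L * (∫ r in s..t, κ r) * (2 * δ + ∫ r in s..t, κ r) := by
  have := hγ.isMarkovKernel
  have hL := hψ.nonneg
  set k := ∫ r in s..t, κ r with hk
  have hk0 : 0 ≤ k := intervalIntegral.integral_nonneg hst fun r _ => hB.modulus.nonneg r
  have hi := fun a b => hψ.intervalIntegrable_integral hB γ a b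
  have hi' : ∀ a b, IntervalIntegrable (fun r => ∫ z, fieldDeriv B ψ r z ∂(γ s)) volume a b :=
    fun a b => by simpa using hψ.intervalIntegrable_integral hB (Kernel.const ℝ (γ s)) a b
  have e1 : ∫ z, ψ z ∂(γ t) - ∫ z, ψ z ∂(γ s) =
      ∫ r in s..t, ∫ z, fieldDeriv B ψ r z ∂(γ r) := by
    rw [hγ.eq L ψ hψ t ⟨hs.trans hst, ht⟩, hγ.eq L ψ hψ s ⟨hs, hst.trans ht⟩,
      add_sub_add_left_eq_sub, intervalIntegral.integral_interval_sub_left (hi _ _) (hi _ _)]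
  -- There are two errors: freezing the measure at time `s` costs `2 L k δ`, since `fieldDeriv B ψ
  -- r` is `2 L κ r`-Lipschitz; the Taylor remainder of the displacement costs `L k ^ 2`.
  have h1 : |(∫ r in s..t, ∫ z, fieldDeriv B ψ r z ∂(γ r)) -
      ∫ r in s..t, ∫ z, fieldDeriv B ψ r z ∂(γ s)| ≤ 2 * L * k * δ := by
    rw [← intervalIntegral.integral_sub (hi _ _) (hi' _ _)]
    have hpt : ∀ r ∈ Ioc s t, ‖(∫ z, fieldDeriv B ψ r z ∂(γ r)) - ∫ z, fieldDeriv B ψ r z ∂(γ s)‖ ≤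
        2 * L * δ * κ r := fun r hr =>
      (hδ r (Ioc_subset_Icc_self hr) (fieldDeriv B ψ r) (L * κ r) (2 * L * κ r)
        (mul_nonneg (by positivity) (hB.modulus.nonneg r)) (hψ.abs_fieldDeriv_le hB r)
        (hψ.abs_fieldDeriv_sub_le hB r)).trans_eq (by ring)
    refine (intervalIntegral.norm_integral_le_of_norm_le hst (ae_of_all _ hpt)
      ((hB.modulus.intervalIntegrable s t).const_mul _)).trans_eq ?_
    rw [intervalIntegral.integral_const_mul]
    ring
  have hdm : Measurable fun z : E × F => ((displacement B s t z.1, 0) : E × F) := by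
    have : StronglyMeasurable (displacement B s t) := by
      unfold displacement
      simp_rw [intervalIntegral.integral_of_le hst]
      exact StronglyMeasurable.integral_prod_right'
        (f := fun p : E × ℝ => B p.2 p.1) (hB.measurable.comp measurable_swap).stronglyMeasurable
    exact (this.measurable.comp measurable_fst).prodMk measurable_const
  have hdn : ∀ z : E × F, ‖((displacement B s t z.1, 0) : E × F)‖ ≤ k := by
    intro z
    rw [Prod.norm_mk, norm_zero, max_eq_left (norm_nonneg _)]
    exact hB.norm_displacement_le hst _
  obtain ⟨C, hC⟩ := hψ.bounded
  have hi1 : Integrable (fun z : E × F => ψ (z + (displacement B s t z.1, 0))) (γ s) :=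
    Integrable.of_bound (hψ.contDiff.continuous.measurable.comp
      (measurable_id.add hdm)).aestronglyMeasurable C (ae_of_all _ fun z => hC _)
  have hi2 : Integrable (fun z : E × F => fderiv ℝ ψ z (displacement B s t z.1, 0)) (γ s) := by
    have hc : Continuous fun p : (E × F) × (E × F) => fderiv ℝ ψ p.1 p.2 :=
      (hψ.continuous_fderiv.comp continuous_fst).clm_apply continuous_snd
    exact Integrable.of_bound (hc.measurable.comp (measurable_id.prodMk hdm)).aestronglyMeasurable
      (L * k) (ae_of_all _ fun z => ((fderiv ℝ ψ z).le_opNorm _).trans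
        (mul_le_mul (hψ.fderiv_le z) (hdn z) (norm_nonneg _) hL))
  have h2 : |∫ z, (ψ (z + (displacement B s t z.1, 0)) - ψ z -
      fderiv ℝ ψ z (displacement B s t z.1, 0)) ∂(γ s)| ≤ L * k ^ 2 := by
    have hpt : ∀ z : E × F, ‖ψ (z + (displacement B s t z.1, 0)) - ψ z -
        fderiv ℝ ψ z (displacement B s t z.1, 0)‖ ≤ L * k ^ 2 := fun z =>
      (hψ.taylor z _).trans (mul_le_mul_of_nonneg_left
        (pow_le_pow_left₀ (norm_nonneg _) (hdn z) 2) hL)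
    exact (norm_integral_le_of_norm_le_const (ae_of_all _ hpt)).trans_eq (by simp)
  have hi12 : Integrable (fun z : E × F => ψ (z + (displacement B s t z.1, 0)) - ψ z) (γ s) :=
    hi1.sub (hψ.integrable _)
  rw [integral_sub hi12 hi2, integral_sub hi1 (hψ.integrable _),
    hψ.integral_fieldDeriv_displacement hB (γ s) hst] at h2
  rw [← e1] at h1
  rw [abs_le] at h1 h2 ⊢
  constructor <;> nlinarith

/-- Two curves transported by the same field from the same measure have the same integrals. -/
theorem IsTransported.integral_eq {γ₀ : Measure (E × F)} {γ γ' : Kernel ℝ (E × F)}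
    (hγ : IsTransported B t₀ T γ₀ γ) (hγ' : IsTransported B t₀ T γ₀ γ')
    (hB : DifferentiableField B κ DB) (hψ : TestClass L ψ) {t : ℝ} (ht : t ∈ Icc t₀ T) :
    ∫ z, ψ z ∂(γ t) = ∫ z, ψ z ∂(γ' t) := by
  have hm := hγ.isMarkovKernel
  have hm' := hγ'.isMarkovKernel
  have hC := hB.caratheodory
  have hκ := hC.modulus
  let Θ : ℝ → ℝ := fun t => ∫ r in t₀..t, (κ r + κ r ^ 2)
  have hΘc : Continuous Θ :=
    intervalIntegral.continuous_primitive (fun a b => hκ.intervalIntegrable_add_sq a b) t₀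
  -- On `[t₀, T]` this is the difference of the two integrals of `ψ`; written with time integrals,
  -- it is visibly continuous in `t`.
  let G : (E × F → ℝ) → ℝ → ℝ := fun ψ t =>
    (∫ r in t₀..t, ∫ z, fieldDeriv B ψ r z ∂(γ r)) -
      ∫ r in t₀..t, ∫ z, fieldDeriv B ψ r z ∂(γ' r)
  have hG : ∀ L ψ, TestClass L ψ → ∀ t ∈ Icc t₀ T,
      ∫ z, ψ z ∂(γ t) - ∫ z, ψ z ∂(γ' t) = G ψ t := fun L ψ hψ t ht => by
    rw [hγ.eq L ψ hψ t ht, hγ'.eq L ψ hψ t ht, add_sub_add_left_eq_sub]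
  have hGc : ∀ L ψ, TestClass L ψ → Continuous (G ψ) := fun L ψ hψ =>
    (intervalIntegral.continuous_primitive
      (fun a b => hψ.intervalIntegrable_integral hC γ a b) t₀).sub
    (intervalIntegral.continuous_primitive
      (fun a b => hψ.intervalIntegrable_integral hC γ' a b) t₀)
  -- The bound must be carried for all test functions at once, because one time step replaces `ψ` by
  -- its displaced version. The weight `exp (3 * Θ t)` pays for the growth of the constant, and `Θ
  -- t` counts the accumulated errors.
  have key : ∀ ε > 0, ∀ t ∈ Icc t₀ T, ∀ L ψ, TestClass L ψ →
      |G ψ t| ≤ ε * L * Real.exp (3 * Θ t) * Θ t := by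
    intro ε hε
    let A : Set ℝ := {t | ∀ L ψ, TestClass L ψ → |G ψ t| ≤ ε * L * Real.exp (3 * Θ t) * Θ t}
    have hA : IsClosed A := by
      have : A = ⋂ (L : ℝ) (ψ : E × F → ℝ) (_ : TestClass L ψ),
          {t | |G ψ t| ≤ ε * L * Real.exp (3 * Θ t) * Θ t} := by
        ext t; simp [A]
      rw [this]
      refine isClosed_iInter fun L => isClosed_iInter fun ψ => isClosed_iInter fun hψ =>
        isClosed_le (hGc L ψ hψ).abs (by fun_prop)
    -- Continuous induction: the good times form a closed set containing `t₀`, and goodness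
    -- propagates slightly to the right.
    refine (hA.inter isClosed_Icc).Icc_subset_of_forall_mem_nhdsWithin (s := A) ?_ ?_
    · intro L ψ _
      simp [G, Θ]
    · rintro s ⟨hsA, hs⟩
      obtain ⟨η₁, hη₁, h₁⟩ := hγ.continuous s hs (ε / 8) (by positivity)
      obtain ⟨η₂, hη₂, h₂⟩ := hγ'.continuous s hs (ε / 8) (by positivity)
      have hΘe : ∀ᶠ t in 𝓝[>] s, Θ t - Θ s < ε / 4 := by
        have : Tendsto (fun t => Θ t - Θ s) (𝓝[>] s) (𝓝 (Θ s - Θ s)) :=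
          ((hΘc.sub continuous_const).tendsto s).mono_left nhdsWithin_le_nhds
        rw [sub_self] at this
        exact this.eventually (gt_mem_nhds (by positivity))
      have hnear : ∀ᶠ t in 𝓝[>] s, t < s + min η₁ η₂ ∧ t < T :=
        nhdsWithin_le_nhds ((eventually_lt_nhds (by linarith [lt_min hη₁ hη₂])).and
          (eventually_lt_nhds hs.2))
      filter_upwards [hΘe, hnear, self_mem_nhdsWithin] with t ht1 ⟨ht2, ht3⟩ (ht4 : s < t)
      intro L ψ hψ
      have hL := hψ.nonneg
      have hst := ht4.le
      have hclose : ∀ r ∈ Icc s t, LipClose (γ r) (γ s) (ε / 8) ∧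
          LipClose (γ' r) (γ' s) (ε / 8) := fun r hr =>
        ⟨h₁ r ⟨hr.1, by linarith [hr.2, min_le_left η₁ η₂]⟩ (hr.2.trans ht3.le),
          h₂ r ⟨hr.1, by linarith [hr.2, min_le_right η₁ η₂]⟩ (hr.2.trans ht3.le)⟩
      set θ := ∫ r in s..t, (κ r + κ r ^ 2) with hθ
      have hθΘ : Θ t = Θ s + θ :=
        (intervalIntegral.integral_add_adjacent_intervals (hκ.intervalIntegrable_add_sq _ _)
          (hκ.intervalIntegrable_add_sq _ _)).symm
      have hθ0 : 0 ≤ θ := intervalIntegral.integral_nonneg hst fun r _ =>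
        add_nonneg (hκ.nonneg r) (sq_nonneg _)
      have hΘs : 0 ≤ Θ s := intervalIntegral.integral_nonneg hs.1 fun r _ =>
        add_nonneg (hκ.nonneg r) (sq_nonneg _)
      set k := ∫ r in s..t, κ r with hk
      have hk0 : 0 ≤ k := intervalIntegral.integral_nonneg hst fun r _ => hκ.nonneg r
      have hkθ : k ≤ θ := hκ.integral_le_integral_add_sq hst
      have e1 := hγ.abs_integral_sub_le hC hψ hs.1 hst ht3.le fun r hr => (hclose r hr).1
      have e2 := hγ'.abs_integral_sub_le hC hψ hs.1 hst ht3.le fun r hr => (hclose r hr).2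
      have e3 := hsA _ _ (hB.testClass_comp_displacement hst hψ)
      rw [← hG _ _ (hB.testClass_comp_displacement hst hψ) s ⟨hs.1, hs.2.le⟩] at e3
      rw [← hG _ _ hψ t ⟨hs.1.trans hst, ht3.le⟩]
      -- Both `2 * (ε / 8)` and `k` are at most `ε / 4`. Each curve then errs by at most `ε L θ /
      -- 2`, and the two together by `ε L θ`.
      have e4 : L * k * (2 * (ε / 8) + k) ≤ L * θ * (ε / 2) := by
        gcongr
        linarith
      have e5 : ε * (L * Real.exp (3 * θ)) * Real.exp (3 * Θ s) * Θ s =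
          ε * L * Real.exp (3 * Θ t) * Θ s := by
        rw [hθΘ, mul_add, Real.exp_add]; ring
      have e6 : ε * L * θ ≤ ε * L * Real.exp (3 * Θ t) * θ := by
        have h1 : 1 ≤ Real.exp (3 * Θ t) := Real.one_le_exp (by rw [hθΘ]; positivity)
        have h2 : 0 ≤ ε * L * θ := by positivity
        nlinarith
      have e7 : ε * L * Real.exp (3 * Θ t) * Θ t =
          ε * L * Real.exp (3 * Θ t) * Θ s + ε * L * Real.exp (3 * Θ t) * θ := by
        rw [← mul_add, ← hθΘ]
      rw [← hθ, e5] at e3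
      rw [e7]
      rw [abs_le] at e1 e2 e3 ⊢
      constructor <;> linarith
  have hzero : |G ψ t| ≤ 0 := by
    refine le_of_forall_pos_le_add fun ε hε => ?_
    rw [zero_add]
    set M := L * Real.exp (3 * Θ t) * Θ t with hM
    have hM0 : 0 ≤ M := by
      have h1 : 0 ≤ Θ t := intervalIntegral.integral_nonneg ht.1 fun r _ =>
        add_nonneg (hκ.nonneg r) (sq_nonneg _)
      have := hψ.nonneg
      positivity
    refine (key (ε / (M + 1)) (by positivity) t ht L ψ hψ).trans ?_
    calc ε / (M + 1) * L * Real.exp (3 * Θ t) * Θ t = ε * (M / (M + 1)) := by rw [hM]; ring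
      _ ≤ ε * 1 := by
        gcongr
        rw [div_le_one (by positivity)]; linarith
      _ = ε := mul_one _
  rw [← sub_eq_zero, hG L ψ hψ t ht]
  exact abs_nonpos_iff.1 hzero

theorem testClass_cos {Z : Type*} [NormedAddCommGroup Z] [NormedSpace ℝ Z] (l : Z →L[ℝ] ℝ) :
    TestClass (max ‖l‖ (‖l‖ ^ 2)) fun z => Real.cos (l z) := by
  have hd : ∀ z, HasFDerivAt (fun z => Real.cos (l z)) (-Real.sin (l z) • l) z := fun z =>
    (l.hasFDerivAt).cos
  refine ⟨Real.contDiff_cos.comp l.contDiff, ⟨1, fun z => Real.abs_cos_le_one _⟩, fun z => ?_,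
    fun z w => ?_⟩
  · rw [(hd z).fderiv, norm_smul, norm_neg]
    exact le_max_of_le_left (mul_le_of_le_one_left (norm_nonneg _) (Real.abs_sin_le_one _))
  · rw [(hd z).fderiv, (hd w).fderiv, ← sub_smul, norm_smul]
    have h1 : ‖-Real.sin (l z) - -Real.sin (l w)‖ ≤ ‖l‖ * ‖z - w‖ := by
      have : ‖-Real.sin (l z) - -Real.sin (l w)‖ = |Real.sin (l z) - Real.sin (l w)| := by
        rw [← norm_neg, Real.norm_eq_abs]; congr 1; ring
      rw [this]
      refine (Real.abs_sin_sub_sin_le _ _).trans ?_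
      rw [← map_sub]
      exact l.le_opNorm _
    calc _ ≤ ‖l‖ * ‖z - w‖ * ‖l‖ := by gcongr
      _ = ‖l‖ ^ 2 * ‖z - w‖ := by ring
      _ ≤ _ := by gcongr; exact le_max_right _ _

theorem testClass_sin {Z : Type*} [NormedAddCommGroup Z] [NormedSpace ℝ Z] (l : Z →L[ℝ] ℝ) :
    TestClass (max ‖l‖ (‖l‖ ^ 2)) fun z => Real.sin (l z) := by
  have hd : ∀ z, HasFDerivAt (fun z => Real.sin (l z)) (Real.cos (l z) • l) z := fun z =>
    (l.hasFDerivAt).sin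
  refine ⟨Real.contDiff_sin.comp l.contDiff, ⟨1, fun z => Real.abs_sin_le_one _⟩, fun z => ?_,
    fun z w => ?_⟩
  · rw [(hd z).fderiv, norm_smul]
    exact le_max_of_le_left (mul_le_of_le_one_left (norm_nonneg _) (Real.abs_cos_le_one _))
  · rw [(hd z).fderiv, (hd w).fderiv, ← sub_smul, norm_smul]
    have h1 : ‖Real.cos (l z) - Real.cos (l w)‖ ≤ ‖l‖ * ‖z - w‖ := by
      refine (Real.abs_cos_sub_cos_le _ _).trans ?_
      rw [← map_sub]
      exact l.le_opNorm _
    calc _ ≤ ‖l‖ * ‖z - w‖ * ‖l‖ := by gcongr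
      _ = ‖l‖ ^ 2 * ‖z - w‖ := by ring
      _ ≤ _ := by gcongr; exact le_max_right _ _

/-- The class contains the sines and cosines of continuous linear forms, hence determines the
characteristic function. -/
theorem ext_of_testClass {μ ν : Measure (E × F)} [IsFiniteMeasure μ] [IsFiniteMeasure ν]
    [CompleteSpace F]
    (h : ∀ L (ψ : E × F → ℝ), TestClass L ψ → ∫ z, ψ z ∂μ = ∫ z, ψ z ∂ν) : μ = ν := by
  refine Measure.ext_of_charFunDual (funext fun l => ?_)
  have hexp : ∀ (ρ : Measure (E × F)) [IsFiniteMeasure ρ], charFunDual ρ l =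
      ((∫ z, Real.cos (l z) ∂ρ : ℝ) : ℂ) + ((∫ z, Real.sin (l z) ∂ρ : ℝ) : ℂ) * Complex.I := by
    intro ρ _
    rw [charFunDual_apply, ← integral_complex_ofReal, ← integral_complex_ofReal,
      ← integral_mul_const, ← integral_add ((testClass_cos l).integrable ρ).ofReal
        (((testClass_sin l).integrable ρ).ofReal.mul_const _)]
    refine integral_congr_ae (ae_of_all _ fun z => ?_)
    simp only [Complex.exp_mul_I, Complex.ofReal_cos, Complex.ofReal_sin]
  rw [hexp μ, hexp ν, h _ _ (testClass_cos l), h _ _ (testClass_sin l)]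

/-- Uniqueness for the continuity equation. -/
theorem IsTransported.unique [CompleteSpace F] {γ₀ : Measure (E × F)} {γ γ' : Kernel ℝ (E × F)}
    (hγ : IsTransported B t₀ T γ₀ γ) (hγ' : IsTransported B t₀ T γ₀ γ')
    (hB : DifferentiableField B κ DB) {t : ℝ} (ht : t ∈ Icc t₀ T) : γ t = γ' t := by
  have := hγ.isMarkovKernel
  have := hγ'.isMarkovKernel
  exact ext_of_testClass fun L ψ hψ => hγ.integral_eq hγ' hB hψ ht

end Uniqueness

/-! ### Differentiability in space of the averaged drift -/

section DriftDerivative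

variable {d₁ d' : ℕ} {b : RSp d₁ → RSp d' → RSp d₁} {C : ℝ} {η : Kernel ℝ (RSp d')}

/-- Differentiation under the integral. The derivative of `b(·, a)` has a Lipschitz constant cubic
in `‖a‖`, at most `2C(1 + ‖a‖ ^ 4)`; with `1 ≤ C` its average is below `4C ^ 2` times that of `1 +
‖a‖ ^ 4`, which is the square of the modulus. -/
theorem DriftBounds.differentiableField (hb : DriftBounds b C) (hη : FourthMoment η) :
    DifferentiableField (driftField b η) (driftModulus C η)
      (fun s x => ∫ a, fderiv ℝ (fun x => b x a) x ∂(η s)) := by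
  have := hη.isMarkovKernel
  have hC := hb.one_le
  have hC0 := zero_le_one.trans hC
  have hm : ∀ x s, AEStronglyMeasurable (fun a => fderiv ℝ (fun x => b x a) x) (η s) := fun x s =>
    (hb.continuous_fderiv.comp (by fun_prop : Continuous fun a : RSp d' => (x, a))).aestronglyMeasurable
  have hi : ∀ x s, Integrable (fun a => fderiv ℝ (fun x => b x a) x) (η s) := fun x s =>
    hη.integrable_of_le s (hm x s) (M := C * 2) fun a => (hb.fderiv_bound x a).trans (by
      rw [mul_assoc]; exact mul_le_mul_of_nonneg_left (one_add_norm_sq_le a) hC0)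
  refine ⟨hb.caratheodoryField hη, fun s x => ?_, fun x => ?_, fun s x y => ?_⟩
  · refine hasFDerivAt_integral_of_dominated_of_fderiv_le (F := fun x a => b x a)
      (F' := fun x a => fderiv ℝ (fun x => b x a) x) (bound := fun a => C * (1 + ‖a‖ ^ 2))
      (s := univ) univ_mem (Eventually.of_forall fun y => (hb.measurable y).aestronglyMeasurable)
      (hb.integrable hη s x) (hm x s) (ae_of_all _ fun a y _ => hb.fderiv_bound y a) ?_
      (ae_of_all _ fun a y _ => (hb.differentiable a).differentiableAt.hasFDerivAt)
    refine hη.integrable_of_le s (M := C * 2) (by fun_prop : Measurable fun a : RSp d' =>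
      C * (1 + ‖a‖ ^ 2)).aestronglyMeasurable fun a => ?_
    rw [Real.norm_of_nonneg (by positivity), mul_assoc]
    exact mul_le_mul_of_nonneg_left (one_add_norm_sq_le a) hC0
  · exact StronglyMeasurable.integral_kernel
      (hb.continuous_fderiv.comp (by fun_prop : Continuous fun a : RSp d' => (x, a))).stronglyMeasurable
  · rw [← integral_sub (hi x s) (hi y s)]
    have hci : Integrable (fun a : RSp d' => 2 * C * (1 + ‖a‖ ^ 4) * ‖x - y‖) (η s) :=
      (((integrable_const _).add (hη.integrable s)).const_mul _).mul_const _
    refine (norm_integral_le_of_norm_le hci (ae_of_all _ fun a =>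
      (hb.fderiv_lipschitz x y a).trans ?_)).trans ?_
    · gcongr ?_ * _
      nlinarith [one_add_norm_cube_le a]
    · rw [integral_mul_const, integral_const_mul, driftModulus_sq,
        integral_add (integrable_const _) (hη.integrable s)]
      simp only [integral_const, probReal_univ, smul_eq_mul, mul_one]
      gcongr ?_ * _
      have := FourthMoment.fourth_nonneg η s
      gcongr ?_ * _
      nlinarith

end DriftDerivative

/-! ### From `[t₀, T]` to the real line -/

section Extension

variable {t₀ T : ℝ}

theorem map_val_lebIcc (t₀ T : ℝ) :
    (lebIcc t₀ T).map Subtype.val = volume.restrict (Icc t₀ T) :=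
  map_comap_subtype_coe measurableSet_Icc _

theorem measurePreserving_val_lebIcc (t₀ T : ℝ) :
    MeasurePreserving Subtype.val (lebIcc t₀ T) (volume.restrict (Icc t₀ T)) :=
  ⟨measurable_subtype_coe, map_val_lebIcc t₀ T⟩

theorem setIntegral_Iic_lebIcc {G : Type*} [NormedAddCommGroup G] [NormedSpace ℝ G]
    (h : t₀ ≤ T) (f : Icc t₀ T → G) (t₁ : Icc t₀ T) :
    ∫ t in Iic t₁, f t ∂(lebIcc t₀ T) = ∫ r in t₀..t₁, f (projIcc t₀ T h r) := by
  have hpre : (Iic t₁ : Set (Icc t₀ T)) = Subtype.val ⁻¹' (Icc t₀ (t₁ : ℝ)) := by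
    ext t
    simp only [mem_Iic, mem_preimage, mem_Icc]
    exact ⟨fun ht => ⟨t.2.1, ht⟩, fun ht => ht.2⟩
  have h1 := (measurePreserving_val_lebIcc t₀ T).setIntegral_preimage_emb
    (MeasurableEmbedding.subtype_coe measurableSet_Icc) (fun r => f (projIcc t₀ T h r))
    (Icc t₀ (t₁ : ℝ))
  rw [Measure.restrict_restrict measurableSet_Icc, inter_eq_left.2 (Icc_subset_Icc_right t₁.2.2),
    integral_Icc_eq_integral_Ioc, ← intervalIntegral.integral_of_le t₁.2.1, ← hpre] at h1
  simpa using h1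

theorem ae_restrict_of_ae_lebIcc (h : t₀ ≤ T) {p : Icc t₀ T → Prop}
    (hp : ∀ᵐ t ∂(lebIcc t₀ T), p t) :
    ∀ᵐ r ∂(volume.restrict (Icc t₀ T)), p (projIcc t₀ T h r) := by
  rw [← map_val_lebIcc, (MeasurableEmbedding.subtype_coe measurableSet_Icc).ae_map_iff]
  simpa using hp

theorem lintegral_lebIcc (h : t₀ ≤ T) (f : Icc t₀ T → ℝ≥0∞) :
    ∫⁻ t, f t ∂(lebIcc t₀ T) = ∫⁻ r in Icc t₀ T, f (projIcc t₀ T h r) := by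
  rw [← map_val_lebIcc, (MeasurableEmbedding.subtype_coe measurableSet_Icc).lintegral_map]
  simp

variable {d' : ℕ}

theorem measurableSet_fourthMoment_lt_top {α : Type*} [MeasurableSpace α]
    (ν : Kernel α (RSp d')) :
    MeasurableSet {t | ∫⁻ a, ENNReal.ofReal (‖a‖ ^ 4) ∂(ν t) < ∞} :=
  measurableSet_lt (Measurable.lintegral_kernel (by fun_prop)) measurable_const

open Classical in
/-- The extension of a kernel to the real line by constants, with the values of infinite fourth
moment replaced by a Dirac mass. -/
noncomputable def extendKernel (h : t₀ ≤ T) (ν : Kernel (Icc t₀ T) (RSp d')) :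
    Kernel ℝ (RSp d') :=
  (Kernel.piecewise (measurableSet_fourthMoment_lt_top ν) ν
    (Kernel.const _ (Measure.dirac 0))).comap (projIcc t₀ T h) continuous_projIcc.measurable

theorem extendKernel_apply_of_lt_top (h : t₀ ≤ T) (ν : Kernel (Icc t₀ T) (RSp d')) {r : ℝ}
    (hr : ∫⁻ a, ENNReal.ofReal (‖a‖ ^ 4) ∂(ν (projIcc t₀ T h r)) < ∞) :
    extendKernel h ν r = ν (projIcc t₀ T h r) := by
  rw [extendKernel, Kernel.comap_apply, Kernel.piecewise_apply]
  exact if_pos hr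

/-- If the fourth moment is integrable in time, it is infinite only on a null set of times, so the
modification is invisible to time integrals. -/
theorem extendKernel_ae_eq (h : t₀ ≤ T) {ν : Kernel (Icc t₀ T) (RSp d')}
    (hν : ∫⁻ t, ∫⁻ a, ENNReal.ofReal (‖a‖ ^ 4) ∂(ν t) ∂(lebIcc t₀ T) ≠ ∞) :
    ∀ᵐ r ∂(volume.restrict (Icc t₀ T)), extendKernel h ν r = ν (projIcc t₀ T h r) := by
  have h1 : ∀ᵐ t ∂(lebIcc t₀ T), ∫⁻ a, ENNReal.ofReal (‖a‖ ^ 4) ∂(ν t) < ∞ :=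
    ae_lt_top (Measurable.lintegral_kernel (by fun_prop)) hν
  filter_upwards [ae_restrict_of_ae_lebIcc h h1] with r hr
  exact extendKernel_apply_of_lt_top h ν hr

theorem lintegral_fourth_extendKernel_le (h : t₀ ≤ T) (ν : Kernel (Icc t₀ T) (RSp d')) (r : ℝ) :
    ∫⁻ a, ENNReal.ofReal (‖a‖ ^ 4) ∂(extendKernel h ν r) ≤
      ∫⁻ a, ENNReal.ofReal (‖a‖ ^ 4) ∂(ν (projIcc t₀ T h r)) := by
  rw [extendKernel, Kernel.comap_apply, Kernel.piecewise_apply]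
  split_ifs with hr
  · exact le_rfl
  · simp

theorem lintegral_fourth_extendKernel_lt_top (h : t₀ ≤ T) (ν : Kernel (Icc t₀ T) (RSp d'))
    (r : ℝ) : ∫⁻ a, ENNReal.ofReal (‖a‖ ^ 4) ∂(extendKernel h ν r) < ∞ := by
  rw [extendKernel, Kernel.comap_apply, Kernel.piecewise_apply]
  split_ifs with hr
  · exact hr
  · simp

theorem isMarkovKernel_extendKernel (h : t₀ ≤ T) (ν : Kernel (Icc t₀ T) (RSp d'))
    [IsMarkovKernel ν] : IsMarkovKernel (extendKernel h ν) := by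
  unfold extendKernel; infer_instance

theorem integrable_fourth_extendKernel (h : t₀ ≤ T) (ν : Kernel (Icc t₀ T) (RSp d')) (r : ℝ) :
    Integrable (fun a => ‖a‖ ^ 4) (extendKernel h ν r) :=
  (lintegral_ofReal_ne_top_iff_integrable
    (by fun_prop : Measurable fun a : RSp d' => ‖a‖ ^ 4).aestronglyMeasurable
    (ae_of_all _ fun a => by positivity)).1 (lintegral_fourth_extendKernel_lt_top h ν r).ne

theorem ofReal_integral_fourth_extendKernel (h : t₀ ≤ T) (ν : Kernel (Icc t₀ T) (RSp d'))
    (r : ℝ) : ENNReal.ofReal (∫ a, ‖a‖ ^ 4 ∂(extendKernel h ν r)) =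
      ∫⁻ a, ENNReal.ofReal (‖a‖ ^ 4) ∂(extendKernel h ν r) :=
  ofReal_integral_eq_lintegral_ofReal (integrable_fourth_extendKernel h ν r)
    (ae_of_all _ fun a => by positivity)

theorem lintegral_fourth_extendKernel (h : t₀ ≤ T) (ν : Kernel (Icc t₀ T) (RSp d')) :
    ∫⁻ r in Icc t₀ T, ENNReal.ofReal (∫ a, ‖a‖ ^ 4 ∂(extendKernel h ν r)) ≤
      ∫⁻ t, ∫⁻ a, ENNReal.ofReal (‖a‖ ^ 4) ∂(ν t) ∂(lebIcc t₀ T) := by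
  simp_rw [ofReal_integral_fourth_extendKernel]
  rw [lintegral_lebIcc h]
  exact lintegral_mono fun r => lintegral_fourth_extendKernel_le h ν r

theorem fourthMoment_extendKernel (h : t₀ ≤ T) {ν : Kernel (Icc t₀ T) (RSp d')}
    [IsMarkovKernel ν]
    (hν : ∫⁻ t, ∫⁻ a, ENNReal.ofReal (‖a‖ ^ 4) ∂(ν t) ∂(lebIcc t₀ T) ≠ ∞) :
    FourthMoment (extendKernel h ν) := by
  have hM := isMarkovKernel_extendKernel h ν
  refine ⟨hM, integrable_fourth_extendKernel h ν, ?_⟩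
  have hsm : StronglyMeasurable fun r => ∫ a, ‖a‖ ^ 4 ∂(extendKernel h ν r) :=
    StronglyMeasurable.integral_kernel
      (by fun_prop : Measurable fun a : RSp d' => ‖a‖ ^ 4).stronglyMeasurable
  have hIcc : IntegrableOn (fun r => ∫ a, ‖a‖ ^ 4 ∂(extendKernel h ν r)) (Icc t₀ T) :=
    (lintegral_ofReal_ne_top_iff_integrable hsm.aestronglyMeasurable
      (ae_of_all _ fun r => FourthMoment.fourth_nonneg _ r)).1
      (ne_top_of_le_ne_top hν (lintegral_fourth_extendKernel h ν))
  set m : ℝ → ℝ := fun r => ∫ a, ‖a‖ ^ 4 ∂(extendKernel h ν r) with hm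
  have hm0 : ∀ r, 0 ≤ m r := fun r => FourthMoment.fourth_nonneg _ r
  -- Outside the interval the kernel is constant, with its value at `t₀` or at `T`. Those two
  -- moments are finite because of the Dirac replacement.
  have hle : ∀ r, m r ≤ (Icc t₀ T).indicator m r + (m t₀ + m T) := by
    intro r
    by_cases hr : r ∈ Icc t₀ T
    · rw [indicator_of_mem hr]; linarith [hm0 t₀, hm0 T]
    · rw [indicator_of_notMem hr]
      rw [mem_Icc, not_and_or, not_le, not_le] at hr
      rcases hr with hr | hr
      · have : m r = m t₀ := by
          simp only [hm, extendKernel, Kernel.comap_apply, projIcc_left, projIcc_of_le_left h hr.le]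
        linarith [hm0 T]
      · have : m r = m T := by
          simp only [hm, extendKernel, Kernel.comap_apply, projIcc_right,
            projIcc_of_right_le h hr.le]
        linarith [hm0 t₀]
  intro u v
  have hi : IntervalIntegrable (fun r => (Icc t₀ T).indicator m r + (m t₀ + m T)) volume u v :=
    ((integrable_indicator_iff measurableSet_Icc).2 hIcc).intervalIntegrable.add
      intervalIntegrable_const
  refine hi.mono_fun hsm.aestronglyMeasurable (ae_of_all _ fun r => ?_)
  refine le_trans ?_ (Real.le_norm_self _)
  change ‖m r‖ ≤ _
  rw [Real.norm_of_nonneg (hm0 r)]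
  exact hle r

end Extension

section StateCurve

variable {d₁ d₂ d' : ℕ} {t₀ T : ℝ}

/-! ### Continuous curves in `P₂` are measurable kernels -/

theorem PTwo.tendsto_integral {α : Type*} {l : Filter α} {γ : α → PTwo d₁ d₂} {μ : PTwo d₁ d₂}
    (hγ : Tendsto (fun i => distTwo (γ i) μ) l (𝓝 0)) {f : RSp d₁ × RSp d₂ → ℝ} {C K : ℝ}
    (hC : ∀ z, |f z| ≤ C) (hK : 0 ≤ K) (hf : ∀ z w, |f z - f w| ≤ K * ‖z - w‖) :
    Tendsto (fun i => ∫ z, f z ∂(γ i).meas) l (𝓝 (∫ z, f z ∂μ.meas)) := by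
  rw [Metric.tendsto_nhds]
  intro ε hε
  have hr : (0 : ℝ≥0∞) < ENNReal.ofReal (ε / (K + 1)) := ENNReal.ofReal_pos.2 (by positivity)
  filter_upwards [hγ.eventually (gt_mem_nhds hr)] with i hi
  rw [Real.dist_eq]
  refine (abs_integral_sub_le_of_distTwo_lt hC hK hf hi).trans_lt ?_
  rw [mul_div_assoc', div_lt_iff₀ (by positivity)]
  nlinarith

/-- Continuity for `d₂` implies weak continuity, as bounded Lipschitz functions suffice to test it.
The mass of an open set is then lower semicontinuous, hence measurable, and open sets form a
generating π-system. -/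
theorem PTwo.measurable_meas {α : Type*} [TopologicalSpace α] [FirstCountableTopology α]
    [MeasurableSpace α] [BorelSpace α] {γ : α → PTwo d₁ d₂}
    (hγ : ∀ s, Tendsto (fun t => distTwo (γ t) (γ s)) (𝓝 s) (𝓝 0)) :
    Measurable fun t => (γ t).meas := by
  have hp : ∀ t, IsProbabilityMeasure (γ t).meas := fun t => (γ t).isProbabilityMeasure
  let p : α → ProbabilityMeasure (RSp d₁ × RSp d₂) := fun t => ⟨(γ t).meas, hp t⟩
  have hlim : ∀ s, Tendsto p (𝓝 s) (𝓝 (p s)) := by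
    intro s
    rw [tendsto_iff_forall_lipschitz_integral_tendsto]
    rintro f ⟨C, hC⟩ ⟨K, hK⟩
    refine PTwo.tendsto_integral (hγ s) (C := C + |f 0|) (K := K) (fun z => ?_) K.2 fun z w => ?_
    · have h1 := hC z 0
      rw [Real.dist_eq] at h1
      have h2 := abs_add_le (f z - f 0) (f 0)
      rw [sub_add_cancel] at h2
      linarith
    · have := hK.dist_le_mul z w
      rwa [Real.dist_eq, dist_eq_norm] at this
  refine Measurable.measure_of_isPiSystem_of_isProbabilityMeasure
    (BorelSpace.measurable_eq (α := RSp d₁ × RSp d₂)) isPiSystem_isOpen fun G hG => ?_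
  refine LowerSemicontinuous.measurable fun s => ?_
  exact lowerSemicontinuousAt_iff_le_liminf.2
    (ProbabilityMeasure.le_liminf_measure_open_of_tendsto (hlim s) hG)

/-- The kernel on the real line attached to a continuous curve on `[t₀, T]`. -/
noncomputable def curveKernel (h : t₀ ≤ T) (γ : Icc t₀ T → PTwo d₁ d₂)
    (hγ : ∀ s, Tendsto (fun t => distTwo (γ t) (γ s)) (𝓝 s) (𝓝 0)) :
    Kernel ℝ (RSp d₁ × RSp d₂) where
  toFun r := (γ (projIcc t₀ T h r)).meas
  measurable' := (PTwo.measurable_meas hγ).comp continuous_projIcc.measurable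

theorem curveKernel_apply (h : t₀ ≤ T) (γ : Icc t₀ T → PTwo d₁ d₂)
    (hγ : ∀ s, Tendsto (fun t => distTwo (γ t) (γ s)) (𝓝 s) (𝓝 0)) (r : ℝ) :
    curveKernel h γ hγ r = (γ (projIcc t₀ T h r)).meas := rfl

/-! ### The continuity equation of a control with fourth moments -/

variable {b : RSp d₁ → RSp d' → RSp d₁} {C : ℝ} {ℓ : RSp d' → ℝ}
  {ν : AdmissibleControl ℓ t₀ T} {γ₀ : PTwo d₁ d₂} {γ : Icc t₀ T → PTwo d₁ d₂}

/-- Moves the weak formulation to the real line: the time and space derivatives merge into one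
directional derivative, and the control is replaced by its extension, which differs from it only on
a null set of times. -/
theorem setIntegral_continuity_eq (h : t₀ ≤ T)
    (hν : ∫⁻ t, ∫⁻ a, ENNReal.ofReal (‖a‖ ^ 4) ∂(ν.kernel t) ∂(lebIcc t₀ T) ≠ ∞)
    (γ : Icc t₀ T → PTwo d₁ d₂) (φ : ℝ × (RSp d₁ × RSp d₂) → ℝ) (t₁ : Icc t₀ T) :
    ∫ t in Iic t₁, (∫ z : RSp d₁ × RSp d₂, (fderiv ℝ φ (t, z) (1, (0, 0)) +
        fderiv ℝ φ (t, z) (0, (∫ a, b z.1 a ∂(ν.kernel t), 0))) ∂(γ t).meas) ∂(lebIcc t₀ T) =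
      ∫ r in t₀..t₁, ∫ z : RSp d₁ × RSp d₂, fderiv ℝ φ (r, z)
        (1, (driftField b (extendKernel h ν.kernel) r z.1, 0)) ∂(γ (projIcc t₀ T h r)).meas := by
  rw [setIntegral_Iic_lebIcc h]
  refine intervalIntegral.integral_congr_ae ?_
  have h1 := (ae_restrict_iff' measurableSet_Icc).1 (extendKernel_ae_eq h hν)
  filter_upwards [h1] with r hr hr'
  rw [uIoc_of_le t₁.2.1] at hr'
  have hmem : r ∈ Icc t₀ T := ⟨hr'.1.le, hr'.2.trans t₁.2.2⟩
  have hval : ((projIcc t₀ T h r : Icc t₀ T) : ℝ) = r := by rw [projIcc_of_mem h hmem]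
  refine integral_congr_ae (ae_of_all _ fun z => ?_)
  simp only [hval]
  rw [← map_add, driftField, hr hmem]
  simp

theorem IsContinuitySolution.isTransported (h : t₀ ≤ T)
    (hν : ∫⁻ t, ∫⁻ a, ENNReal.ofReal (‖a‖ ^ 4) ∂(ν.kernel t) ∂(lebIcc t₀ T) ≠ ∞)
    (hγ : IsContinuitySolution b ν γ₀ γ) :
    IsTransported (driftField b (extendKernel h ν.kernel)) t₀ T γ₀.meas
      (curveKernel h γ hγ.continuous) := by
  refine ⟨⟨fun r => (γ _).isProbabilityMeasure⟩, fun L ψ hψ t ht => ?_, fun s hs δ hδ => ?_⟩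
  · set φ : ℝ × (RSp d₁ × RSp d₂) → ℝ := fun p => ψ p.2 with hφ
    have hfd : ∀ p : ℝ × (RSp d₁ × RSp d₂), fderiv ℝ φ p =
        (fderiv ℝ ψ p.2).comp (ContinuousLinearMap.snd ℝ ℝ (RSp d₁ × RSp d₂)) := fun p =>
      ((hψ.hasFDerivAt p.2).comp p hasFDerivAt_snd).fderiv
    obtain ⟨C, hC⟩ := hψ.bounded
    have h1 := hγ.weak_eq φ (hψ.contDiff.comp contDiff_snd) ⟨max C L, fun p =>
      ⟨(hC _).trans (le_max_left _ _), ?_⟩⟩ ⟨t, ht⟩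
    · rw [setIntegral_continuity_eq h hν] at h1
      simp only [hfd, ContinuousLinearMap.comp_apply, ContinuousLinearMap.coe_snd'] at h1
      simp only [curveKernel_apply, projIcc_of_mem h ht]
      exact h1
    · rw [hfd]
      refine (ContinuousLinearMap.opNorm_comp_le _ _).trans ?_
      refine (mul_le_of_le_one_right (norm_nonneg _)
        (ContinuousLinearMap.norm_snd_le ℝ ℝ (RSp d₁ × RSp d₂))).trans ?_
      exact (hψ.fderiv_le _).trans (le_max_right _ _)
  · have hlim : Tendsto (fun r => distTwo (γ (projIcc t₀ T h r)) (γ (projIcc t₀ T h s))) (𝓝 s)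
        (𝓝 0) := (hγ.continuous (projIcc t₀ T h s)).comp (continuous_projIcc.tendsto s)
    obtain ⟨η, hη, H⟩ := Metric.eventually_nhds_iff.1
      (hlim.eventually (gt_mem_nhds (ENNReal.ofReal_pos.2 hδ)))
    refine ⟨η / 2, by positivity, fun r hr _ f C K hK hC hf => ?_⟩
    refine abs_integral_sub_le_of_distTwo_lt hC hK hf (H ?_)
    rw [Real.dist_eq, abs_lt]
    constructor <;> linarith [hr.1, hr.2]

theorem IsContinuitySolution.unique (hb : DriftBounds b C) (h : t₀ ≤ T)
    (hν : ∫⁻ t, ∫⁻ a, ENNReal.ofReal (‖a‖ ^ 4) ∂(ν.kernel t) ∂(lebIcc t₀ T) ≠ ∞)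
    {γ' : Icc t₀ T → PTwo d₁ d₂} (hγ : IsContinuitySolution b ν γ₀ γ)
    (hγ' : IsContinuitySolution b ν γ₀ γ') : γ = γ' := by
  have := ν.isMarkovKernel
  funext t
  have h1 := (hγ.isTransported h hν).unique (hγ'.isTransported h hν)
    (hb.differentiableField (fourthMoment_extendKernel h hν)) t.2
  simp only [curveKernel_apply, projIcc_val] at h1
  exact PTwo.ext h1

/-- The image of a measure in `P₂` by a map at bounded distance from the identity in `x`. -/
theorem PTwo.exists_map (γ₀ : PTwo d₁ d₂) {f : RSp d₁ → RSp d₁} (hf : Measurable f) {R : ℝ}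
    (hR : ∀ x, ‖f x - x‖ ≤ R) :
    ∃ μ : PTwo d₁ d₂, μ.meas = γ₀.meas.map fun z => (f z.1, z.2) := by
  have := γ₀.isProbabilityMeasure
  have hm : Measurable fun z : RSp d₁ × RSp d₂ => (f z.1, z.2) :=
    (hf.comp measurable_fst).prodMk measurable_snd
  refine ⟨⟨_, Measure.isProbabilityMeasure_map hm.aemeasurable, ?_⟩, rfl⟩
  rw [lintegral_map (by fun_prop) hm]
  calc _ ≤ ∫⁻ z, (ENNReal.ofReal (2 * R ^ 2) +
        ENNReal.ofReal 2 * ENNReal.ofReal (‖z.1‖ ^ 2 + ‖z.2‖ ^ 2)) ∂γ₀.meas := by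
        refine lintegral_mono fun z => ?_
        rw [← ENNReal.ofReal_mul (by norm_num), ← ENNReal.ofReal_add (by positivity) (by positivity)]
        refine ENNReal.ofReal_le_ofReal ?_
        have h1 : ‖f z.1‖ ≤ R + ‖z.1‖ := by
          have := norm_add_le (f z.1 - z.1) z.1
          rw [sub_add_cancel] at this
          linarith [hR z.1]
        have h2 : ‖f z.1‖ ^ 2 ≤ (R + ‖z.1‖) ^ 2 := pow_le_pow_left₀ (norm_nonneg _) h1 2
        nlinarith [sq_nonneg (R - ‖z.1‖), sq_nonneg ‖z.2‖]
    _ < ∞ := by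
        rw [lintegral_add_left measurable_const, lintegral_const, measure_univ, mul_one,
          lintegral_const_mul _ (by fun_prop)]
        exact ENNReal.add_lt_top.2 ⟨ENNReal.ofReal_lt_top,
          ENNReal.mul_lt_top ENNReal.ofReal_lt_top γ₀.secondMoment⟩

/-- The measure transported by the flow of the averaged field solves the continuity equation. -/
theorem exists_isContinuitySolution (hb : DriftBounds b C) (h : t₀ ≤ T)
    (hν : ∫⁻ t, ∫⁻ a, ENNReal.ofReal (‖a‖ ^ 4) ∂(ν.kernel t) ∂(lebIcc t₀ T) ≠ ∞)
    (γ₀ : PTwo d₁ d₂) {X : ℝ → RSp d₁ → RSp d₁}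
    (hX : CaratheodoryField.IsFlow (driftField b (extendKernel h ν.kernel)) t₀ T X) :
    ∃ γ : Icc t₀ T → PTwo d₁ d₂, IsContinuitySolution b ν γ₀ γ ∧
      ∀ t, (γ t).meas = γ₀.meas.map fun z => (X t z.1, z.2) := by
  have := ν.isMarkovKernel
  have := γ₀.isProbabilityMeasure
  set κ := driftModulus C (extendKernel h ν.kernel)
  have hB : CaratheodoryField (driftField b (extendKernel h ν.kernel)) κ :=
    hb.caratheodoryField (fourthMoment_extendKernel h hν)
  have hXm : ∀ t, Measurable (X t) := fun t =>
    (hX.continuous.comp (continuous_const.prodMk continuous_id)).measurable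
  have hXXm : ∀ t, Measurable fun z : RSp d₁ × RSp d₂ => (X t z.1, z.2) := fun t =>
    ((hXm t).comp measurable_fst).prodMk measurable_snd
  -- This bound is uniform in `x`: it yields both the finite second moments and the continuity for
  -- `d₂`.
  have hdist : ∀ s ∈ Icc t₀ T, ∀ t ∈ Icc t₀ T, ∀ x, ‖X t x - X s x‖ ≤ |∫ r in s..t, κ r| := by
    intro s hs t ht x
    rcases le_total s t with hst | hst
    · exact (hX.norm_sub_le hB hs.1 hst ht.2 x).trans (le_abs_self _)
    · rw [norm_sub_rev, intervalIntegral.integral_symm, abs_neg]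
      exact (hX.norm_sub_le hB ht.1 hst hs.2 x).trans (le_abs_self _)
  have hex : ∀ t : Icc t₀ T, ∃ μ : PTwo d₁ d₂, μ.meas = γ₀.meas.map fun z => (X t z.1, z.2) := by
    intro t
    refine γ₀.exists_map (hXm t) (R := |∫ r in t₀..t, κ r|) fun x => ?_
    have := hdist t₀ (left_mem_Icc.2 h) t t.2 x
    rwa [hX.apply_start h] at this
  choose γ hγ using hex
  refine ⟨γ, ⟨fun s => ?_, fun φ hφ ⟨K, hK⟩ t₁ => ?_⟩, hγ⟩
  · have hprim : Continuous fun t : Icc t₀ T => |∫ r in (s : ℝ)..t, κ r| :=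
      ((intervalIntegral.continuous_primitive
        (fun a b => hB.modulus.intervalIntegrable a b) s).comp continuous_subtype_val).abs
    have hlim : Tendsto (fun t : Icc t₀ T => ENNReal.ofReal |∫ r in (s : ℝ)..t, κ r|) (𝓝 s)
        (𝓝 0) := by
      have := (ENNReal.continuous_ofReal.comp hprim).tendsto s
      simpa [Function.comp_def] using this
    refine tendsto_of_tendsto_of_tendsto_of_le_of_le tendsto_const_nhds hlim (fun _ => bot_le)
      fun t => ?_
    refine distTwo_le_of_map (hXXm t) (hXXm s) (hγ t).symm (hγ s).symm (abs_nonneg _) fun z => ?_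
    have := hdist s s.2 t t.2 z.1
    simp only [sub_self, norm_zero]
    nlinarith [norm_nonneg (X t z.1 - X s z.1)]
  · have hφt : Measurable fun z : RSp d₁ × RSp d₂ => φ (t₁, z) :=
      hφ.continuous.measurable.comp measurable_prodMk_left
    rw [setIntegral_continuity_eq h hν, hγ t₁,
      integral_map (hXXm t₁).aemeasurable hφt.aestronglyMeasurable, hX.integral_comp_eq hB hφ hK t₁.2 γ₀.meas]
    congr 1
    refine intervalIntegral.integral_congr fun r hr => ?_
    rw [uIcc_of_le t₁.2.1] at hr
    have hmem : r ∈ Icc t₀ T := ⟨hr.1, hr.2.trans t₁.2.2⟩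
    have hm1 : Measurable fun z : RSp d₁ × RSp d₂ => fderiv ℝ φ (r, z)
        (1, (driftField b (extendKernel h ν.kernel) r z.1, 0)) := by
      have hc : Continuous fun p : (ℝ × (RSp d₁ × RSp d₂)) × (ℝ × (RSp d₁ × RSp d₂)) =>
          fderiv ℝ φ p.1 p.2 :=
        ((hφ.continuous_fderiv (by norm_num)).comp continuous_fst).clm_apply continuous_snd
      refine hc.measurable.comp ((measurable_const.prodMk measurable_id).prodMk
        (measurable_const.prodMk (Measurable.prodMk ?_ measurable_const)))
      exact hB.measurable.comp (measurable_const.prodMk measurable_fst)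
    simp only [projIcc_of_mem h hmem, hγ]
    rw [integral_map (hXXm r).aemeasurable hm1.aestronglyMeasurable]

theorem existsUnique_isContinuitySolution (hb : DriftBounds b C) (h : t₀ ≤ T)
    (hν : ∫⁻ t, ∫⁻ a, ENNReal.ofReal (‖a‖ ^ 4) ∂(ν.kernel t) ∂(lebIcc t₀ T) ≠ ∞)
    (γ₀ : PTwo d₁ d₂) : ∃! γ : Icc t₀ T → PTwo d₁ d₂, IsContinuitySolution b ν γ₀ γ := by
  have := ν.isMarkovKernel
  obtain ⟨X, hX⟩ := (hb.caratheodoryField (fourthMoment_extendKernel h hν)).exists_flow h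
  obtain ⟨γ, hγ, -⟩ := exists_isContinuitySolution hb h hν γ₀ hX
  exact ⟨γ, hγ, fun γ' hγ' => hγ'.unique hb h hν hγ⟩

/-- The state curve is the image of the initial measure by the flow. -/
theorem stateCurve_meas (hb : DriftBounds b C) (h : t₀ ≤ T)
    (hν : ∫⁻ t, ∫⁻ a, ENNReal.ofReal (‖a‖ ^ 4) ∂(ν.kernel t) ∂(lebIcc t₀ T) ≠ ∞)
    (γ₀ : PTwo d₁ d₂) {X : ℝ → RSp d₁ → RSp d₁}
    (hX : CaratheodoryField.IsFlow (driftField b (extendKernel h ν.kernel)) t₀ T X)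
    (t : Icc t₀ T) : (stateCurve b γ₀ ν t).meas = γ₀.meas.map fun z => (X t z.1, z.2) := by
  obtain ⟨γ, hγ, hmap⟩ := exists_isContinuitySolution hb h hν γ₀ hX
  have hex : ∃ γ, IsContinuitySolution b ν γ₀ γ := ⟨γ, hγ⟩
  have h1 : stateCurve b γ₀ ν = γ := by
    rw [stateCurve, dif_pos hex]
    exact hex.choose_spec.unique hb h hν hγ
  rw [h1, hmap]

end StateCurve

/-! ### Integrability of the prior -/

section Prior

variable {d' : ℕ} {ℓ : RSp d' → ℝ}

/-- On the ray `s ↦ s • a`, the second derivative of `ℓ` is at least `c(r ^ 2 + s ^ 2 r ^ 4)` with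
`r = ‖a‖`. Subtracting the double primitive of this leaves a convex function, which lies above its
tangent at `0`. -/
theorem RegularPotential.exists_quartic_le (hℓ : RegularPotential ℓ) :
    ∃ c G : ℝ, 0 < c ∧ ∀ a, ℓ 0 - G * ‖a‖ + c * (‖a‖ ^ 2 / 2 + ‖a‖ ^ 4 / 12) ≤ ℓ a := by
  obtain ⟨c, hc, hess⟩ := hℓ.hessian
  refine ⟨c, ‖fderiv ℝ ℓ 0‖, hc, fun a => ?_⟩
  have hd1 : ∀ z, HasFDerivAt ℓ (fderiv ℝ ℓ z) z := fun z =>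
    (hℓ.contDiff.differentiable (by norm_num) z).hasFDerivAt
  have hd2 : ∀ z, HasFDerivAt (fderiv ℝ ℓ) (fderiv ℝ (fderiv ℝ ℓ) z) z := fun z =>
    ((hℓ.contDiff.fderiv_right (m := 1) (by norm_num)).differentiable (by norm_num) z).hasFDerivAt
  have hray : ∀ s : ℝ, HasDerivAt (fun s : ℝ => s • a) a s := fun s => by
    simpa using (hasDerivAt_id s).smul_const a
  set r := ‖a‖ with hr
  set h : ℝ → ℝ := fun s => ℓ (s • a) - c * (s ^ 2 * r ^ 2 / 2 + s ^ 4 * r ^ 4 / 12) with hh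
  have h1 : ∀ s, HasDerivAt h (fderiv ℝ ℓ (s • a) a - c * (s * r ^ 2 + s ^ 3 * r ^ 4 / 3)) s := by
    intro s
    have hp : HasDerivAt (fun s : ℝ => c * (s ^ 2 * r ^ 2 / 2 + s ^ 4 * r ^ 4 / 12))
        (c * (s * r ^ 2 + s ^ 3 * r ^ 4 / 3)) s := by
      have := (((((hasDerivAt_pow 2 s).mul_const (r ^ 2)).div_const 2).add
        (((hasDerivAt_pow 4 s).mul_const (r ^ 4)).div_const 12)).const_mul c)
      convert! this using 1
      norm_num
      ring_nf
      simp
    exact ((hd1 _).comp_hasDerivAt s (hray s)).sub hp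
  have h2 : ∀ s, HasDerivAt (fun s => fderiv ℝ ℓ (s • a) a - c * (s * r ^ 2 + s ^ 3 * r ^ 4 / 3))
      (fderiv ℝ (fderiv ℝ ℓ) (s • a) a a - c * (r ^ 2 + s ^ 2 * r ^ 4)) s := by
    intro s
    have hp : HasDerivAt (fun s : ℝ => c * (s * r ^ 2 + s ^ 3 * r ^ 4 / 3))
        (c * (r ^ 2 + s ^ 2 * r ^ 4)) s := by
      have := ((((hasDerivAt_id s).mul_const (r ^ 2)).add
        (((hasDerivAt_pow 3 s).mul_const (r ^ 4)).div_const 3)).const_mul c)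
      convert! this using 1
      norm_num
      ring_nf
      simp
    have hq := ((hd2 _).comp_hasDerivAt s (hray s)).clm_apply (hasDerivAt_const s a)
    simp only [map_zero, add_zero, Function.comp_def] at hq
    exact hq.sub hp
  have hd : deriv h = fun s => fderiv ℝ ℓ (s • a) a - c * (s * r ^ 2 + s ^ 3 * r ^ 4 / 3) :=
    funext fun s => (h1 s).deriv
  have hconv : ConvexOn ℝ univ h := by
    refine convexOn_univ_of_deriv2_nonneg (fun s => (h1 s).differentiableAt) ?_ fun s => ?_
    · rw [hd]
      exact fun s => (h2 s).differentiableAt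
    · simp only [Function.iterate_succ, Function.iterate_zero, Function.comp_apply, id_eq, hd]
      rw [(h2 s).deriv]
      have := hess (s • a) a
      rw [iteratedFDeriv_two_apply, norm_smul, Real.norm_eq_abs, mul_pow, sq_abs] at this
      nlinarith
  have h3 := hconv.le_slope_of_hasDerivAt (mem_univ 0) (mem_univ 1) one_pos (h1 0)
  have h4 := (fderiv ℝ ℓ 0).le_opNorm a
  rw [Real.norm_eq_abs] at h4
  have h5 := (abs_le.1 h4).1
  simp only [slope_def_field, hh, one_smul, zero_smul] at h3
  norm_num at h3
  linarith

/-- The exponent `c / 12` uses up the quartic part of the lower bound. Of the quadratic part `c‖a‖ ^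
2 / 2`, one half absorbs the linear term and the other half leaves an integrable Gaussian. -/
theorem RegularPotential.exists_integrable_exp (hℓ : RegularPotential ℓ) :
    ∃ c : ℝ, 0 < c ∧ Integrable (fun a => Real.exp (c * ‖a‖ ^ 4 - ℓ a)) := by
  obtain ⟨c, G, hc, h⟩ := hℓ.exists_quartic_le
  refine ⟨c / 12, by positivity, ?_⟩
  have hg : Integrable fun a : RSp d' => Real.exp (-(c / 4) * ‖a‖ ^ 2) := by
    have := (GaussianFourier.integrable_cexp_neg_mul_sq_norm_add (V := RSp d') (b := (c / 4 : ℝ))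
      (by simpa using hc) 0 0).norm
    refine this.congr (ae_of_all _ fun a => ?_)
    simp only [Complex.norm_exp]
    congr 1
    simp [← Complex.ofReal_pow]
  refine (hg.const_mul (Real.exp (-ℓ 0 + G ^ 2 / c))).mono'
    (by have := hℓ.contDiff.continuous; fun_prop : Continuous _).aestronglyMeasurable
    (ae_of_all _ fun a => ?_)
  rw [Real.norm_of_nonneg (Real.exp_pos _).le, ← Real.exp_add]
  refine Real.exp_le_exp.2 ?_
  have h1 := h a
  have h2 : 0 ≤ G ^ 2 / c + c / 4 * ‖a‖ ^ 2 - G * ‖a‖ := by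
    have : G ^ 2 / c + c / 4 * ‖a‖ ^ 2 - G * ‖a‖ = (G - c / 2 * ‖a‖) ^ 2 / c := by
      field_simp
      ring
    rw [this]
    positivity
  nlinarith

theorem RegularPotential.integrable_exp_neg (hℓ : RegularPotential ℓ) :
    Integrable fun a => Real.exp (-ℓ a) := by
  obtain ⟨c, hc, h⟩ := hℓ.exists_integrable_exp
  refine h.mono' (by have := hℓ.contDiff.continuous; fun_prop : Continuous _).aestronglyMeasurable
    (ae_of_all _ fun a => ?_)
  rw [Real.norm_of_nonneg (Real.exp_pos _).le]
  refine Real.exp_le_exp.2 ?_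
  have : 0 ≤ c * ‖a‖ ^ 4 := by positivity
  linarith

theorem RegularPotential.isProbabilityMeasure (hℓ : RegularPotential ℓ) :
    IsProbabilityMeasure (priorMeasure ℓ) :=
  isProbabilityMeasure_tilted hℓ.integrable_exp_neg

theorem RegularPotential.exists_integrable_exp_prior (hℓ : RegularPotential ℓ) :
    ∃ c : ℝ, 0 < c ∧ Integrable (fun a => Real.exp (c * ‖a‖ ^ 4)) (priorMeasure ℓ) := by
  obtain ⟨c, hc, h⟩ := hℓ.exists_integrable_exp
  refine ⟨c, hc, (integrable_tilted_iff hℓ.integrable_exp_neg _).2 ?_⟩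
  refine h.congr (ae_of_all _ fun a => ?_)
  simp only [smul_eq_mul]
  rw [← Real.exp_add]
  ring_nf

end Prior

/-! ### Entropy inequality -/

section Young

open InformationTheory

/-- Fenchel–Young inequality: `exp x - 1` is the convex conjugate of `klFun`. -/
theorem mul_le_klFun_add_exp {x y : ℝ} (hy : 0 ≤ y) :
    x * y ≤ klFun y + (Real.exp x - 1) := by
  rw [klFun_apply]
  rcases hy.eq_or_lt with rfl | hy
  · simp [Real.exp_nonneg]
  · have h1 := Real.add_one_le_exp (x - Real.log y)
    rw [Real.exp_sub, Real.exp_log hy] at h1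
    have h2 : (x - Real.log y + 1) * y ≤ Real.exp x := by rwa [← le_div_iff₀ hy]
    nlinarith

theorem lintegral_le_klDiv_add {α : Type*} [MeasurableSpace α] {μ π : Measure α}
    [IsFiniteMeasure μ] [IsFiniteMeasure π] {f : α → ℝ} (hf : Measurable f) (hf0 : ∀ a, 0 ≤ f a) :
    ∫⁻ a, ENNReal.ofReal (f a) ∂μ ≤
      klDiv μ π + ∫⁻ a, ENNReal.ofReal (Real.exp (f a) - 1) ∂π := by
  by_cases hac : μ ≪ π
  swap
  · rw [klDiv_of_not_ac hac, top_add]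
    exact le_top
  rw [klDiv_eq_lintegral_klFun_of_ac hac, ← lintegral_rnDeriv_mul hac (by fun_prop),
    ← lintegral_add_left (by fun_prop)]
  refine lintegral_mono_ae ?_
  filter_upwards [μ.rnDeriv_lt_top π] with a ha
  have h1 : 0 ≤ (μ.rnDeriv π a).toReal := ENNReal.toReal_nonneg
  rw [← ENNReal.ofReal_toReal ha.ne, ← ENNReal.ofReal_mul h1,
    ← ENNReal.ofReal_add (klFun_nonneg (by simp)) (by simpa using hf0 a)]
  refine ENNReal.ofReal_le_ofReal ?_
  rw [ENNReal.toReal_ofReal h1, mul_comm]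
  exact mul_le_klFun_add_exp h1

/-- The entropy of a kernel is the entropy of the associated measure on the product space. -/
theorem lintegral_klDiv_eq_klDiv_compProd {α γ : Type*} [MeasurableSpace α] [MeasurableSpace γ]
    [MeasurableSpace.CountablyGenerated γ] (μ : Measure α)
    [IsFiniteMeasure μ] (ν : Kernel α γ) [IsMarkovKernel ν] (π : Measure γ)
    [IsProbabilityMeasure π] :
    ∫⁻ t, klDiv (ν t) π ∂μ = klDiv (μ ⊗ₘ ν) (μ.prod π) := by
  have hmeas : MeasurableSet {t | ν t ≪ π} := by
    simpa using Kernel.measurableSet_absolutelyContinuous ν (Kernel.const α π)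
  by_cases hac : ∀ᵐ t ∂μ, ν t ≪ π
  · have hac' : μ ⊗ₘ ν ≪ μ ⊗ₘ Kernel.const α π :=
      Measure.absolutelyContinuous_compProd_right_iff.2 (by simpa using hac)
    -- A jointly measurable version of the densities of the `ν t`; it is also the density of the
    -- composition product, so that Tonelli's theorem gives the identity.
    set ρ : α → γ → ℝ≥0∞ := Kernel.rnDeriv ν (Kernel.const α π) with hρ
    have hρm : Measurable fun p : α × γ => ρ p.1 p.2 := Kernel.measurable_rnDeriv _ _
    have hρt : ∀ t, ρ t =ᵐ[π] (ν t).rnDeriv π := fun t => by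
      simpa using Kernel.rnDeriv_eq_rnDeriv_measure (κ := ν) (η := Kernel.const α π) (a := t)
    have hdens : μ ⊗ₘ ν = (μ ⊗ₘ Kernel.const α π).withDensity fun p => ρ p.1 p.2 := by
      rw [← Measure.compProd_withDensity hρm]
      refine Measure.compProd_congr ?_
      filter_upwards [hac] with t ht
      rw [Kernel.withDensity_apply _ hρm, Kernel.const_apply, withDensity_congr_ae (hρt t),
        Measure.withDensity_rnDeriv_eq _ _ ht]
    have hrn : (μ ⊗ₘ ν).rnDeriv (μ ⊗ₘ Kernel.const α π) =ᵐ[μ ⊗ₘ Kernel.const α π]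
        fun p => ρ p.1 p.2 := by
      conv_lhs => rw [hdens]
      exact Measure.rnDeriv_withDensity _ hρm
    rw [← Measure.compProd_const, klDiv_eq_lintegral_klFun_of_ac hac',
      lintegral_congr_ae (hrn.mono fun p hp => by rw [hp]),
      Measure.lintegral_compProd (by fun_prop)]
    refine lintegral_congr_ae ?_
    filter_upwards [hac] with t ht
    rw [klDiv_eq_lintegral_klFun_of_ac ht, Kernel.const_apply]
    exact lintegral_congr_ae ((hρt t).mono fun a ha => by simp only [ha])
  · rw [← Measure.compProd_const, klDiv_of_not_ac fun h => hac (by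
      simpa using Measure.absolutelyContinuous_compProd_right_iff.1 h)]
    by_contra hne
    refine hac ?_
    rw [ae_iff]
    -- If absolute continuity fails on a set of positive measure, the left-hand side is infinite
    -- too.
    have hle : ∫⁻ t, {t | ν t ≪ π}ᶜ.indicator (fun _ => ∞) t ∂μ ≤ ∫⁻ t, klDiv (ν t) π ∂μ := by
      refine lintegral_mono fun t => ?_
      by_cases ht : ν t ≪ π
      · simp [ht]
      · simp [ht]
    rw [lintegral_indicator_const hmeas.compl] at hle
    by_contra h0
    rw [ENNReal.top_mul (by simpa [compl_ofPred] using h0)] at hle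
    exact hne (top_le_iff.1 hle)

end Young

/-! ### Moments of controls -/

section Moments

variable {d' : ℕ} {ℓ : RSp d' → ℝ}

/-- The entropy inequality with the function `c‖a‖ ^ 4`, whose exponential is integrable for the
prior. -/
theorem RegularPotential.exists_lintegral_fourth_le (hℓ : RegularPotential ℓ) :
    ∃ K : ℝ≥0∞, K ≠ ∞ ∧ ∀ μ : Measure (RSp d'), IsProbabilityMeasure μ →
      ∫⁻ a, ENNReal.ofReal (‖a‖ ^ 4) ∂μ ≤
        K * (InformationTheory.klDiv μ (priorMeasure ℓ) + 1) := by
  obtain ⟨c, hc, hint⟩ := hℓ.exists_integrable_exp_prior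
  have := hℓ.isProbabilityMeasure
  set I : ℝ≥0∞ := ∫⁻ a, ENNReal.ofReal (Real.exp (c * ‖a‖ ^ 4) - 1) ∂(priorMeasure ℓ)
  have hI : I ≠ ∞ :=
    ((hint.sub (integrable_const 1)).lintegral_lt_top).ne
  refine ⟨ENNReal.ofReal c⁻¹ * (1 + I), ENNReal.mul_ne_top ENNReal.ofReal_ne_top (by simpa),
    fun μ hμ => ?_⟩
  have h1 := lintegral_le_klDiv_add (μ := μ) (π := priorMeasure ℓ)
    (f := fun a : RSp d' => c * ‖a‖ ^ 4) (by fun_prop) fun a => by positivity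
  have h2 : ∫⁻ a, ENNReal.ofReal (‖a‖ ^ 4) ∂μ =
      ENNReal.ofReal c⁻¹ * ∫⁻ a, ENNReal.ofReal (c * ‖a‖ ^ 4) ∂μ := by
    rw [← lintegral_const_mul _ (by fun_prop)]
    refine lintegral_congr fun a => ?_
    rw [← ENNReal.ofReal_mul (by positivity), inv_mul_cancel_left₀ hc.ne']
  rw [h2, mul_assoc]
  gcongr
  refine h1.trans ?_
  set D := InformationTheory.klDiv μ (priorMeasure ℓ)
  calc D + I ≤ D + I + (1 + I * D) := le_self_add
    _ = (1 + I) * (D + 1) := by ring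

theorem RegularPotential.exists_lintegral_lintegral_fourth_le (hℓ : RegularPotential ℓ) :
    ∃ K : ℝ≥0∞, K ≠ ∞ ∧ ∀ (t₀ T : ℝ) (ν : Kernel (Icc t₀ T) (RSp d')), IsMarkovKernel ν →
      ∫⁻ t, ∫⁻ a, ENNReal.ofReal (‖a‖ ^ 4) ∂(ν t) ∂(lebIcc t₀ T) ≤
        K * (∫⁻ t, InformationTheory.klDiv (ν t) (priorMeasure ℓ) ∂(lebIcc t₀ T) +
          lebIcc t₀ T univ) := by
  obtain ⟨K, hK, h⟩ := hℓ.exists_lintegral_fourth_le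
  refine ⟨K, hK, fun t₀ T ν hν => ?_⟩
  calc _ ≤ ∫⁻ t, K * (InformationTheory.klDiv (ν t) (priorMeasure ℓ) + 1) ∂(lebIcc t₀ T) :=
        lintegral_mono fun t => h _ (hν.isProbabilityMeasure t)
    _ = _ := by
        rw [lintegral_const_mul' _ _ hK, lintegral_add_right _ measurable_const, lintegral_one]

theorem AdmissibleControl.lintegral_fourth_ne_top (hℓ : RegularPotential ℓ) {t₀ T : ℝ}
    (ν : AdmissibleControl ℓ t₀ T) :
    ∫⁻ t, ∫⁻ a, ENNReal.ofReal (‖a‖ ^ 4) ∂(ν.kernel t) ∂(lebIcc t₀ T) ≠ ∞ := by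
  obtain ⟨K, hK, h⟩ := hℓ.exists_lintegral_lintegral_fourth_le
  have := lebIcc_isFiniteMeasure t₀ T
  exact ((h t₀ T ν.kernel ν.isMarkovKernel).trans_lt (ENNReal.mul_lt_top hK.lt_top
    (ENNReal.add_lt_top.2 ⟨ν.entropy, measure_lt_top _ _⟩))).ne

end Moments

/-! ### Variational formula for the entropy -/

section Variational

open InformationTheory

variable {α : Type*} [MeasurableSpace α] {μ π : Measure α} [IsFiniteMeasure μ] [IsFiniteMeasure π]

theorem integrable_of_abs_le {μ : Measure α} [IsFiniteMeasure μ] {f : α → ℝ} (hf : Measurable f)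
    {n : ℝ} (hn : ∀ a, |f a| ≤ n) : Integrable f μ :=
  Integrable.of_bound hf.aestronglyMeasurable n (ae_of_all _ hn)

theorem integrable_exp_of_abs_le {μ : Measure α} [IsFiniteMeasure μ] {f : α → ℝ}
    (hf : Measurable f) {n : ℝ} (hn : ∀ a, |f a| ≤ n) : Integrable (fun a => Real.exp (f a)) μ :=
  Integrable.of_bound (by fun_prop) (Real.exp n) (ae_of_all _ fun a => by
    rw [Real.norm_of_nonneg (Real.exp_pos _).le]
    exact Real.exp_le_exp.2 ((le_abs_self _).trans (hn a)))

theorem integral_le_of_klDiv_le {R : ℝ} (hR : 0 ≤ R) (h : klDiv μ π ≤ ENNReal.ofReal R) {f : α → ℝ}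
    (hf : Measurable f) {n : ℝ} (hn : ∀ a, |f a| ≤ n) :
    ∫ a, f a ∂μ ≤ R + ∫ a, (Real.exp (f a) - 1) ∂π := by
  obtain ⟨hac, hint⟩ := klDiv_ne_top_iff.1 (h.trans_lt ENNReal.ofReal_lt_top).ne
  have h1 := ENNReal.toReal_le_of_le_ofReal hR h
  rw [toReal_klDiv_eq_integral_klFun hac] at h1
  have hk := (integrable_klFun_rnDeriv_iff hac).2 hint
  have he : Integrable (fun a => Real.exp (f a) - 1) π :=
    (integrable_exp_of_abs_le hf hn).sub (integrable_const 1)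
  have hi : Integrable (fun a => (μ.rnDeriv π a).toReal * f a) π :=
    (integrable_rnDeriv_smul_iff hac).2 (integrable_of_abs_le hf hn)
  calc ∫ a, f a ∂μ = ∫ a, (μ.rnDeriv π a).toReal * f a ∂π := (integral_rnDeriv_smul hac).symm
    _ ≤ ∫ a, (klFun (μ.rnDeriv π a).toReal + (Real.exp (f a) - 1)) ∂π :=
        integral_mono hi (hk.add he) fun a => by
          rw [mul_comm]
          exact mul_le_klFun_add_exp ENNReal.toReal_nonneg
    _ ≤ R + ∫ a, (Real.exp (f a) - 1) ∂π := by
        rw [integral_add hk he]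
        gcongr

/-- For `z` the truncation of `y` to `[exp (-n), exp n]`, the product `(y - z) * log z` is
nonnegative: `log z` is `n` when `y` exceeds `z`, and `-n` when `y` is below it. -/
theorem klFun_clamp_le {n : ℝ} (hn : 0 ≤ n) (y : ℝ) :
    klFun (max (Real.exp (-n)) (min y (Real.exp n))) ≤
      y * Real.log (max (Real.exp (-n)) (min y (Real.exp n))) -
        (max (Real.exp (-n)) (min y (Real.exp n)) - 1) := by
  have h1 : Real.exp (-n) ≤ 1 := Real.exp_le_one_iff.2 (by linarith)
  have h2 : 1 ≤ Real.exp n := Real.one_le_exp hn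
  rw [klFun_apply]
  rcases le_total y (Real.exp n) with hyn | hyn
  · rw [min_eq_left hyn]
    rcases le_total (Real.exp (-n)) y with h3 | h3
    · rw [max_eq_right h3]
      linarith
    · rw [max_eq_left h3, Real.log_exp]
      nlinarith
  · rw [min_eq_right hyn, max_eq_right (h1.trans h2), Real.log_exp]
    nlinarith

/-- The optimal test function is the logarithm of the density, which need not be bounded. The
logarithm of the truncated density is an admissible substitute, and Fatou's lemma removes the
truncation. -/
theorem klDiv_le_of_forall_measurable {R : ℝ}
    (h : ∀ (f : α → ℝ) (n : ℝ), Measurable f → (∀ a, |f a| ≤ n) →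
      ∫ a, f a ∂μ ≤ R + ∫ a, (Real.exp (f a) - 1) ∂π) : klDiv μ π ≤ ENNReal.ofReal R := by
  have hac : μ ≪ π := by
    refine Measure.AbsolutelyContinuous.mk fun s hs hπs => ?_
    by_contra hne
    have hpos : 0 < μ.real s := ENNReal.toReal_pos hne (measure_ne_top _ _)
    -- On a `π`-null set of positive `μ`-mass, the test function `n` times the indicator costs
    -- nothing under `π` and violates the bound for large `n`.
    obtain ⟨n, hn⟩ := exists_nat_gt (R / μ.real s)
    rw [div_lt_iff₀ hpos] at hn
    have h1 := h (s.indicator fun _ => (n : ℝ)) n (measurable_const.indicator hs) fun a => by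
      by_cases ha : a ∈ s <;> simp [ha]
    rw [integral_indicator_const _ hs, smul_eq_mul] at h1
    have h2 : ∫ a, (Real.exp (s.indicator (fun _ => (n : ℝ)) a) - 1) ∂π = 0 := by
      refine integral_eq_zero_of_ae ?_
      filter_upwards [measure_eq_zero_iff_ae_notMem.1 hπs] with a ha
      simp [ha]
    rw [h2] at h1
    linarith
  set ρ : α → ℝ := fun a => (μ.rnDeriv π a).toReal with hρ
  have hρm : Measurable ρ := by fun_prop
  have hρ0 : ∀ a, 0 ≤ ρ a := fun a => ENNReal.toReal_nonneg
  set c : ℕ → α → ℝ := fun n a => max (Real.exp (-n)) (min (ρ a) (Real.exp n)) with hc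
  have hcm : ∀ n, Measurable (c n) := fun n => by fun_prop
  have hc1 : ∀ (n : ℕ) a, Real.exp (-n) ≤ c n a := fun n a => le_max_left _ _
  have hc2 : ∀ (n : ℕ) a, c n a ≤ Real.exp n := fun n a =>
    max_le (Real.exp_le_exp.2 (by linarith [n.cast_nonneg (α := ℝ)])) (min_le_right _ _)
  have hc0 : ∀ n a, 0 < c n a := fun n a => (Real.exp_pos _).trans_le (hc1 n a)
  have hlim : ∀ a, Tendsto (fun n => c n a) atTop (𝓝 (ρ a)) := by
    intro a
    have h1 : Tendsto (fun n : ℕ => Real.exp (-n)) atTop (𝓝 0) :=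
      Real.tendsto_exp_neg_atTop_nhds_zero.comp tendsto_natCast_atTop_atTop
    have h2 : Tendsto (fun n : ℕ => min (ρ a) (Real.exp n)) atTop (𝓝 (ρ a)) := by
      refine tendsto_const_nhds.congr' ?_
      filter_upwards [(Real.tendsto_exp_atTop.comp tendsto_natCast_atTop_atTop).eventually_ge_atTop
        (ρ a)] with n hn
      exact (min_eq_left hn).symm
    have := h1.max h2
    rwa [max_eq_right (hρ0 a)] at this
  have hbound : ∀ n, ∫⁻ a, ENNReal.ofReal (klFun (c n a)) ∂π ≤ ENNReal.ofReal R := by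
    intro n
    have hlog : ∀ a, |Real.log (c n a)| ≤ n := fun a => abs_le.2
      ⟨(Real.le_log_iff_exp_le (hc0 n a)).2 (hc1 n a), (Real.log_le_iff_le_exp (hc0 n a)).2 (hc2 n a)⟩
    have hlm : Measurable fun a => Real.log (c n a) := (hcm n).log
    have h1 := h _ n hlm hlog
    rw [← integral_rnDeriv_smul hac] at h1
    simp only [smul_eq_mul] at h1
    have hi1 : Integrable (fun a => ρ a * Real.log (c n a)) π :=
      (integrable_rnDeriv_smul_iff hac).2 (integrable_of_abs_le hlm hlog)
    have hi2 : Integrable (fun a => Real.exp (Real.log (c n a)) - 1) π :=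
      (integrable_exp_of_abs_le hlm hlog).sub (integrable_const 1)
    have hpt : ∀ a, klFun (c n a) ≤ ρ a * Real.log (c n a) - (Real.exp (Real.log (c n a)) - 1) := by
      intro a
      rw [Real.exp_log (hc0 n a)]
      exact klFun_clamp_le n.cast_nonneg (ρ a)
    calc ∫⁻ a, ENNReal.ofReal (klFun (c n a)) ∂π
        ≤ ∫⁻ a, ENNReal.ofReal (ρ a * Real.log (c n a) - (Real.exp (Real.log (c n a)) - 1)) ∂π :=
          lintegral_mono fun a => ENNReal.ofReal_le_ofReal (hpt a)
      _ = ENNReal.ofReal (∫ a, (ρ a * Real.log (c n a) - (Real.exp (Real.log (c n a)) - 1)) ∂π) :=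
          (ofReal_integral_eq_lintegral_ofReal (hi1.sub hi2) (ae_of_all _ fun a =>
            (klFun_nonneg (hc0 n a).le).trans (hpt a))).symm
      _ ≤ ENNReal.ofReal R := by
          refine ENNReal.ofReal_le_ofReal ?_
          rw [integral_sub hi1 hi2]
          linarith
  rw [klDiv_eq_lintegral_klFun_of_ac hac]
  calc ∫⁻ a, ENNReal.ofReal (klFun (ρ a)) ∂π
      = ∫⁻ a, liminf (fun n => ENNReal.ofReal (klFun (c n a))) atTop ∂π := by
        refine lintegral_congr fun a => ?_
        exact (ENNReal.tendsto_ofReal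
          ((continuous_klFun.tendsto _).comp (hlim a))).liminf_eq.symm
    _ ≤ liminf (fun n => ∫⁻ a, ENNReal.ofReal (klFun (c n a)) ∂π) atTop :=
        lintegral_liminf_le fun n => (measurable_klFun.comp (hcm n)).ennreal_ofReal
    _ ≤ ENNReal.ofReal R := by
        refine liminf_le_of_le (by isBoundedDefault) fun r hr => ?_
        obtain ⟨n, hn⟩ := hr.exists
        exact hn.trans (hbound n)

theorem abs_exp_sub_exp_le {n x y : ℝ} (hx : x ≤ n) (hy : y ≤ n) :
    |Real.exp x - Real.exp y| ≤ Real.exp n * |x - y| := by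
  wlog hxy : y ≤ x generalizing x y
  · rw [abs_sub_comm, abs_sub_comm x]
    exact this hy hx (le_of_not_ge hxy)
  rw [abs_of_nonneg (sub_nonneg.2 (Real.exp_le_exp.2 hxy)), abs_of_nonneg (sub_nonneg.2 hxy)]
  have h1 := Real.add_one_le_exp (y - x)
  have h2 : Real.exp x ≤ Real.exp n := Real.exp_le_exp.2 hx
  have h3 : Real.exp y = Real.exp x * Real.exp (y - x) := by rw [← Real.exp_add]; ring_nf
  rw [h3]
  nlinarith [Real.exp_pos x, sub_nonneg.2 hxy]

variable [TopologicalSpace α] [TopologicalSpace.PseudoMetrizableSpace α] [BorelSpace α]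

/-- A bounded measurable function is approximated in `L¹(μ + π)` by a continuous one. Truncating the
latter at the same level `n` does not spoil the approximation, and makes the exponential `exp
n`-Lipschitz on the values involved. -/
theorem klDiv_le_of_forall_continuous {R : ℝ}
    (h : ∀ f : BoundedContinuousFunction α ℝ,
      ∫ a, f a ∂μ ≤ R + ∫ a, (Real.exp (f a) - 1) ∂π) : klDiv μ π ≤ ENNReal.ofReal R := by
  refine klDiv_le_of_forall_measurable fun f n hf hn => ?_
  -- Without a point of `α` nothing forces `0 ≤ n`, so the empty case is treated apart.
  rcases isEmpty_or_nonempty α with hα | ⟨⟨a₀⟩⟩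
  · have h0 := h 0
    simp only [Measure.eq_zero_of_isEmpty, integral_zero_measure, add_zero] at h0 ⊢
    exact h0
  have hn0 : 0 ≤ n := (abs_nonneg _).trans (hn a₀)
  refine le_of_forall_pos_le_add fun δ hδ => ?_
  set δ' := δ / (1 + Real.exp n) with hδ'
  have hpos : 0 < δ' := by positivity
  obtain ⟨g, hg, hgi⟩ := (integrable_of_abs_le (μ := μ + π) hf
    hn).exists_boundedContinuous_integral_sub_le hpos
  set g' : BoundedContinuousFunction α ℝ := BoundedContinuousFunction.mkOfBound
    ⟨fun a => max (-n) (min (g a) n), by fun_prop⟩ (2 * n) fun a b => by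
      have h1 : ∀ a, -n ≤ max (-n) (min (g a) n) ∧ max (-n) (min (g a) n) ≤ n := fun a =>
        ⟨le_max_left _ _, max_le (by linarith) (min_le_right _ _)⟩
      rw [Real.dist_eq, abs_le]
      simp only [ContinuousMap.coe_mk]
      constructor <;> linarith [(h1 a).1, (h1 b).1, (h1 a).2, (h1 b).2] with hg'
  have hg'a : ∀ a, g' a = max (-n) (min (g a) n) := fun a => rfl
  have hg'n : ∀ a, |g' a| ≤ n := fun a => by
    rw [hg'a, abs_le]
    exact ⟨le_max_left _ _, max_le (by linarith) (min_le_right _ _)⟩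
  have hclose : ∀ a, |f a - g' a| ≤ |f a - g a| := fun a => by
    have h1 := abs_le.1 (hn a)
    have h2 : f a = max (-n) (min (f a) n) := by rw [min_eq_left h1.2, max_eq_right h1.1]
    rw [hg'a]
    conv_lhs => rw [h2]
    have h3 := abs_max_sub_max_le_max (-n) (min (f a) n) (-n) (min (g a) n)
    have h4 := abs_min_sub_min_le_max (f a) n (g a) n
    simp only [sub_self, abs_zero, abs_nonneg, sup_of_le_left, sup_of_le_right] at h3 h4
    exact h3.trans h4
  have hg'm : Measurable g' := g'.continuous.measurable
  have hdiff : Integrable (fun a => |f a - g' a|) (μ + π) :=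
    ((integrable_of_abs_le hf hn).sub (integrable_of_abs_le hg'm hg'n)).abs
  have hsum : ∫ a, |f a - g' a| ∂μ + ∫ a, |f a - g' a| ∂π ≤ δ' := by
    rw [← integral_add_measure hdiff.left_of_add_measure hdiff.right_of_add_measure]
    refine (integral_mono hdiff ?_ fun a => hclose a).trans hg
    exact ((integrable_of_abs_le hf hn).sub hgi).abs
  have hp1 : 0 ≤ ∫ a, |f a - g' a| ∂μ := integral_nonneg fun a => abs_nonneg _
  have hp2 : 0 ≤ ∫ a, |f a - g' a| ∂π := integral_nonneg fun a => abs_nonneg _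
  have h1 : ∫ a, f a ∂μ ≤ ∫ a, g' a ∂μ + ∫ a, |f a - g' a| ∂μ := by
    rw [← integral_add (integrable_of_abs_le hg'm hg'n) hdiff.left_of_add_measure]
    refine integral_mono (integrable_of_abs_le hf hn)
      ((integrable_of_abs_le hg'm hg'n).add hdiff.left_of_add_measure) fun a => ?_
    linarith [le_abs_self (f a - g' a)]
  have h2 : ∫ a, (Real.exp (g' a) - 1) ∂π ≤
      ∫ a, (Real.exp (f a) - 1) ∂π + Real.exp n * ∫ a, |f a - g' a| ∂π := by
    have hfe : Integrable (fun a => Real.exp (f a) - 1) π :=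
      (integrable_exp_of_abs_le hf hn).sub (integrable_const 1)
    rw [← integral_const_mul, ← integral_add hfe (hdiff.right_of_add_measure.const_mul _)]
    refine integral_mono ((integrable_exp_of_abs_le hg'm hg'n).sub (integrable_const 1))
      (hfe.add (hdiff.right_of_add_measure.const_mul _)) fun a => ?_
    have := abs_exp_sub_exp_le ((le_abs_self _).trans (hg'n a)) ((le_abs_self _).trans (hn a))
    rw [abs_sub_comm (g' a)] at this
    linarith [le_abs_self (Real.exp (g' a) - Real.exp (f a))]
  have h3 := h g'
  have h4 : ∫ a, |f a - g' a| ∂μ + Real.exp n * ∫ a, |f a - g' a| ∂π ≤ δ := by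
    calc _ ≤ (1 + Real.exp n) * (∫ a, |f a - g' a| ∂μ + ∫ a, |f a - g' a| ∂π) := by
          nlinarith [Real.exp_pos n, mul_nonneg (Real.exp_pos n).le hp1]
      _ ≤ (1 + Real.exp n) * δ' := by gcongr
      _ = δ := by rw [hδ']; field_simp
  linarith

/-- The entropy is lower semicontinuous for the weak convergence of finite measures. -/
theorem isClosed_klDiv_le (π : Measure α) [IsFiniteMeasure π] {R : ℝ} (hR : 0 ≤ R) :
    IsClosed {μ : FiniteMeasure α | klDiv (μ : Measure α) π ≤ ENNReal.ofReal R} := by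
  have : {μ : FiniteMeasure α | klDiv (μ : Measure α) π ≤ ENNReal.ofReal R} =
      ⋂ f : BoundedContinuousFunction α ℝ,
        {μ : FiniteMeasure α | ∫ a, f a ∂(μ : Measure α) ≤ R + ∫ a, (Real.exp (f a) - 1) ∂π} := by
    ext μ
    simp only [mem_ofPred_eq, mem_iInter]
    exact ⟨fun h f => integral_le_of_klDiv_le hR h f.continuous.measurable
      fun a => f.norm_coe_le_norm a, klDiv_le_of_forall_continuous⟩
  rw [this]
  exact isClosed_iInter fun f => isClosed_le
    (FiniteMeasure.continuous_integral_boundedContinuousFunction f) continuous_const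

end Variational

/-! ### Compactness of the controls of bounded entropy -/

section Compactness

open InformationTheory

variable {d' : ℕ} {ℓ : RSp d' → ℝ} {t₀ T : ℝ}

/-- The total entropy of a control. -/
noncomputable def AdmissibleControl.totalEntropy (ν : AdmissibleControl ℓ t₀ T) : ℝ≥0∞ :=
  ∫⁻ t, klDiv (ν.kernel t) (priorMeasure ℓ) ∂(lebIcc t₀ T)

theorem AdmissibleControl.totalEntropy_ne_top (ν : AdmissibleControl ℓ t₀ T) :
    ν.totalEntropy ≠ ∞ := ν.entropy.ne

theorem AdmissibleControl.coe_toFiniteMeasure (ν : AdmissibleControl ℓ t₀ T) :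
    (ν.toFiniteMeasure : Measure (Icc t₀ T × RSp d')) = lebIcc t₀ T ⊗ₘ ν.kernel := rfl

theorem AdmissibleControl.totalEntropy_eq_klDiv (hℓ : RegularPotential ℓ)
    (ν : AdmissibleControl ℓ t₀ T) :
    ν.totalEntropy = klDiv (ν.toFiniteMeasure : Measure (Icc t₀ T × RSp d'))
      ((lebIcc t₀ T).prod (priorMeasure ℓ)) := by
  have := ν.isMarkovKernel
  have := lebIcc_isFiniteMeasure t₀ T
  have := hℓ.isProbabilityMeasure
  exact lintegral_klDiv_eq_klDiv_compProd _ _ _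

theorem AdmissibleControl.isInducing_toFiniteMeasure :
    IsInducing (AdmissibleControl.toFiniteMeasure (ℓ := ℓ) (t₀ := t₀) (T := T)) := ⟨rfl⟩

theorem AdmissibleControl.mass_toFiniteMeasure (ν : AdmissibleControl ℓ t₀ T) :
    (ν.toFiniteMeasure : Measure (Icc t₀ T × RSp d')) univ = lebIcc t₀ T univ := by
  have := ν.isMarkovKernel
  have := lebIcc_isFiniteMeasure t₀ T
  rw [coe_toFiniteMeasure, Measure.compProd_apply_univ]

theorem AdmissibleControl.fst_toFiniteMeasure (ν : AdmissibleControl ℓ t₀ T) :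
    (ν.toFiniteMeasure : Measure (Icc t₀ T × RSp d')).fst = lebIcc t₀ T := by
  have := ν.isMarkovKernel
  have := lebIcc_isFiniteMeasure t₀ T
  rw [coe_toFiniteMeasure, Measure.fst_compProd]

theorem AdmissibleControl.lintegral_toFiniteMeasure (ν : AdmissibleControl ℓ t₀ T)
    {f : RSp d' → ℝ≥0∞} (hf : Measurable f) :
    ∫⁻ p, f p.2 ∂(ν.toFiniteMeasure : Measure (Icc t₀ T × RSp d')) =
      ∫⁻ t, ∫⁻ a, f a ∂(ν.kernel t) ∂(lebIcc t₀ T) := by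
  have := ν.isMarkovKernel
  have := lebIcc_isFiniteMeasure t₀ T
  rw [coe_toFiniteMeasure, Measure.lintegral_compProd (by fun_prop)]

theorem AdmissibleControl.isClosed_totalEntropy_le (hℓ : RegularPotential ℓ) {R : ℝ} (hR : 0 ≤ R) :
    IsClosed {ν : AdmissibleControl ℓ t₀ T | ν.totalEntropy ≤ ENNReal.ofReal R} := by
  have := lebIcc_isFiniteMeasure t₀ T
  have := hℓ.isProbabilityMeasure
  simp only [totalEntropy_eq_klDiv hℓ]
  exact (isClosed_klDiv_le ((lebIcc t₀ T).prod (priorMeasure ℓ)) hR).preimage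
    isInducing_toFiniteMeasure.continuous

/-- A finite measure with Lebesgue first marginal disintegrates along time, and its conditional
kernel is a control with the same entropy. The image is thus cut out by two conditions that are
closed for the weak topology. -/
theorem AdmissibleControl.image_totalEntropy_le (hℓ : RegularPotential ℓ) (R : ℝ) :
    toFiniteMeasure '' {ν : AdmissibleControl ℓ t₀ T | ν.totalEntropy ≤ ENNReal.ofReal R} =
      {μ : FiniteMeasure (Icc t₀ T × RSp d') | (μ : Measure (Icc t₀ T × RSp d')).fst = lebIcc t₀ T ∧
        klDiv (μ : Measure (Icc t₀ T × RSp d')) ((lebIcc t₀ T).prod (priorMeasure ℓ)) ≤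
          ENNReal.ofReal R} := by
  have := lebIcc_isFiniteMeasure t₀ T
  have := hℓ.isProbabilityMeasure
  refine Subset.antisymm ?_ ?_
  · rintro _ ⟨ν, hν, rfl⟩
    rw [mem_ofPred_eq, totalEntropy_eq_klDiv hℓ] at hν
    exact ⟨ν.fst_toFiniteMeasure, hν⟩
  · rintro μ ⟨h1, h2⟩
    have hdis : lebIcc t₀ T ⊗ₘ (μ : Measure (Icc t₀ T × RSp d')).condKernel = μ := by
      conv_lhs => rw [← h1]
      exact Measure.disintegrate _ _
    have hE : ∫⁻ t, klDiv ((μ : Measure (Icc t₀ T × RSp d')).condKernel t) (priorMeasure ℓ)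
        ∂(lebIcc t₀ T) ≤ ENNReal.ofReal R := by
      rw [lintegral_klDiv_eq_klDiv_compProd, hdis]
      exact h2
    exact ⟨⟨_, inferInstance, hE.trans_lt ENNReal.ofReal_lt_top⟩, hE,
      FiniteMeasure.toMeasure_injective hdis⟩

theorem AdmissibleControl.exists_lintegral_fourth_le (hℓ : RegularPotential ℓ) (t₀ T R : ℝ) :
    ∃ M : ℝ, 0 ≤ M ∧ ∀ ν : AdmissibleControl ℓ t₀ T, ν.totalEntropy ≤ ENNReal.ofReal R →
      ∫⁻ t, ∫⁻ a, ENNReal.ofReal (‖a‖ ^ 4) ∂(ν.kernel t) ∂(lebIcc t₀ T) ≤ ENNReal.ofReal M := by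
  obtain ⟨K, hK, h⟩ := hℓ.exists_lintegral_lintegral_fourth_le
  have := lebIcc_isFiniteMeasure t₀ T
  have hne : K * (ENNReal.ofReal R + lebIcc t₀ T univ) ≠ ∞ :=
    ENNReal.mul_ne_top hK (ENNReal.add_ne_top.2 ⟨ENNReal.ofReal_ne_top, measure_ne_top _ _⟩)
  refine ⟨(K * (ENNReal.ofReal R + lebIcc t₀ T univ)).toReal, ENNReal.toReal_nonneg,
    fun ν hν => ?_⟩
  rw [ENNReal.ofReal_toReal hne]
  refine (h t₀ T ν.kernel ν.isMarkovKernel).trans ?_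
  gcongr
  exact hν

/-- The controls of bounded entropy form a weakly compact set. -/
theorem AdmissibleControl.isCompact_totalEntropy_le (hℓ : RegularPotential ℓ) {R : ℝ}
    (hR : 0 ≤ R) : IsCompact {ν : AdmissibleControl ℓ t₀ T | ν.totalEntropy ≤ ENNReal.ofReal R} := by
  have hfin := lebIcc_isFiniteMeasure t₀ T
  have := hℓ.isProbabilityMeasure
  obtain ⟨M, hM0, hM⟩ := exists_lintegral_fourth_le hℓ t₀ T R
  have himage := image_totalEntropy_le (t₀ := t₀) (T := T) hℓ R
  rw [isInducing_toFiniteMeasure.isCompact_iff]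
  -- Tightness by Markov's inequality: the mass outside is at most `M / (n + 1)`. The shift by `1`
  -- ensures `1 ≤ ‖a‖` there, so that `n + 1 ≤ ‖a‖ ≤ ‖a‖ ^ 4`.
  let K : ℕ → Set (Icc t₀ T × RSp d') := fun n => univ ×ˢ Metric.closedBall 0 (n + 1)
  let u : ℕ → NNReal := fun n => (M / (n + 1)).toNNReal
  have hu : Tendsto u atTop (𝓝 0) := by
    have h1 : Tendsto (fun n : ℕ => M / ((n : ℝ) + 1)) atTop (𝓝 0) :=
      tendsto_const_nhds.div_atTop (tendsto_natCast_atTop_atTop.atTop_add tendsto_const_nhds)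
    simpa [u, Function.comp_def] using (continuous_real_toNNReal.tendsto 0).comp h1
  have hK : ∀ n, IsCompact (K n) := fun n =>
    isCompact_univ.prod (isCompact_closedBall _ _)
  refine (isCompact_setOfPred_finiteMeasure_mass_eq_compl_isCompact_le
    (lebIcc t₀ T univ).toNNReal hu hK (Or.inl inferInstance)).of_isClosed_subset ?_ ?_
  · rw [himage]
    refine IsClosed.inter ?_ (isClosed_klDiv_le _ hR)
    have hset : {μ : FiniteMeasure (Icc t₀ T × RSp d') | (μ : Measure (Icc t₀ T × RSp d')).fst = lebIcc t₀ T} =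
        {μ : FiniteMeasure (Icc t₀ T × RSp d') | μ.map Prod.fst = ⟨lebIcc t₀ T, hfin⟩} := by
      ext μ
      simp only [mem_ofPred_eq]
      constructor
      · intro h
        exact FiniteMeasure.toMeasure_injective (by simpa [Measure.fst] using h)
      · intro h
        have := congrArg FiniteMeasure.toMeasure h
        simpa [Measure.fst] using this
    change IsClosed {μ : FiniteMeasure (Icc t₀ T × RSp d') |
      (μ : Measure (Icc t₀ T × RSp d')).fst = lebIcc t₀ T}
    rw [hset]
    exact isClosed_eq (FiniteMeasure.continuous_map continuous_fst) continuous_const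
  · rintro _ ⟨ν, hν, rfl⟩
    refine ⟨?_, fun n => ?_⟩
    · rw [FiniteMeasure.mass, ← ν.mass_toFiniteMeasure]
      rfl
    · have hn : (0 : ℝ) < n + 1 := by positivity
      have h1 : (ENNReal.ofReal (n + 1)) *
          (ν.toFiniteMeasure : Measure (Icc t₀ T × RSp d')) (K n)ᶜ ≤ ENNReal.ofReal M := by
        refine le_trans ?_ (hM ν hν)
        rw [← ν.lintegral_toFiniteMeasure (by fun_prop)]
        refine le_trans ?_ (mul_meas_ge_le_lintegral₀ (by fun_prop) (ENNReal.ofReal (n + 1)))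
        gcongr
        intro p hp
        simp only [K, mem_compl_iff, mem_prod, mem_univ, true_and, mem_closedBall_zero_iff,
          not_le] at hp
        refine ENNReal.ofReal_le_ofReal (hp.le.trans ?_)
        exact le_self_pow₀ (by linarith [n.cast_nonneg (α := ℝ)]) (by norm_num)
      rw [← ENNReal.coe_le_coe, FiniteMeasure.ennreal_coeFn_eq_coeFn_toMeasure]
      change _ ≤ ENNReal.ofReal (M / (n + 1))
      rw [ENNReal.ofReal_div_of_pos hn, ENNReal.le_div_iff_mul_le
        (Or.inl (ENNReal.ofReal_pos.2 hn).ne') (Or.inl ENNReal.ofReal_ne_top), mul_comm]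
      exact h1

end Compactness

/-! ### Countable neighbourhood bases in the space of controls -/

section FirstCountable

variable {d' : ℕ} {ℓ : RSp d' → ℝ} {t₀ T : ℝ}

/-- All controls have the same mass, so neighbourhoods can be pulled back from probability measures
by normalization, where they are countably generated. If the mass is zero, all controls have the
same image and the topology is trivial. Dominated convergence along neighbourhood filters needs this
property. -/
theorem AdmissibleControl.isCountablyGenerated_nhds (h : t₀ ≤ T) (ν : AdmissibleControl ℓ t₀ T) :
    (𝓝 ν).IsCountablyGenerated := by
  have : Nonempty (Icc t₀ T) := ⟨⟨t₀, left_mem_Icc.2 h⟩⟩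
  have hmass : ∀ η : AdmissibleControl ℓ t₀ T, η.toFiniteMeasure.mass = ν.toFiniteMeasure.mass := by
    intro η
    rw [← ENNReal.coe_inj, FiniteMeasure.ennreal_mass, FiniteMeasure.ennreal_mass,
      mass_toFiniteMeasure, mass_toFiniteMeasure]
  by_cases h0 : ν.toFiniteMeasure = 0
  · have hall : ∀ η : AdmissibleControl ℓ t₀ T, η.toFiniteMeasure = ν.toFiniteMeasure := fun η => by
      rw [h0, ← FiniteMeasure.mass_zero_iff, hmass η, h0, FiniteMeasure.zero_mass]
    have : 𝓝 ν = ⊤ := by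
      rw [isInducing_toFiniteMeasure.nhds_eq_comap, eq_top_iff, ← tendsto_iff_comap]
      exact tendsto_nhds_of_eventually_eq (Eventually.of_forall hall)
    rw [this]
    infer_instance
  · have : 𝓝 ν = comap (fun η : AdmissibleControl ℓ t₀ T => η.toFiniteMeasure.normalize)
        (𝓝 ν.toFiniteMeasure.normalize) := by
      refine le_antisymm ?_ ?_
      · rw [← tendsto_iff_comap]
        exact FiniteMeasure.tendsto_normalize_of_tendsto
          isInducing_toFiniteMeasure.continuous.continuousAt h0
      · rw [isInducing_toFiniteMeasure.nhds_eq_comap, ← tendsto_iff_comap]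
        refine (FiniteMeasure.tendsto_normalize_iff_tendsto h0).1 ⟨tendsto_comap, ?_⟩
        exact tendsto_nhds_of_eventually_eq (Eventually.of_forall hmass)
    rw [this]
    infer_instance

end FirstCountable

/-! ### Stability of the flow with respect to the field -/

section Stability

variable {E : Type*} [NormedAddCommGroup E] [NormedSpace ℝ E] [CompleteSpace E]
  [MeasurableSpace E] [BorelSpace E] [SecondCountableTopology E]

/-- The fields are compared only through the integrated discrepancy `e` along the fixed solution
`u'`, in mean square and at the final time. Weak convergence of controls provides exactly that, and
gives no pointwise closeness of the fields. -/
theorem CaratheodoryField.norm_solution_sub_le {B B' : ℝ → E → E} {κ κ' : ℝ → ℝ}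
    (hB : CaratheodoryField B κ) (hB' : CaratheodoryField B' κ') {t₀ T N δ : ℝ} (h : t₀ ≤ T)
    (hN : ∫ s in t₀..T, κ s ^ 2 ≤ N) (hδ : 0 < δ) {x : E} {u u' e : ℝ → E}
    (hu : Continuous u) (hu' : Continuous u')
    (hue : ∀ t ∈ Icc t₀ T, u t = x + ∫ s in t₀..t, B s (u s))
    (hue' : ∀ t ∈ Icc t₀ T, u' t = x + ∫ s in t₀..t, B' s (u' s))
    (he : ∀ t, e t = (∫ s in t₀..t, B s (u' s)) - ∫ s in t₀..t, B' s (u' s)) :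
    ‖u T - u' T‖ ≤ 2 * Real.exp (2 * (1 + N) * (T - t₀)) *
      (δ * N + δ⁻¹ * ∫ s in t₀..T, ‖e s‖ ^ 2) + ‖e T‖ := by
  have hec : Continuous e := by
    have : e = fun t => (∫ s in t₀..t, B s (u' s)) - ∫ s in t₀..t, B' s (u' s) := funext he
    rw [this]
    exact (intervalIntegral.continuous_primitive (fun a b => hB.intervalIntegrable hu' a b) _).sub
      (intervalIntegral.continuous_primitive (fun a b => hB'.intervalIntegrable hu' a b) _)
  set v : ℝ → ℝ := fun s => ‖u s - u' s‖ with hv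
  have hvc : Continuous v := (hu.sub hu').norm
  -- Grönwall's inequality is applied to `w` instead of `v`: its forcing term is the constant `G`,
  -- an integral of `κ‖e‖`, which Young's inequality splits with the free parameter `δ`.
  set w : ℝ → ℝ := fun t => ∫ s in t₀..t, κ s * v s with hw
  have hwc : Continuous w :=
    intervalIntegral.continuous_primitive (fun a b => hB.modulus.intervalIntegrable_mul hvc a b) _
  have hw0 : ∀ t ∈ Icc t₀ T, 0 ≤ w t := fun t ht =>
    intervalIntegral.integral_nonneg ht.1 fun s _ =>
      mul_nonneg (hB.modulus.nonneg s) (norm_nonneg _)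
  have hvle : ∀ t ∈ Icc t₀ T, v t ≤ |w t| + ‖e t‖ := by
    intro t ht
    have h1 : u t - u' t = ((∫ s in t₀..t, B s (u s)) - ∫ s in t₀..t, B s (u' s)) + e t := by
      rw [hue t ht, hue' t ht, he]
      abel
    rw [hv]
    simp only
    rw [h1, abs_of_nonneg (hw0 t ht)]
    exact (norm_add_le _ _).trans (add_le_add_left (hB.norm_integral_sub_le hu hu' ht.1) _)
  set G := ∫ s in t₀..T, κ s * ‖e s‖ with hG
  have hki := fun {f : ℝ → ℝ} (hf : Continuous f) (a b : ℝ) =>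
    hB.modulus.intervalIntegrable_mul hf a b
  have hG0 : 0 ≤ G := intervalIntegral.integral_nonneg h fun s _ =>
    mul_nonneg (hB.modulus.nonneg s) (norm_nonneg _)
  have hstep : ∀ t ∈ Icc t₀ T, |w t| ≤ G + ∫ s in t₀..t, κ s * |w s| := by
    intro t ht
    rw [abs_of_nonneg (hw0 t ht)]
    have h1 : w t ≤ ∫ s in t₀..t, (κ s * ‖e s‖ + κ s * |w s|) := by
      refine intervalIntegral.integral_mono_on ht.1 (hki hvc _ _)
        ((hki hec.norm _ _).add (hki hwc.abs _ _)) fun s hs => ?_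
      rw [← mul_add, add_comm]
      exact mul_le_mul_of_nonneg_left (hvle s ⟨hs.1, hs.2.trans ht.2⟩) (hB.modulus.nonneg s)
    rw [intervalIntegral.integral_add (hki hec.norm _ _) (hki hwc.abs _ _)] at h1
    have h2 : ∫ s in t₀..t, κ s * ‖e s‖ ≤ G :=
      intervalIntegral.integral_mono_interval le_rfl ht.1 ht.2
        (ae_of_all _ fun s => mul_nonneg (hB.modulus.nonneg s) (norm_nonneg _)) (hki hec.norm _ _)
    linarith
  have hTmem : T ∈ Icc t₀ T := right_mem_Icc.2 h
  have hgr := hB.modulus.gronwall hN hG0 hwc.abs (fun t => abs_nonneg _) hstep hTmem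
  have hGle : G ≤ δ * N + δ⁻¹ * ∫ s in t₀..T, ‖e s‖ ^ 2 := by
    have hsq : IntervalIntegrable (fun s => ‖e s‖ ^ 2) volume t₀ T :=
      (hec.norm.pow 2).intervalIntegrable _ _
    have h1 : G ≤ ∫ s in t₀..T, (δ * κ s ^ 2 + δ⁻¹ * ‖e s‖ ^ 2) := by
      refine intervalIntegral.integral_mono_on h (hki hec.norm _ _)
        (((hB.modulus.sq_integrable _ _).const_mul _).add (hsq.const_mul _)) fun s _ => ?_
      have h2 : δ⁻¹ * (δ * κ s - ‖e s‖) ^ 2 =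
          δ * κ s ^ 2 - 2 * (κ s * ‖e s‖) + δ⁻¹ * ‖e s‖ ^ 2 := by
        field_simp
        ring
      have h3 : 0 ≤ δ⁻¹ * (δ * κ s - ‖e s‖) ^ 2 := by positivity
      have h4 : 0 ≤ κ s * ‖e s‖ := mul_nonneg (hB.modulus.nonneg s) (norm_nonneg _)
      linarith
    rw [intervalIntegral.integral_add ((hB.modulus.sq_integrable _ _).const_mul _)
      (hsq.const_mul _), intervalIntegral.integral_const_mul,
      intervalIntegral.integral_const_mul] at h1
    refine h1.trans ?_
    gcongr
  calc ‖u T - u' T‖ ≤ |w T| + ‖e T‖ := hvle T hTmem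
    _ ≤ _ := by
        gcongr
        refine hgr.trans ?_
        gcongr

end Stability

/-! ### Weak convergence against functions of subquadratic growth -/

section WeakConvergence

open AdmissibleControl

variable {d' : ℕ} {ℓ : RSp d' → ℝ} {t₀ T : ℝ}

theorem AdmissibleControl.integrable_fourth (hℓ : RegularPotential ℓ)
    (ν : AdmissibleControl ℓ t₀ T) :
    Integrable (fun p : Icc t₀ T × RSp d' => ‖p.2‖ ^ 4) (ν.toFiniteMeasure : Measure _) := by
  refine (lintegral_ofReal_ne_top_iff_integrable
    (by fun_prop : Measurable fun p : Icc t₀ T × RSp d' => ‖p.2‖ ^ 4).aestronglyMeasurable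
    (ae_of_all _ fun p => by positivity)).1 ?_
  rw [ν.lintegral_toFiniteMeasure (f := fun a => ENNReal.ofReal (‖a‖ ^ 4)) (by fun_prop)]
  exact ν.lintegral_fourth_ne_top hℓ

theorem AdmissibleControl.integrable_of_le (hℓ : RegularPotential ℓ)
    (ν : AdmissibleControl ℓ t₀ T) {G : Type*} [NormedAddCommGroup G]
    {f : Icc t₀ T × RSp d' → G} (hf : AEStronglyMeasurable f (ν.toFiniteMeasure : Measure _))
    {M : ℝ} (h : ∀ p, ‖f p‖ ≤ M * (1 + ‖p.2‖ ^ 4)) :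
    Integrable f (ν.toFiniteMeasure : Measure (Icc t₀ T × RSp d')) :=
  (((integrable_const 1).add (ν.integrable_fourth hℓ)).const_mul M).mono' hf (ae_of_all _ h)

theorem AdmissibleControl.exists_integral_fourth_le (hℓ : RegularPotential ℓ) (t₀ T R : ℝ) :
    ∃ M : ℝ, 0 ≤ M ∧ ∀ ν : AdmissibleControl ℓ t₀ T, ν.totalEntropy ≤ ENNReal.ofReal R →
      ∫ p, (1 + ‖p.2‖ ^ 4) ∂(ν.toFiniteMeasure : Measure (Icc t₀ T × RSp d')) ≤ M := by
  obtain ⟨M, hM0, hM⟩ := exists_lintegral_fourth_le hℓ t₀ T R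
  refine ⟨(lebIcc t₀ T).real univ + M, by positivity, fun ν hν => ?_⟩
  rw [integral_add (integrable_const 1) (ν.integrable_fourth hℓ), integral_const, smul_eq_mul,
    mul_one, measureReal_def, ν.mass_toFiniteMeasure, ← measureReal_def]
  gcongr
  rw [integral_eq_lintegral_of_nonneg_ae (ae_of_all _ fun p => by positivity) (by fun_prop)]
  refine ENNReal.toReal_le_of_le_ofReal hM0 ?_
  rw [ν.lintegral_toFiniteMeasure (f := fun a => ENNReal.ofReal (‖a‖ ^ 4)) (by fun_prop)]
  exact hM ν hν

theorem abs_sub_clamp_le {n : ℝ} (hn : 0 < n) (y : ℝ) :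
    |y - max (-n) (min y n)| ≤ y ^ 2 / n := by
  rw [le_div_iff₀ hn]
  rcases le_total y n with h1 | h1
  · rw [min_eq_left h1]
    rcases le_total (-n) y with h2 | h2
    · rw [max_eq_right h2, sub_self, abs_zero, zero_mul]
      positivity
    · rw [max_eq_left h2, abs_of_nonpos (by linarith)]
      nlinarith
  · rw [min_eq_right h1, max_eq_right (by linarith), abs_of_nonneg (by linarith)]
    nlinarith

/-- The integrand may be discontinuous in time and unbounded in `a`. Truncating `f` at height `n`
costs `f ^ 2 / n`, controlled by fourth moments uniformly on the sublevel; replacing `θ` by a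
continuous `χ` costs `n` times an `L¹` distance in time, the same for all controls because they
share their first marginal. -/
theorem AdmissibleControl.tendsto_integral (hℓ : RegularPotential ℓ) {R : ℝ}
    {ν₀ : AdmissibleControl ℓ t₀ T} (hν₀ : ν₀.totalEntropy ≤ ENNReal.ofReal R)
    {θ : Icc t₀ T → ℝ} (hθ : Measurable θ) (hθ1 : ∀ t, |θ t| ≤ 1)
    {f : Icc t₀ T × RSp d' → ℝ} (hf : Continuous f) {C : ℝ} (hC : 0 ≤ C)
    (hfC : ∀ p, f p ^ 2 ≤ C * (1 + ‖p.2‖ ^ 4)) :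
    Tendsto (fun ν : AdmissibleControl ℓ t₀ T =>
        ∫ p, θ p.1 * f p ∂(ν.toFiniteMeasure : Measure (Icc t₀ T × RSp d')))
      (𝓝[{ν | ν.totalEntropy ≤ ENNReal.ofReal R}] ν₀)
      (𝓝 (∫ p, θ p.1 * f p ∂(ν₀.toFiniteMeasure : Measure (Icc t₀ T × RSp d')))) := by
  have := lebIcc_isFiniteMeasure t₀ T
  obtain ⟨M, hM0, hM⟩ := exists_integral_fourth_le hℓ t₀ T R
  rw [Metric.tendsto_nhds]
  intro ε hε
  obtain ⟨n, hn0, hn⟩ : ∃ n : ℝ, 0 < n ∧ C * M / n ≤ ε / 8 := by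
    refine ⟨8 * (C * M) / ε + 1, by positivity, ?_⟩
    rw [div_le_iff₀ (by positivity)]
    have : ε / 8 * (8 * (C * M) / ε + 1) = C * M + ε / 8 := by field_simp
    rw [this]
    linarith
  obtain ⟨χ, hχ, hχi⟩ := (integrable_of_abs_le (μ := lebIcc t₀ T) hθ
    hθ1).exists_boundedContinuous_integral_sub_le (ε := ε / 8 / n) (by positivity)
  set g : Icc t₀ T × RSp d' → ℝ := fun p => χ p.1 * max (-n) (min (f p) n) with hg
  have hcl : ∀ y : ℝ, |max (-n) (min y n)| ≤ n := fun y =>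
    abs_le.2 ⟨le_max_left _ _, max_le (by linarith) (min_le_right _ _)⟩
  have hgc : Continuous g := (χ.continuous.comp continuous_fst).mul
    (continuous_const.max (hf.min continuous_const))
  have hgb : ∀ p, ‖g p‖ ≤ ‖χ‖ * n := fun p => by
    rw [hg, norm_mul]
    exact mul_le_mul (χ.norm_coe_le_norm _) (hcl _) (norm_nonneg _) (norm_nonneg _)
  set G : BoundedContinuousFunction (Icc t₀ T × RSp d') ℝ :=
    BoundedContinuousFunction.ofNormedAddCommGroup g hgc _ hgb with hG
  have hpt : ∀ p, |θ p.1 * f p - g p| ≤ f p ^ 2 / n + n * |θ p.1 - χ p.1| := by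
    intro p
    have h1 : θ p.1 * f p - g p = θ p.1 * (f p - max (-n) (min (f p) n)) +
        (θ p.1 - χ p.1) * max (-n) (min (f p) n) := by rw [hg]; ring
    rw [h1]
    refine (abs_add_le _ _).trans (add_le_add ?_ ?_)
    · rw [abs_mul]
      exact (mul_le_of_le_one_left (abs_nonneg _) (hθ1 _)).trans (abs_sub_clamp_le hn0 _)
    · rw [abs_mul, mul_comm]
      exact mul_le_mul_of_nonneg_right (hcl _) (abs_nonneg _)
  have hclose : ∀ ν : AdmissibleControl ℓ t₀ T, ν.totalEntropy ≤ ENNReal.ofReal R →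
      |∫ p, θ p.1 * f p ∂(ν.toFiniteMeasure : Measure (Icc t₀ T × RSp d')) -
        ∫ p, G p ∂(ν.toFiniteMeasure : Measure (Icc t₀ T × RSp d'))| ≤ ε / 4 := by
    intro ν hν
    set μ := ν.toFiniteMeasure.toMeasure with hμ
    have hfst : μ.map Prod.fst = lebIcc t₀ T := ν.fst_toFiniteMeasure
    have hi1 : Integrable (fun p => θ p.1 * f p) μ := by
      refine ν.integrable_of_le hℓ ((hθ.comp measurable_fst).mul hf.measurable).aestronglyMeasurable
        (M := C + 1) fun p => ?_
      rw [norm_mul]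
      refine (mul_le_of_le_one_left (norm_nonneg _) (hθ1 _)).trans ?_
      rw [Real.norm_eq_abs]
      have h1 := hfC p
      have h2 : (0 : ℝ) ≤ ‖p.2‖ ^ 4 := by positivity
      rw [← sq_abs] at h1
      nlinarith [sq_nonneg (|f p| - 1)]
    have hi2 : Integrable G μ := G.integrable μ
    have hi3 : Integrable (fun p => f p ^ 2) μ :=
      ν.integrable_of_le hℓ (hf.pow 2).aestronglyMeasurable (M := C) fun p => by
        rw [Real.norm_of_nonneg (sq_nonneg _)]
        exact hfC p
    have hi4' : Integrable (fun t => |θ t - χ t|) (lebIcc t₀ T) :=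
      ((integrable_of_abs_le hθ hθ1).sub hχi).abs
    have hi4 : Integrable (fun p : Icc t₀ T × RSp d' => |θ p.1 - χ p.1|) μ :=
      (hfst ▸ hi4').comp_measurable measurable_fst
    have h4 : ∫ p, |θ p.1 - χ p.1| ∂μ ≤ ε / 8 / n := by
      rw [← integral_map (φ := Prod.fst) (f := fun t => |θ t - χ t|)
        measurable_fst.aemeasurable (hfst ▸ hi4'.aestronglyMeasurable), hfst]
      exact hχ
    have h3 : ∫ p, f p ^ 2 ∂μ ≤ C * M := by
      calc _ ≤ ∫ p, C * (1 + ‖p.2‖ ^ 4) ∂μ :=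
            integral_mono hi3 (((integrable_const 1).add (ν.integrable_fourth hℓ)).const_mul C) hfC
        _ ≤ _ := by
            rw [integral_const_mul]
            exact mul_le_mul_of_nonneg_left (hM ν hν) hC
    rw [← integral_sub hi1 hi2]
    calc _ ≤ ∫ p, |θ p.1 * f p - G p| ∂μ := abs_integral_le_integral_abs
      _ ≤ ∫ p, (f p ^ 2 / n + n * |θ p.1 - χ p.1|) ∂μ :=
          integral_mono (hi1.sub hi2).abs ((hi3.div_const n).add (hi4.const_mul n)) hpt
      _ = (∫ p, f p ^ 2 ∂μ) / n + n * ∫ p, |θ p.1 - χ p.1| ∂μ := by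
          rw [integral_add (hi3.div_const n) (hi4.const_mul n), integral_div, integral_const_mul]
      _ ≤ C * M / n + n * (ε / 8 / n) := by gcongr
      _ ≤ ε / 4 := by
          rw [mul_div_cancel₀ _ hn0.ne']
          linarith
  have hlim : Tendsto (fun ν : AdmissibleControl ℓ t₀ T =>
      ∫ p, G p ∂(ν.toFiniteMeasure : Measure (Icc t₀ T × RSp d')))
      (𝓝[{ν | ν.totalEntropy ≤ ENNReal.ofReal R}] ν₀)
      (𝓝 (∫ p, G p ∂(ν₀.toFiniteMeasure : Measure (Icc t₀ T × RSp d')))) :=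
    (((FiniteMeasure.continuous_integral_boundedContinuousFunction G).comp
      isInducing_toFiniteMeasure.continuous).tendsto ν₀).mono_left nhdsWithin_le_nhds
  filter_upwards [(Metric.tendsto_nhds.1 hlim) (ε / 4) (by positivity), self_mem_nhdsWithin]
    with ν h1 h2
  rw [Real.dist_eq] at h1 ⊢
  have h3 := abs_le.1 (hclose ν h2)
  have h4 := abs_le.1 (hclose ν₀ hν₀)
  have h5 := abs_lt.1 h1
  rw [abs_lt]
  constructor <;> linarith [h3.1, h3.2, h4.1, h4.2, h5.1, h5.2]

end WeakConvergence

/-! ### Stability of the state with respect to the control -/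

section ControlStability

open AdmissibleControl

variable {d₁ d₂ d' : ℕ} {t₀ T : ℝ} {b : RSp d₁ → RSp d' → RSp d₁} {C : ℝ} {ℓ : RSp d' → ℝ}

theorem DriftBounds.norm_le (hb : DriftBounds b C) (x : RSp d₁) (a : RSp d') :
    ‖b x a‖ ≤ C * 2 * (1 + ‖a‖ ^ 4) := by
  have := hb.one_le
  refine (hb.bound x a).trans ?_
  rw [mul_assoc]
  exact mul_le_mul_of_nonneg_left (one_add_norm_le a) (by linarith)

theorem integrable_indicator_drift (hℓ : RegularPotential ℓ) (hb : DriftBounds b C)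
    (ν : AdmissibleControl ℓ t₀ T) {Y : Icc t₀ T → RSp d₁} (hY : Continuous Y) (t : Icc t₀ T) :
    Integrable (fun p : Icc t₀ T × RSp d' =>
      (Iic t).indicator (fun _ => (1 : ℝ)) p.1 • b (Y p.1) p.2)
      (ν.toFiniteMeasure.toMeasure) := by
  have hbY : Continuous fun p : Icc t₀ T × RSp d' => b (Y p.1) p.2 :=
    hb.continuous.comp ((hY.comp continuous_fst).prodMk continuous_snd)
  have hθ : Measurable fun p : Icc t₀ T × RSp d' => (Iic t).indicator (fun _ => (1 : ℝ)) p.1 :=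
    (measurable_const.indicator measurableSet_Iic).comp measurable_fst
  refine ν.integrable_of_le hℓ (hθ.smul hbY.measurable).aestronglyMeasurable (M := C * 2)
    fun p => ?_
  rw [norm_smul]
  refine (mul_le_of_le_one_left (norm_nonneg _) ?_).trans (hb.norm_le _ _)
  refine (norm_indicator_le_norm_self _ _).trans ?_
  simp

/-- Exhibits the integrated drift along a curve as an integral against `dν_t dt`, the form in which
weak convergence can be used. -/
theorem integral_driftField_eq (hℓ : RegularPotential ℓ) (hb : DriftBounds b C) (h : t₀ ≤ T)
    (ν : AdmissibleControl ℓ t₀ T) {Y : ℝ → RSp d₁} (hY : Continuous Y) (t : Icc t₀ T) :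
    ∫ s in t₀..t, driftField b (extendKernel h ν.kernel) s (Y s) =
      ∫ p, (Iic t).indicator (fun _ => (1 : ℝ)) p.1 • b (Y p.1) p.2
        ∂(ν.toFiniteMeasure.toMeasure) := by
  have := ν.isMarkovKernel
  have := lebIcc_isFiniteMeasure t₀ T
  have hi := integrable_indicator_drift hℓ hb ν (hY.comp continuous_subtype_val) t
  simp only [Function.comp_apply] at hi
  rw [coe_toFiniteMeasure] at hi ⊢
  rw [Measure.integral_compProd hi]
  simp only [integral_smul]
  have h1 : ∀ r : Icc t₀ T, (Iic t).indicator (fun _ => (1 : ℝ)) r •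
      ∫ a, b (Y r) a ∂(ν.kernel r) =
        (Iic t).indicator (fun r : Icc t₀ T => ∫ a, b (Y r) a ∂(ν.kernel r)) r := by
    intro r
    by_cases hr : r ∈ Iic t <;> simp [hr]
  simp only [h1]
  rw [integral_indicator measurableSet_Iic, setIntegral_Iic_lebIcc h]
  refine intervalIntegral.integral_congr_ae ?_
  filter_upwards [(ae_restrict_iff' measurableSet_Icc).1
    (extendKernel_ae_eq h (ν.lintegral_fourth_ne_top hℓ))] with r hr hr'
  rw [uIoc_of_le t.2.1] at hr'
  have hmem : r ∈ Icc t₀ T := ⟨hr'.1.le, hr'.2.trans t.2.2⟩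
  rw [driftField, hr hmem, projIcc_of_mem h hmem]

theorem tendsto_integral_driftField (hℓ : RegularPotential ℓ) (hb : DriftBounds b C) (h : t₀ ≤ T)
    {R : ℝ} {ν₀ : AdmissibleControl ℓ t₀ T} (hν₀ : ν₀.totalEntropy ≤ ENNReal.ofReal R)
    {Y : ℝ → RSp d₁} (hY : Continuous Y) {t : ℝ} (ht : t ∈ Icc t₀ T) :
    Tendsto (fun ν : AdmissibleControl ℓ t₀ T =>
        ∫ s in t₀..t, driftField b (extendKernel h ν.kernel) s (Y s))
      (𝓝[{ν | ν.totalEntropy ≤ ENNReal.ofReal R}] ν₀)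
      (𝓝 (∫ s in t₀..t, driftField b (extendKernel h ν₀.kernel) s (Y s))) := by
  have hC := hb.one_le
  have hcoord : ∀ (ν : AdmissibleControl ℓ t₀ T) (i : Fin d₁),
      (∫ s in t₀..t, driftField b (extendKernel h ν.kernel) s (Y s)) i =
        ∫ p, (Iic (⟨t, ht⟩ : Icc t₀ T)).indicator (fun _ => (1 : ℝ)) p.1 * (b (Y p.1) p.2) i
          ∂(ν.toFiniteMeasure.toMeasure) := by
    intro ν i
    have h1 := integral_driftField_eq hℓ hb h ν hY ⟨t, ht⟩
    simp only at h1
    rw [h1]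
    exact ((EuclideanSpace.proj (𝕜 := ℝ) i).integral_comp_comm (integrable_indicator_drift hℓ hb ν
      (hY.comp continuous_subtype_val) ⟨t, ht⟩)).symm
  have hvec : ∀ i : Fin d₁, Tendsto (fun ν : AdmissibleControl ℓ t₀ T =>
        (∫ s in t₀..t, driftField b (extendKernel h ν.kernel) s (Y s)) i)
      (𝓝[{ν | ν.totalEntropy ≤ ENNReal.ofReal R}] ν₀)
      (𝓝 ((∫ s in t₀..t, driftField b (extendKernel h ν₀.kernel) s (Y s)) i)) := by
    intro i
    simp only [hcoord]
    have hbY : Continuous fun p : Icc t₀ T × RSp d' => b (Y p.1) p.2 :=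
      hb.continuous.comp (((hY.comp continuous_subtype_val).comp continuous_fst).prodMk
        continuous_snd)
    refine AdmissibleControl.tendsto_integral hℓ hν₀
      (θ := (Iic (⟨t, ht⟩ : Icc t₀ T)).indicator fun _ => (1 : ℝ))
      (f := fun p => (b (Y p.1) p.2) i) (measurable_const.indicator measurableSet_Iic) (fun s => ?_)
      ((EuclideanSpace.proj (𝕜 := ℝ) i).continuous.comp hbY) (C := 4 * C ^ 2) (by positivity)
      fun p => ?_
    · rw [← Real.norm_eq_abs]
      refine (norm_indicator_le_norm_self _ _).trans ?_
      simp
    · have h1 : |(b (Y p.1) p.2) i| ≤ C * (1 + ‖p.2‖) :=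
        (PiLp.norm_apply_le _ i).trans (hb.bound _ _)
      have h2 : (b (Y p.1) p.2) i ^ 2 ≤ (C * (1 + ‖p.2‖)) ^ 2 := by
        rw [← sq_abs]
        exact pow_le_pow_left₀ (abs_nonneg _) h1 2
      refine h2.trans ?_
      rw [mul_pow, mul_comm 4, mul_assoc]
      refine mul_le_mul_of_nonneg_left ?_ (sq_nonneg C)
      have := norm_nonneg p.2
      nlinarith [sq_nonneg (‖p.2‖ - 1), one_add_norm_sq_le p.2]
  exact ((PiLp.continuous_toLp 2 _).tendsto _).comp (tendsto_pi_nhds.2 hvec)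

theorem exists_integral_driftModulus_sq_le (hℓ : RegularPotential ℓ) (h : t₀ ≤ T) (C R : ℝ) :
    ∃ N : ℝ, 0 ≤ N ∧ ∀ ν : AdmissibleControl ℓ t₀ T, ν.totalEntropy ≤ ENNReal.ofReal R →
      ∫ s in t₀..T, driftModulus C (extendKernel h ν.kernel) s ^ 2 ≤ N := by
  obtain ⟨M, hM0, hM⟩ := exists_lintegral_fourth_le hℓ t₀ T R
  refine ⟨4 * C ^ 2 * ((T - t₀) + M), by have := sub_nonneg.2 h; positivity, fun ν hν => ?_⟩
  have := ν.isMarkovKernel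
  have hη := fourthMoment_extendKernel h (ν.lintegral_fourth_ne_top hℓ)
  simp only [driftModulus_sq]
  rw [intervalIntegral.integral_const_mul, intervalIntegral.integral_add intervalIntegrable_const
    (hη.intervalIntegrable _ _), intervalIntegral.integral_const, smul_eq_mul, mul_one]
  gcongr
  rw [intervalIntegral.integral_of_le h, ← integral_Icc_eq_integral_Ioc,
    integral_eq_lintegral_of_nonneg_ae (ae_of_all _ fun s => FourthMoment.fourth_nonneg _ s)
      (StronglyMeasurable.integral_kernel (by fun_prop : Measurable fun a : RSp d' =>
        ‖a‖ ^ 4).stronglyMeasurable).aestronglyMeasurable]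
  exact ENNReal.toReal_le_of_le_ofReal hM0 ((lintegral_fourth_extendKernel h ν.kernel).trans
    (hM ν hν))

theorem SquareModulus.integral_le {κ : ℝ → ℝ} (hκ : SquareModulus κ) {N t : ℝ}
    (hN : ∫ s in t₀..T, κ s ^ 2 ≤ N) (ht : t ∈ Icc t₀ T) :
    ∫ s in t₀..t, κ s ≤ T - t₀ + N := by
  have h := ht.1.trans ht.2
  calc ∫ s in t₀..t, κ s ≤ ∫ s in t₀..T, κ s :=
        intervalIntegral.integral_mono_interval le_rfl ht.1 ht.2
          (ae_of_all _ hκ.nonneg) (hκ.intervalIntegrable _ _)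
    _ ≤ ∫ s in t₀..T, (1 + κ s ^ 2) :=
        intervalIntegral.integral_mono_on h (hκ.intervalIntegrable _ _)
          (intervalIntegrable_const.add (hκ.sq_integrable _ _)) fun s _ => by
            nlinarith [sq_nonneg (κ s - 1)]
    _ ≤ T - t₀ + N := by
        rw [intervalIntegral.integral_add intervalIntegrable_const (hκ.sq_integrable _ _),
          intervalIntegral.integral_const, smul_eq_mul, mul_one]
        gcongr

/-- The discrepancy is measured along the limit trajectory `Y`, which does not move with the
control. It tends to `0` at each time and is uniformly bounded on the sublevel, so its mean square
tends to `0`, and the stability estimate concludes. -/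
theorem tendsto_flow (hℓ : RegularPotential ℓ) (hb : DriftBounds b C) (h : t₀ ≤ T)
    {R : ℝ} {ν₀ : AdmissibleControl ℓ t₀ T} (hν₀ : ν₀.totalEntropy ≤ ENNReal.ofReal R)
    {X : AdmissibleControl ℓ t₀ T → ℝ → RSp d₁ → RSp d₁}
    (hX : ∀ ν, CaratheodoryField.IsFlow (driftField b (extendKernel h ν.kernel)) t₀ T (X ν))
    (x : RSp d₁) :
    Tendsto (fun ν => X ν T x) (𝓝[{ν | ν.totalEntropy ≤ ENNReal.ofReal R}] ν₀)
      (𝓝 (X ν₀ T x)) := by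
  have := isCountablyGenerated_nhds h ν₀
  set l := 𝓝[{ν : AdmissibleControl ℓ t₀ T | ν.totalEntropy ≤ ENNReal.ofReal R}] ν₀ with hl
  have hlc : l.IsCountablyGenerated := by rw [hl, nhdsWithin]; infer_instance
  have hmk := fun ν : AdmissibleControl ℓ t₀ T => ν.isMarkovKernel
  obtain ⟨N, hN0, hN⟩ := exists_integral_driftModulus_sq_le hℓ h C R
  have hB := fun ν : AdmissibleControl ℓ t₀ T =>
    hb.caratheodoryField (fourthMoment_extendKernel h (ν.lintegral_fourth_ne_top hℓ))
  set Y : ℝ → RSp d₁ := fun s => X ν₀ s x with hYdef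
  have hY : Continuous Y := (hX ν₀).continuous_time x
  set e : AdmissibleControl ℓ t₀ T → ℝ → RSp d₁ := fun ν t =>
    (∫ s in t₀..t, driftField b (extendKernel h ν.kernel) s (Y s)) -
      ∫ s in t₀..t, driftField b (extendKernel h ν₀.kernel) s (Y s) with he
  have hec : ∀ ν, Continuous (e ν) := fun ν =>
    (intervalIntegral.continuous_primitive (fun a b => (hB ν).intervalIntegrable hY a b) _).sub
      (intervalIntegral.continuous_primitive (fun a b => (hB ν₀).intervalIntegrable hY a b) _)
  have helim : ∀ t ∈ Icc t₀ T, Tendsto (fun ν => ‖e ν t‖) l (𝓝 0) := by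
    intro t ht
    rw [← tendsto_zero_iff_norm_tendsto_zero]
    have := (tendsto_integral_driftField hℓ hb h hν₀ hY ht).sub_const
      (∫ s in t₀..t, driftField b (extendKernel h ν₀.kernel) s (Y s))
    rwa [sub_self] at this
  have hdrift : ∀ ν : AdmissibleControl ℓ t₀ T, ν.totalEntropy ≤ ENNReal.ofReal R →
      ∀ t ∈ Icc t₀ T, ‖∫ s in t₀..t, driftField b (extendKernel h ν.kernel) s (Y s)‖ ≤
        T - t₀ + N := fun ν hν t ht =>
    (intervalIntegral.norm_integral_le_of_norm_le ht.1 (ae_of_all _ fun s _ => (hB ν).bound s _)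
      ((hB ν).modulus.intervalIntegrable _ _)).trans ((hB ν).modulus.integral_le (hN ν hν) ht)
  have hsq : Tendsto (fun ν => ∫ s in t₀..T, ‖e ν s‖ ^ 2) l (𝓝 0) := by
    have h0 : ∫ _ in t₀..T, (0 : ℝ) = 0 := by simp
    rw [← h0]
    refine intervalIntegral.tendsto_integral_filter_of_dominated_convergence
      (fun _ => (2 * (T - t₀ + N)) ^ 2)
      (Eventually.of_forall fun ν => ((hec ν).norm.pow 2).aestronglyMeasurable) ?_
      intervalIntegrable_const (ae_of_all _ fun s hs => ?_)
    · filter_upwards [self_mem_nhdsWithin] with ν hν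
      refine ae_of_all _ fun s hs => ?_
      rw [uIoc_of_le h] at hs
      have hs' : s ∈ Icc t₀ T := Ioc_subset_Icc_self hs
      rw [Real.norm_of_nonneg (by positivity)]
      refine pow_le_pow_left₀ (norm_nonneg _) ?_ 2
      refine (norm_sub_le _ _).trans ?_
      linarith [hdrift ν hν s hs', hdrift ν₀ hν₀ s hs']
    · rw [uIoc_of_le h] at hs
      simpa using (helim s (Ioc_subset_Icc_self hs)).pow 2
  rw [Metric.tendsto_nhds]
  intro ε hε
  set K := 2 * Real.exp (2 * (1 + N) * (T - t₀)) with hK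
  have hK0 : 0 < K := by positivity
  -- `δ` is fixed before the control varies: it makes `K δ N` at most `ε / 3`, and the factor `δ⁻¹`
  -- then multiplies a quantity tending to `0`.
  set δ := ε / (3 * (K * N + 1)) with hδ
  have hδ0 : 0 < δ := by positivity
  have hδle : K * (δ * N) ≤ ε / 3 := by
    rw [hδ, div_mul_eq_mul_div, mul_div_assoc', div_le_iff₀ (by positivity)]
    nlinarith
  have hsq' := (hsq.const_mul (K * δ⁻¹))
  rw [mul_zero] at hsq'
  filter_upwards [hsq'.eventually (gt_mem_nhds (show 0 < ε / 3 by positivity)),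
    (helim T (right_mem_Icc.2 h)).eventually (gt_mem_nhds (show 0 < ε / 3 by positivity)),
    self_mem_nhdsWithin] with ν h1 h2 hν
  rw [dist_eq_norm]
  have h3 := (hB ν).norm_solution_sub_le (hB ν₀) h (hN ν hν) hδ0
    ((hX ν).continuous_time x) hY (fun t ht => (hX ν).eq t ht x) (fun t ht => (hX ν₀).eq t ht x)
    (e := e ν) fun t => rfl
  refine h3.trans_lt ?_
  rw [mul_add, ← mul_assoc K δ⁻¹]
  linarith

end ControlStability

/-! ### Semicontinuity of the cost -/

section Cost

open AdmissibleControl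

variable {d₁ d₂ d' : ℕ} {t₀ T : ℝ} {b : RSp d₁ → RSp d' → RSp d₁} {C : ℝ} {ℓ : RSp d' → ℝ}
  {L : RSp d₁ × RSp d₂ → ℝ}

theorem RegularCost.continuous (hL : RegularCost L) : Continuous L := by
  have h := (hL.differentiable 0 (by norm_num)).continuous
  have h1 : L = fun z => iteratedFDeriv ℝ 0 L z 0 := by
    funext z
    simp
  rw [h1]
  exact (ContinuousMultilinearMap.apply ℝ (fun _ : Fin 0 => RSp d₁ × RSp d₂) ℝ 0).continuous.comp h

theorem PTwo.integrable_norm_sq (γ : PTwo d₁ d₂) :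
    Integrable (fun z : RSp d₁ × RSp d₂ => ‖z.1‖ ^ 2 + ‖z.2‖ ^ 2) γ.meas :=
  (lintegral_ofReal_ne_top_iff_integrable (by fun_prop : Measurable fun z : RSp d₁ × RSp d₂ =>
    ‖z.1‖ ^ 2 + ‖z.2‖ ^ 2).aestronglyMeasurable (ae_of_all _ fun z => by positivity)).1
    γ.secondMoment.ne

theorem RegularCost.integrable (hL : RegularCost L) (γ : PTwo d₁ d₂) : Integrable L γ.meas := by
  obtain ⟨K, hK⟩ := hL.growth
  have := γ.isProbabilityMeasure
  refine (((integrable_const 1).add γ.integrable_norm_sq).const_mul K).mono'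
    hL.continuous.aestronglyMeasurable (ae_of_all _ fun z => ?_)
  have := (hK z).1
  rw [add_assoc] at this
  exact this

/-- All states are images of the same `γ₀`, so this is dominated convergence under `γ₀`. On the
sublevel the flow moves points by at most `D`, hence `L` along it has a common quadratic bound. -/
theorem tendsto_integral_stateCurve (hℓ : RegularPotential ℓ) (hb : DriftBounds b C)
    (hL : RegularCost L) (h : t₀ ≤ T) (γ₀ : PTwo d₁ d₂) {R : ℝ} {ν₀ : AdmissibleControl ℓ t₀ T}
    (hν₀ : ν₀.totalEntropy ≤ ENNReal.ofReal R) :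
    Tendsto (fun ν : AdmissibleControl ℓ t₀ T =>
        ∫ z, L z ∂(stateCurve b γ₀ ν ⟨T, right_mem_Icc.2 h⟩).meas)
      (𝓝[{ν | ν.totalEntropy ≤ ENNReal.ofReal R}] ν₀)
      (𝓝 (∫ z, L z ∂(stateCurve b γ₀ ν₀ ⟨T, right_mem_Icc.2 h⟩).meas)) := by
  have := isCountablyGenerated_nhds h ν₀
  set l := 𝓝[{ν : AdmissibleControl ℓ t₀ T | ν.totalEntropy ≤ ENNReal.ofReal R}] ν₀ with hl
  have hlc : l.IsCountablyGenerated := by rw [hl, nhdsWithin]; infer_instance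
  have hmk := fun ν : AdmissibleControl ℓ t₀ T => ν.isMarkovKernel
  have hprob := γ₀.isProbabilityMeasure
  obtain ⟨K, hK⟩ := hL.growth
  have hK0 : 0 ≤ K := by
    have := (abs_nonneg _).trans (hK 0).1
    simpa using this
  obtain ⟨N, hN0, hN⟩ := exists_integral_driftModulus_sq_le hℓ h C R
  have hB := fun ν : AdmissibleControl ℓ t₀ T =>
    hb.caratheodoryField (fourthMoment_extendKernel h (ν.lintegral_fourth_ne_top hℓ))
  choose X hX using fun ν => (hB ν).exists_flow h
  have hXm : ∀ ν, Continuous fun z : RSp d₁ × RSp d₂ => (X ν T z.1, z.2) := fun ν =>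
    ((hX ν).continuous.comp (continuous_const.prodMk continuous_fst)).prodMk continuous_snd
  have hint : ∀ ν, ∫ z, L z ∂(stateCurve b γ₀ ν ⟨T, right_mem_Icc.2 h⟩).meas =
      ∫ z, L (X ν T z.1, z.2) ∂γ₀.meas := by
    intro ν
    rw [stateCurve_meas hb h (ν.lintegral_fourth_ne_top hℓ) γ₀ (hX ν),
      integral_map (hXm ν).aemeasurable hL.continuous.aestronglyMeasurable]
  simp only [hint]
  set D := T - t₀ + N
  have hD0 : 0 ≤ D := add_nonneg (sub_nonneg.2 h) hN0
  refine tendsto_integral_filter_of_dominated_convergence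
    (fun z => K * (1 + 2 * D ^ 2 + 2 * (‖z.1‖ ^ 2 + ‖z.2‖ ^ 2)))
    (Eventually.of_forall fun ν => (hL.continuous.comp (hXm ν)).aestronglyMeasurable) ?_
    (((integrable_const _).add (γ₀.integrable_norm_sq.const_mul 2)).const_mul K)
    (ae_of_all _ fun z => ?_)
  · filter_upwards [self_mem_nhdsWithin] with ν hν
    refine ae_of_all _ fun z => ((hK _).1).trans ?_
    have h1 : ‖X ν T z.1 - z.1‖ ≤ D := by
      have h2 := (hX ν).norm_sub_le (hB ν) le_rfl h le_rfl z.1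
      rw [(hX ν).apply_start h] at h2
      exact h2.trans ((hB ν).modulus.integral_le (hN ν hν) (right_mem_Icc.2 h))
    have h2 : ‖X ν T z.1‖ ≤ D + ‖z.1‖ := by
      have := norm_add_le (X ν T z.1 - z.1) z.1
      rw [sub_add_cancel] at this
      linarith
    have h3 : ‖X ν T z.1‖ ^ 2 ≤ (D + ‖z.1‖) ^ 2 := pow_le_pow_left₀ (norm_nonneg _) h2 2
    refine mul_le_mul_of_nonneg_left ?_ hK0
    nlinarith [sq_nonneg (D - ‖z.1‖), sq_nonneg ‖z.2‖]
  · exact (hL.continuous.tendsto _).comp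
      ((tendsto_flow hℓ hb h hν₀ hX z.1).prodMk_nhds tendsto_const_nhds)

theorem totalCost_eq (ε : ℝ) (h : t₀ ≤ T) (γ₀ : PTwo d₁ d₂) (ν : AdmissibleControl ℓ t₀ T) :
    totalCost b L ε h γ₀ ν = ∫ z, L z ∂(stateCurve b γ₀ ν ⟨T, right_mem_Icc.2 h⟩).meas +
      ε * ν.totalEntropy.toReal := rfl

theorem RegularCost.exists_le_totalCost (hL : RegularCost L) (b : RSp d₁ → RSp d' → RSp d₁)
    (ε : ℝ) (h : t₀ ≤ T) (γ₀ : PTwo d₁ d₂) :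
    ∃ m : ℝ, ∀ ν : AdmissibleControl ℓ t₀ T,
      m + ε * ν.totalEntropy.toReal ≤ totalCost b L ε h γ₀ ν := by
  obtain ⟨m, hm⟩ := hL.bddBelow
  refine ⟨m, fun ν => ?_⟩
  rw [totalCost_eq]
  gcongr
  set γ := stateCurve b γ₀ ν ⟨T, right_mem_Icc.2 h⟩
  have := γ.isProbabilityMeasure
  calc m = ∫ _, m ∂γ.meas := by simp
    _ ≤ _ := integral_mono (integrable_const m) (hL.integrable γ) hm

/-- The terminal cost is handled only on entropy sublevels, so nearby controls are split in two.
Those of entropy at most `R` combine continuity of the terminal cost with lower semicontinuity of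
the entropy; the others already cost more than `y` through their entropy. -/
theorem lowerSemicontinuous_totalCost (hℓ : RegularPotential ℓ) (hb : DriftBounds b C)
    (hL : RegularCost L) {ε : ℝ} (hε : 0 < ε) (h : t₀ ≤ T) (γ₀ : PTwo d₁ d₂) :
    LowerSemicontinuous fun ν : AdmissibleControl ℓ t₀ T => totalCost b L ε h γ₀ ν := by
  obtain ⟨m, hm⟩ := hL.exists_le_totalCost (ℓ := ℓ) b ε h γ₀
  intro ν₀ y hy
  change y < totalCost b L ε h γ₀ ν₀ at hy
  change ∀ᶠ ν in 𝓝 ν₀, y < totalCost b L ε h γ₀ ν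
  rw [totalCost_eq] at hy
  set e₀ := ν₀.totalEntropy.toReal with he₀
  set F : AdmissibleControl ℓ t₀ T → ℝ := fun ν =>
    ∫ z, L z ∂(stateCurve b γ₀ ν ⟨T, right_mem_Icc.2 h⟩).meas with hF
  change y < F ν₀ + ε * e₀ at hy
  have he0 : 0 ≤ e₀ := ENNReal.toReal_nonneg
  -- A loss of `δ` in the terminal cost and of `δ` in the entropy uses up exactly the gap above `y`.
  set δ := (F ν₀ + ε * e₀ - y) / (1 + ε) with hδ
  have hδ0 : 0 < δ := div_pos (by linarith) (by linarith)
  have hδe : δ + ε * δ = F ν₀ + ε * e₀ - y := by rw [hδ]; field_simp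
  -- The first entry puts `ν₀` in the sublevel; the second makes `m + ε * R ≥ y`.
  set R := max e₀ ((|y| + |m|) / ε) with hR
  have hR0 : 0 ≤ R := he0.trans (le_max_left _ _)
  have hν₀ : ν₀.totalEntropy ≤ ENNReal.ofReal R := by
    rw [← ENNReal.ofReal_toReal ν₀.totalEntropy_ne_top]
    exact ENNReal.ofReal_le_ofReal (le_max_left _ _)
  have hF' := (tendsto_integral_stateCurve hℓ hb hL h γ₀ hν₀).eventually
    (lt_mem_nhds (show F ν₀ - δ < F ν₀ by linarith))
  rw [eventually_nhdsWithin_iff] at hF'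
  have hE : ∀ᶠ ν in 𝓝 ν₀, e₀ - δ < ν.totalEntropy.toReal := by
    rcases lt_or_ge (e₀ - δ) 0 with hneg | hpos
    · exact Eventually.of_forall fun ν => hneg.trans_le ENNReal.toReal_nonneg
    · filter_upwards [(isClosed_totalEntropy_le hℓ hpos).isOpen_compl.mem_nhds (x := ν₀) (by
        simp only [mem_compl_iff, mem_ofPred_eq, not_le]
        rw [ENNReal.ofReal_lt_iff_lt_toReal hpos ν₀.totalEntropy_ne_top]
        linarith)] with ν hν
      simp only [mem_compl_iff, mem_ofPred_eq, not_le] at hν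
      exact (ENNReal.ofReal_lt_iff_lt_toReal hpos ν.totalEntropy_ne_top).1 hν
  filter_upwards [hF', hE] with ν h1 h2
  by_cases hν : ν.totalEntropy ≤ ENNReal.ofReal R
  · have h3 : F ν₀ - δ < F ν := h1 hν
    rw [totalCost_eq]
    change y < F ν + ε * ν.totalEntropy.toReal
    have h4 := mul_lt_mul_of_pos_left h2 hε
    linarith
  · rw [not_le, ENNReal.ofReal_lt_iff_lt_toReal hR0 ν.totalEntropy_ne_top] at hν
    have h3 : (|y| + |m|) / ε < ν.totalEntropy.toReal := (le_max_right _ _).trans_lt hν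
    rw [div_lt_iff₀ hε] at h3
    have h4 := hm ν
    have h5 := le_abs_self y
    have h6 := neg_abs_le m
    linarith

/-- A cost at most `M` forces an entropy at most `(M - m) / ε`, so this is a closed part of a
compact entropy sublevel. -/
theorem isCompact_totalCost_le (hℓ : RegularPotential ℓ) (hb : DriftBounds b C)
    (hL : RegularCost L) {ε : ℝ} (hε : 0 < ε) (h : t₀ ≤ T) (γ₀ : PTwo d₁ d₂) (M : ℝ) :
    IsCompact {ν : AdmissibleControl ℓ t₀ T | totalCost b L ε h γ₀ ν ≤ M} := by
  obtain ⟨m, hm⟩ := hL.exists_le_totalCost (ℓ := ℓ) b ε h γ₀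
  refine (isCompact_totalEntropy_le hℓ (le_max_left 0 ((M - m) / ε))).of_isClosed_subset
    ((lowerSemicontinuous_totalCost hℓ hb hL hε h γ₀).isClosed_preimage M) fun ν hν => ?_
  rw [mem_ofPred_eq] at hν ⊢
  rw [← ENNReal.ofReal_toReal ν.totalEntropy_ne_top]
  refine ENNReal.ofReal_le_ofReal (le_max_of_le_right ?_)
  rw [le_div_iff₀ hε]
  linarith [hm ν]

/-- The constant control equal to the prior. -/
noncomputable def priorControl (hℓ : RegularPotential ℓ) (t₀ T : ℝ) : AdmissibleControl ℓ t₀ T where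
  kernel := Kernel.const _ (priorMeasure ℓ)
  isMarkovKernel := have := hℓ.isProbabilityMeasure; inferInstance
  entropy := by
    have := hℓ.isProbabilityMeasure
    simp

/-- Direct method on the sublevel at the cost of the prior control, which is compact and not empty.
-/
theorem exists_forall_totalCost_le (hℓ : RegularPotential ℓ) (hb : DriftBounds b C)
    (hL : RegularCost L) {ε : ℝ} (hε : 0 < ε) (h : t₀ ≤ T) (γ₀ : PTwo d₁ d₂) :
    ∃ νopt : AdmissibleControl ℓ t₀ T, ∀ ν : AdmissibleControl ℓ t₀ T,
      totalCost b L ε h γ₀ νopt ≤ totalCost b L ε h γ₀ ν := by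
  set J₀ := totalCost b L ε h γ₀ (priorControl hℓ t₀ T)
  obtain ⟨ν, hν, hmin⟩ := LowerSemicontinuousOn.exists_isMinOn
    (s := {ν : AdmissibleControl ℓ t₀ T | totalCost b L ε h γ₀ ν ≤ J₀}) ⟨priorControl hℓ t₀ T, le_refl J₀⟩
    (isCompact_totalCost_le hℓ hb hL hε h γ₀ J₀)
    ((lowerSemicontinuous_totalCost hℓ hb hL hε h γ₀).lowerSemicontinuousOn _)
  refine ⟨ν, fun η => ?_⟩
  by_cases hη : totalCost b L ε h γ₀ η ≤ J₀
  · exact hmin hη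
  · exact (show totalCost b L ε h γ₀ ν ≤ J₀ from hν).trans (not_le.1 hη).le

end Cost

theorem mainTheorem10 {d₁ d₂ d' : ℕ} (hd₁ : 1 ≤ d₁) (hd₂ : 1 ≤ d₂) (hd' : 1 ≤ d')
    (b : RSp d₁ → RSp d' → RSp d₁) (ℓ : RSp d' → ℝ) (L : RSp d₁ × RSp d₂ → ℝ)
    (hb : RegularField b) (hℓ : RegularPotential ℓ) (hL : RegularCost L)
    {ε T : ℝ} (hε : 0 < ε) (hT : 0 < T)
    (t₀ : ℝ) (ht₀ : t₀ ∈ Set.Icc 0 T) (γ₀ : PTwo d₁ d₂) :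
    -- every control drives exactly one curve, so that the cost is well defined
    (∀ ν : AdmissibleControl ℓ t₀ T, ∃! γ : Set.Icc t₀ T → PTwo d₁ d₂,
      IsContinuitySolution b ν γ₀ γ) ∧
    -- the sub-level sets are weakly compact
    (∀ M : ℝ, IsCompact (AdmissibleControl.toFiniteMeasure ''
      {ν : AdmissibleControl ℓ t₀ T | totalCost b L ε ht₀.2 γ₀ ν ≤ M})) ∧
    -- the cost is weakly lower semicontinuous
    LowerSemicontinuous (fun ν : AdmissibleControl ℓ t₀ T => totalCost b L ε ht₀.2 γ₀ ν) ∧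
    -- the control problem has a minimizer
    (∃ νopt : AdmissibleControl ℓ t₀ T, ∀ ν : AdmissibleControl ℓ t₀ T,
      totalCost b L ε ht₀.2 γ₀ νopt ≤ totalCost b L ε ht₀.2 γ₀ ν) := by
  obtain ⟨C, hC⟩ := hb.exists_driftBounds
  exact ⟨fun ν => existsUnique_isContinuitySolution hC ht₀.2 (ν.lintegral_fourth_ne_top hℓ) γ₀,
    fun M => (isCompact_totalCost_le hℓ hC hL hε ht₀.2 γ₀ M).image
      AdmissibleControl.isInducing_toFiniteMeasure.continuous,
    lowerSemicontinuous_totalCost hℓ hC hL hε ht₀.2 γ₀,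
    exists_forall_totalCost_le hℓ hC hL hε ht₀.2 γ₀⟩
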